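/- **Setting.** Let $N\ge 0$ be an integer, and let $\varphi:\mathbb R\to\mathbb R$ be a measurable father wavelet: its integer translates are orthonormal in $L^2(\mathbb R)$ and, with $g_{jk}(x)=2^{j/2}g(2^jx-k)$ and $V_j=\overline{\mathrm{span}}\{\varphi_{jk}:k\in\mathbb Z\}$, one has $V_j\subseteq V_{j+1}$ for all $j\in\mathbb Z$ and $\bigcup_jV_j$ is dense in $L^2(\mathbb R)$. Assume that $\varphi$ is $N+1$ times weakly differentiable with $\operatorname{ess\,sup}_x\sum_k|\varphi^{(N+1)}(x-k)|<\infty$, and that $|\varphi(u)|\le\Phi(|u|)$ for a bounded non-increasing $\Phi$ on $\mathbb R_+$ with $\int\Phi(|u|)\,du<\infty$ and $\int\Phi(|u|)|u|^N\,du<\infty$. Let $\psi$ be an associated mother wavelet, measurable and bounded: $\{\psi_{0k}\}_{k\in\mathbb Z}$ is an orthonormal basis of the orthogonal complement of $V_0$ in $V_1$. Both $\varphi$ and $\psi$ vanish outside $[-A,A]$. Let $1\le p,r<\infty$, $1\le q\le\infty$, $0<s<N+1$, $L,T>0$, put $s'=s-(1/p-1/r)_+$ and assume $s'>0$. Let $\mathcal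 D=\mathcal D^s_{pq}(L,T)$ be the set of probability densities $f$ on $\mathbb R$ that vanish outside $[-T,T]$ and satisfy $J_{spq}(f)\le L$, where $$J_{spq}(f)=\Big\|\Big(\int f\varphi_{0k}\Big)_{k}\Big\|_{\ell^p}+\Big\|\Big(2^{j(s+1/2-1/p)}\Big\|\Big(\int f\psi_{jk}\Big)_{k}\Big\|_{\ell^p}\Big)_{j\ge0}\Big\|_{\ell^q}.$$ **Estimator.** Let $X_1,\dots,X_n$ be i.i.d. with density $f\in\mathcal D$, let $\alpha>0$ and $j_1\in\mathbb N$, and put $\psi_{-1,k}=\varphi_{0k}$, $\mathcal N_j=\{k\in\mathbb Z:|k|\le 2^{\max(j,0)}T+A\}$ and $c_A=2\lceil A\rceil+1$. The private views are $Z_i=(Z_{ijk})_{-1\le j\le j_1,\,k\in\mathcal N_j}$ with $Z_{ijk}=\psi_{jk}(X_i)+\widetilde\sigma_jW_{ijk}$, where the $W_{ijk}$ are independent (also of the $X_i$) with density $\frac12e^{-|x|}$, $\widetilde\sigma_{-1}=4c_A\|\varphi\|_\infty/\alpha$, and $\widetilde\sigma_j=\frac{4c_A\|\psi\|_\infty}{\alpha}\cdot\frac{\sqrt2}{\sqrt2-1}\cdot2^{j_1/2}$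 for $0\le j\le j_1$. The linear estimator is $$\widehat f_{\mathrm{lin}}=\sum_{j=-1}^{j_1}\sum_{k\in\mathcal N_j}\Big(\frac1n\sum_{i=1}^nZ_{ijk}\Big)\psi_{jk}.$$ **Claim 1 (upper bound).** For all $0<c_1,c_2<\infty$ there is a constant $C>0$, depending only on $c_1,c_2,p,q,r,s,L,T,N,A,\varphi,\psi$, such that for all $n\ge1$, $\alpha>0$ and $j_1\in\mathbb N$ with $$c_1\,R_{n,\alpha}\le2^{j_1}\le c_2\,R_{n,\alpha},\qquad R_{n,\alpha}=(n\alpha^2)^{\frac1{2s'+2}}\wedge n^{\frac1{2s'+1}},\tag{$*$}$$ one has $$\sup_{f\in\mathcal D}\mathbb E\|\widehat f_{\mathrm{lin}}-f\|_r^r\le C\Big((n\alpha^2)^{-\frac{rs'}{2s'+2}}\vee n^{-\frac{rs'}{2s'+1}}\Big).$$ **Claim 2 (rate optimality for $p\ge r$).** Suppose that $p\ge r$ and that $\mathcal D^s_{pq}(L_0,T)\ne\emptyset$ for some $L_0<L$. Then for all $0<c_1,c_2<\infty$ and $\bar\alpha>0$ there is a constant $C>0$, depending only on these numbers and on $p,q,r,s,L,T,N,A,\varphi,\psi$,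 such that for all $n\ge1$, $\alpha\in(0,\bar\alpha]$ and $j_1\in\mathbb N$ with $(*)$, the channel $x\mapsto\mathcal L(Z_i\mid X_i=x)$ is $\alpha$-differentially private and $$\sup_{f\in\mathcal D}\mathbb E\|\widehat f_{\mathrm{lin}}-f\|_r^r\le C\,\inf_{Q,\widetilde f}\ \sup_{f\in\mathcal D}\mathbb E_{f,Q}\|\widetilde f-f\|_r^r.$$ Here a channel $Q$ from $\mathbb R$ to a measurable space is $\alpha$-differentially private if $Q(B\mid x)\le e^\alpha Q(B\mid x')$ for all $x,x'\in\mathbb R$ and all measurable $B$. The infimum runs over all sequentially interactive mechanisms $Z_i\sim Q_i(\cdot\mid X_i,Z_1,\dots,Z_{i-1})$ (Markov kernels with values in an arbitrary measurable space) for which $Q_i(\cdot\mid\cdot,z_1,\dots,z_{i-1})$ is $\alpha$-differentially private for all $i$ and all $z_1,\dots,z_{i-1}$, and over all measurable estimators $\widetilde f$ based on $Z_1,\dots,Z_n$. -/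

import Mathlib

open MeasureTheory ProbabilityTheory Set
open scoped ENNReal NNReal

universe u

noncomputable section

namespace PrivateWavelet

/-! ### Wavelet bases -/

/-- The dilated and translated function `g_{jk}(x) = 2^{j/2} g(2^j x - k)`. -/
def dil (g : ℝ → ℝ) (j k : ℤ) (x : ℝ) : ℝ :=
  (2 : ℝ) ^ ((j : ℝ) / 2) * g ((2 : ℝ) ^ j * x - k)

/-- The closed linear span in `L²(ℝ)` of the functions `g_{jk}`, `k ∈ ℤ`. -/
def shiftSpan (g : ℝ → ℝ) (j : ℤ) : Submodule ℝ (Lp ℝ 2 (volume : Measure ℝ)) :=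
  (Submodule.span ℝ {h : Lp ℝ 2 (volume : Measure ℝ) |
    ∃ k : ℤ, (h : ℝ → ℝ) =ᵐ[volume] dil g j k}).topologicalClosure

/-- `g` is square integrable and its integer translates form an orthonormal system in `L²(ℝ)`. -/
def OrthonormalShifts (g : ℝ → ℝ) : Prop :=
  MemLp g 2 volume ∧
    ∀ k l : ℤ, ∫ x, g (x - k) * g (x - l) = if k = l then 1 else 0

/-- `φ` generates a multiresolution analysis of `L²(ℝ)`. -/
structure GeneratesMRA (φ : ℝ → ℝ) : Prop where
  orthonormal : OrthonormalShifts φ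
  nested : ∀ j : ℤ, shiftSpan φ j ≤ shiftSpan φ (j + 1)
  dense : (⨆ j : ℤ, shiftSpan φ j).topologicalClosure = ⊤

/-- `ψ` is a mother wavelet associated with the father wavelet `φ`: its integer translates form an
orthonormal basis of the orthogonal complement of `V₀` in `V₁`. -/
structure IsMotherWavelet (φ ψ : ℝ → ℝ) : Prop where
  orthonormal : OrthonormalShifts ψ
  span_eq : shiftSpan ψ 0 = (shiftSpan φ 0)ᗮ ⊓ shiftSpan φ 1

/-- `g` is the weak derivative of order `m` of `f` on `ℝ`. -/
def IsWeakDeriv (m : ℕ) (f g : ℝ → ℝ) : Prop :=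
  LocallyIntegrable f volume ∧ LocallyIntegrable g volume ∧
    ∀ h : ℝ → ℝ, ContDiff ℝ (⊤ : ℕ∞) h → HasCompactSupport h →
      ∫ x, f x * iteratedDeriv m h x = (-1) ^ m * ∫ x, g x * h x

/-- The regularity assumption of order `N` on the father wavelet. -/
structure RegularFather (N : ℕ) (φ : ℝ → ℝ) : Prop where
  mra : GeneratesMRA φ
  weakDeriv : ∃ g : ℝ → ℝ, IsWeakDeriv (N + 1) φ g ∧
    ∃ M : ℝ≥0, ∀ᵐ x, ∑' k : ℤ, ‖g (x - k)‖ₑ ≤ M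
  decay : ∃ Φ : ℝ → ℝ, (∃ B : ℝ, ∀ t, 0 ≤ t → Φ t ≤ B) ∧ AntitoneOn Φ (Ici 0) ∧
    (∀ x, |φ x| ≤ Φ |x|) ∧ Integrable (fun x : ℝ => Φ |x|) volume ∧
    Integrable (fun x : ℝ => Φ |x| * |x| ^ N) volume

/-- A father wavelet `φ` of regularity `N` with an associated mother wavelet `ψ`, both vanishing
outside `[-A, A]`. Both are actual (measurable, bounded) functions, not classes modulo null
sets, because they are evaluated at data points and enter the noise level through their sup norm. -/
structure WaveletPair (N : ℕ) (A : ℝ) (φ ψ : ℝ → ℝ) : Prop where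
  father : RegularFather N φ
  mother : IsMotherWavelet φ ψ
  measurable_father : Measurable φ
  measurable_mother : Measurable ψ
  bounded_mother : ∃ B : ℝ, ∀ x, |ψ x| ≤ B
  support_father : Function.support φ ⊆ Icc (-A) A
  support_mother : Function.support ψ ⊆ Icc (-A) A

/-! ### Besov classes of densities -/

/-- The wavelet coefficient `∫ f g_{jk}`. -/
def coeff (g f : ℝ → ℝ) (j k : ℤ) : ℝ := ∫ x, f x * dil g j k x

/-- The Besov norm `J_{spq}(f) = ‖α_{0·}‖_p + ‖(2^{j(s + 1/2 - 1/p)} ‖β_{j·}‖_p)_{j ≥ 0}‖_q`,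
an extended nonnegative number; `q = ∞` is allowed. -/
def besovNorm (φ ψ : ℝ → ℝ) (s p : ℝ) (q : ℝ≥0∞) (f : ℝ → ℝ) : ℝ≥0∞ :=
  eLpNorm (fun k : ℤ => coeff φ f 0 k) (ENNReal.ofReal p) Measure.count +
    eLpNorm (fun j : ℕ => ENNReal.ofReal ((2 : ℝ) ^ ((j : ℝ) * (s + 1 / 2 - 1 / p))) *
        eLpNorm (fun k : ℤ => coeff ψ f j k) (ENNReal.ofReal p) Measure.count)
      q Measure.count

/-- The probability densities supported in `[-T, T]` that lie in the Besov ball of radius `L`. -/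
def densityClass (φ ψ : ℝ → ℝ) (s p : ℝ) (q : ℝ≥0∞) (L T : ℝ) : Set (ℝ → ℝ) :=
  {f | Measurable f ∧ (∀ x, 0 ≤ f x) ∧ Integrable f volume ∧ ∫ x, f x = 1 ∧
    Function.support f ⊆ Icc (-T) T ∧ besovNorm φ ψ s p q f ≤ ENNReal.ofReal L}

/-- The law on `ℝ` with density `f`. -/
def densityLaw (f : ℝ → ℝ) : Measure ℝ := volume.withDensity fun x => ENNReal.ofReal (f x)

/-- The loss `‖g - f‖_r^r`. -/
def lossPow (r : ℝ) (g f : ℝ → ℝ) : ℝ≥0∞ := ∫⁻ x, ‖g x - f x‖ₑ ^ r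

/-! ### The Laplace mechanism and the linear estimator -/

/-- The Laplace distribution with parameter `1`. -/
def laplaceLaw : Measure ℝ :=
  volume.withDensity fun x => ENNReal.ofReal (1 / 2 * Real.exp (-|x|))

/-- The sup norm of a bounded function. -/
def supNorm (g : ℝ → ℝ) : ℝ := ⨆ x, |g x|

/-- The set of translates `k` for which the interval `[(k - A) / 2^j, (k + A) / 2^j]` meets
`[-T, T]`, that is, `|k| ≤ 2^j T + A`. -/
def translates (A T : ℝ) (j : ℕ) : Finset ℤ :=
  Finset.Icc (-⌊(2 : ℝ) ^ j * T + A⌋) ⌊(2 : ℝ) ^ j * T + A⌋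

/-- The indices of the coefficients used up to resolution level `j₁`: the left summand indexes the
father coefficients (level `-1`), the right one the mother coefficients at the levels
`0, …, j₁`. -/
abbrev CoeffIndex (A T : ℝ) (j₁ : ℕ) : Type :=
  {k : ℤ // k ∈ translates A T 0} ⊕
    (Σ j : Fin (j₁ + 1), {k : ℤ // k ∈ translates A T (j : ℕ)})

/-- The basis function with a given index. -/
def atom (φ ψ : ℝ → ℝ) {A T : ℝ} {j₁ : ℕ} : CoeffIndex A T j₁ → ℝ → ℝ
  | .inl k => dil φ 0 (k : ℤ)
  | .inr ⟨j, k⟩ => dil ψ ((j : ℕ) : ℤ) (k : ℤ)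

/-- The constant `c_A = 2⌈A⌉ + 1`. -/
def overlap (A : ℝ) : ℝ := 2 * (⌈A⌉ : ℝ) + 1

/-- The noise level of the coefficient with a given index, at privacy level `α`. -/
def noiseScale (φ ψ : ℝ → ℝ) {A T : ℝ} {j₁ : ℕ} (α : ℝ) : CoeffIndex A T j₁ → ℝ
  | .inl _ => 4 * overlap A * supNorm φ / α
  | .inr _ => 4 * overlap A * supNorm ψ / α * (√2 / (√2 - 1)) * (2 : ℝ) ^ ((j₁ : ℝ) / 2)

/-- The private view `(Z_{jk})` of an observation `x`, with noise variables `w = (W_{jk})`. -/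
def privateView (φ ψ : ℝ → ℝ) {A T : ℝ} {j₁ : ℕ} (α x : ℝ) (w : CoeffIndex A T j₁ → ℝ) :
    CoeffIndex A T j₁ → ℝ :=
  fun c => atom φ ψ c x + noiseScale φ ψ α c * w c

/-- The law of independent Laplace noise variables `(W_{jk})`. -/
def noiseLaw (A T : ℝ) (j₁ : ℕ) : Measure (CoeffIndex A T j₁ → ℝ) :=
  Measure.pi fun _ => laplaceLaw

/-- The privacy channel: the conditional law of the private view given the observation `x`. -/
def laplaceChannel (φ ψ : ℝ → ℝ) (A T : ℝ) (j₁ : ℕ) (α x : ℝ) :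
    Measure (CoeffIndex A T j₁ → ℝ) :=
  (noiseLaw A T j₁).map (privateView φ ψ α x)

/-- The linear wavelet estimator computed from the private views `z₁, …, z_n`. -/
def linearEstimator (φ ψ : ℝ → ℝ) {A T : ℝ} {j₁ n : ℕ} (z : Fin n → CoeffIndex A T j₁ → ℝ)
    (x : ℝ) : ℝ :=
  ∑ c : CoeffIndex A T j₁, ((1 / (n : ℝ)) * ∑ i, z i c) * atom φ ψ c x

/-- The joint law of `(X_i, (W_{ijk})_{jk})`, `i = 1, …, n`: all variables are independent, the
`X_i` have density `f` and the `W_{ijk}` are Laplace distributed. -/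
def sampleLaw (f : ℝ → ℝ) (A T : ℝ) (j₁ n : ℕ) :
    Measure (Fin n → ℝ × (CoeffIndex A T j₁ → ℝ)) :=
  Measure.pi fun _ => (densityLaw f).prod (noiseLaw A T j₁)

/-- The integrated risk `E ‖f̂_lin - f‖_r^r` of the linear private estimator at the density `f`. -/
def linearRisk (φ ψ : ℝ → ℝ) (A T r : ℝ) (j₁ n : ℕ) (α : ℝ) (f : ℝ → ℝ) : ℝ≥0∞ :=
  ∫⁻ ω, lossPow r
      (linearEstimator φ ψ fun i => privateView φ ψ α (ω i).1 (ω i).2) f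
    ∂(sampleLaw f A T j₁ n)

/-! ### The private minimax risk -/

/-- A channel from `ℝ` to `Z` is `α`-differentially private. -/
def LocallyPrivate {Z : Type u} [MeasurableSpace Z] (α : ℝ) (Q : ℝ → Measure Z) : Prop :=
  ∀ x x' : ℝ, ∀ B : Set Z, MeasurableSet B → Q x B ≤ ENNReal.ofReal (Real.exp α) * Q x' B

/-- A sequentially interactive mechanism with values in `Z`: the next private view is drawn from
`channel i (x, z)`, where `x` is the observation of the next data holder and `z` is the vector of
the `i` private views released before. -/
structure Mechanism (Z : Type u) [MeasurableSpace Z] where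
  channel : ∀ i : ℕ, Kernel (ℝ × (Fin i → Z)) Z
  markov : ∀ i, IsMarkovKernel (channel i)

/-- The mechanism provides local `α`-differential privacy. -/
def Mechanism.IsPrivate {Z : Type u} [MeasurableSpace Z] (Q : Mechanism Z) (α : ℝ) : Prop :=
  ∀ (i : ℕ) (z : Fin i → Z), LocallyPrivate α fun x => Q.channel i (x, z)

/-- The law of the private views `(Z₁, …, Z_n)` when the observations are independent with
law `P`. -/
def Mechanism.viewLaw {Z : Type u} [MeasurableSpace Z] (Q : Mechanism Z) (P : Measure ℝ) :
    ∀ n : ℕ, Measure (Fin n → Z)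
  | 0 => Measure.dirac fun i => i.elim0
  | n + 1 =>
    ((Q.viewLaw P n) ⊗ₘ (Q.channel n ∘ₖ (Kernel.const (Fin n → Z) P ×ₖ Kernel.id))).map
      fun y => Fin.snoc (α := fun _ => Z) y.1 y.2

/-- The local `α`-differentially private minimax risk for the loss `‖· - ·‖_r^r` over a class `F`
of densities: the infimum over all private mechanisms and all (jointly measurable) estimators
based on the `n` private views of the maximal risk over `F`. -/
def privateMinimaxRisk (r : ℝ) (F : Set (ℝ → ℝ)) (n : ℕ) (α : ℝ) : ℝ≥0∞ :=
  ⨅ (Z : Type u) (_ : MeasurableSpace Z) (Q : Mechanism Z) (_ : Q.IsPrivate α)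
    (est : (Fin n → Z) → ℝ → ℝ) (_ : Measurable (Function.uncurry est)),
    ⨆ f ∈ F, ∫⁻ z, lossPow r (est z) f ∂(Q.viewLaw (densityLaw f) n)

/-! ### Rates -/

/-- The effective smoothness `s' = s - (1/p - 1/r)_+`. -/
def effSmoothness (s p r : ℝ) : ℝ := s - max (1 / p - 1 / r) 0

/-- `(n α²)^{1/(2t+2)} ∧ n^{1/(2t+1)}`. -/
def resolution (t : ℝ) (n : ℕ) (α : ℝ) : ℝ :=
  min (((n : ℝ) * α ^ 2) ^ (1 / (2 * t + 2))) ((n : ℝ) ^ (1 / (2 * t + 1)))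

/-- `(n α²)^{-rt/(2t+2)} ∨ n^{-rt/(2t+1)}`. -/
def rate (r t : ℝ) (n : ℕ) (α : ℝ) : ℝ :=
  max (((n : ℝ) * α ^ 2) ^ (-(r * t / (2 * t + 2)))) ((n : ℝ) ^ (-(r * t / (2 * t + 1))))

end PrivateWavelet

end

/-! ### Scaling, overlap and index counts for compactly supported wavelets -/

namespace PrivateWavelet

/-! Upper bound. The mean of the estimator is the wavelet partial sum of `f` through level `j₁`, so
the error splits into bias and stochastic error. For the bias, the `Lʳ` norm of one level is
controlled by the `ℓᵖ` norm of its coefficients (`exists_eLpNorm_levelPart_le`), which on the Besov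
ball makes level `j` of order `2^{-j s'}`; summing the geometric tail gives `2^{-j₁ s'}`
(`exists_approximation`). That the tail represents `f`, a priori only integrable, follows from `L¹`
convergence of the projections, deduced from the `L²` theory by truncation.

At a fixed point `x` the estimator is a mean of `n` independent bounded variables perturbed by
linear combinations of Laplace noise. Exponential moments give a Rosenthal type bound
(`lintegral_mean_rpow_le`) with three terms: range `2^{j₁}/n`, sampling deviation, and privacy
deviation `2^{j₁}/(α√n)`. Densities in the class need not be bounded, so the sampling variance is
kept in the form `(2^{j₁}/n) F(x)`, where `F` integrates `f` against a level-weighted kernel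
(`majorant`) whose marginal integrals are bounded uniformly in `j₁`. Schur's test then bounds `F` in
`Lʳ` by `f` in `Lʳ`. The two inequalities hidden in `R_{n,α}` make every term at most of order
`2^{-j₁ s'}` (`exists_linearRisk_le`).

Lower bound. This is an Assouad argument. A density in the interior of the ball, bounded below near
the origin, is perturbed by `2^{j₁}` signed wavelets with disjoint supports at level `j₁ + j₀`.
Reversing one sign changes the density in `L¹` by order `2^{-j₁(s+1)}`. A private channel contracts
this to a `χ²` distance of order `α² 2^{-2j₁(s+1)}` per observation, also under sequential
interaction (`Mechanism.sq_lintegral_viewLaw_le`). Hence if `nα² ≲ 2^{j₁(2s+2)}` no sign can be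
recovered and the risk is at least of order `2^{-j₁ r s}` (`exists_le_privateMinimaxRisk`).

The construction needs `∫ ψ = 0`, orthogonality between levels and a smooth bump of finite Besov
norm. The first and the last come from the regularity of `φ`: since `φ` is an iterated primitive
orthogonal to every `ψ_{jk}` with `j ≥ 0`, the iterated tail integrals of `ψ` through order `N + 1`
stay compactly supported (`exists_boundedSupported_iterate_tailIntegral`).

For `p ≥ r` one has `s' = s`, and for bounded `α` condition `(*)` forces `nα² ≲ 2^{j₁(2s+2)}` even
where the minimum defining `R_{n,α}` is the nonprivate term (`mul_sq_le_rpow_resolution`). Both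
bounds are then multiples of `2^{-j₁ r s}` for the same `j₁`. Privacy of the channel is a comparison
of shifted Laplace densities with the privacy budget spread over the coefficients. -/

/-- `g` is measurable, bounded by `B` and vanishes outside `[-A, A]`. -/
structure BoundedSupported (A B : ℝ) (g : ℝ → ℝ) : Prop where
  measurable : Measurable g
  bound : ∀ x, |g x| ≤ B
  support : Function.support g ⊆ Icc (-A) A

theorem lintegral_comp_affine (F : ℝ → ℝ≥0∞) {a : ℝ} (ha : 0 < a) (b : ℝ) :
    ∫⁻ x, F (a * x - b) = ENNReal.ofReal a⁻¹ * ∫⁻ x, F x := by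
  have h1 : ∫⁻ x, F (a * x - b) = ∫⁻ x, F (x - b) ∂(Measure.map (a * ·) volume) :=
    ((Homeomorph.mulLeft₀ a ha.ne').measurableEmbedding.lintegral_map
      (fun x => F (x - b))).symm
  rw [h1, Real.map_volume_mul_left ha.ne', lintegral_smul_measure,
    lintegral_sub_right_eq_self (μ := (volume : Measure ℝ)) F b, abs_of_pos (inv_pos.2 ha),
    smul_eq_mul]

theorem integral_comp_affine (F : ℝ → ℝ) {a : ℝ} (ha : 0 < a) (b : ℝ) :
    ∫ x, F (a * x - b) = a⁻¹ * ∫ x, F x := by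
  rw [Measure.integral_comp_mul_left (fun x => F (x - b)) a, integral_sub_right_eq_self F b,
    abs_of_pos (inv_pos.2 ha), smul_eq_mul]

theorem two_zpow_eq_rpow (j : ℤ) : (2 : ℝ) ^ j = (2 : ℝ) ^ (j : ℝ) :=
  (Real.rpow_intCast 2 j).symm

theorem sq_two_rpow_half (j : ℤ) : (2 : ℝ) ^ ((j : ℝ) / 2) * (2 : ℝ) ^ ((j : ℝ) / 2) = (2 : ℝ) ^ j := by
  rw [← Real.rpow_add two_pos, add_halves, two_zpow_eq_rpow]

theorem dil_zero_left (g : ℝ → ℝ) (k : ℤ) (x : ℝ) : dil g 0 k x = g (x - k) := by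
  simp [dil]

/-- The finite set of translates overlapping a point has at most `2⌈A⌉ + 1` elements. -/
theorem card_overlap {A : ℝ} (hA : 0 ≤ A) (y : ℝ) (s : Finset ℤ)
    (hs : ∀ k ∈ s, |y - k| ≤ A) : (s.card : ℝ) ≤ overlap A := by
  have hsub : s ⊆ Finset.Icc ⌈y - A⌉ ⌊y + A⌋ := by
    intro k hk
    have := abs_le.1 (hs k hk)
    rw [Finset.mem_Icc, Int.ceil_le, Int.le_floor]
    constructor <;> linarith
  have h1 : (s.card : ℝ) ≤ ((Finset.Icc ⌈y - A⌉ ⌊y + A⌋).card : ℝ) := by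
    exact_mod_cast Finset.card_le_card hsub
  refine h1.trans ?_
  rw [Int.card_Icc]
  have h2 : ((⌊y + A⌋ + 1 - ⌈y - A⌉ : ℤ) : ℝ) ≤ 2 * A + 1 := by
    push_cast
    linarith [Int.floor_le (y + A), Int.le_ceil (y - A)]
  have h3 : (((⌊y + A⌋ + 1 - ⌈y - A⌉).toNat : ℤ) : ℝ) ≤ 2 * A + 1 := by
    rw [Int.toNat_eq_max]
    push_cast at h2 ⊢
    exact max_le h2 (by linarith)
  unfold overlap
  have := Int.le_ceil A
  have h4 : (((⌊y + A⌋ + 1 - ⌈y - A⌉).toNat : ℤ) : ℝ)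
      = ((⌊y + A⌋ + 1 - ⌈y - A⌉).toNat : ℝ) := by norm_cast
  linarith

theorem one_le_overlap {A : ℝ} (hA : 0 ≤ A) : 1 ≤ overlap A := by
  unfold overlap
  have : (0 : ℝ) ≤ ⌈A⌉ := hA.trans (Int.le_ceil A)
  linarith

namespace BoundedSupported

variable {A B : ℝ} {g : ℝ → ℝ}

theorem nonneg (hg : BoundedSupported A B g) : 0 ≤ B := (abs_nonneg _).trans (hg.bound 0)

theorem abs_le_of_ne (hg : BoundedSupported A B g) {x : ℝ} (hx : g x ≠ 0) : |x| ≤ A :=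
  abs_le.2 (hg.support hx)

theorem eq_zero (hg : BoundedSupported A B g) {x : ℝ} (hx : A < |x|) : g x = 0 := by
  by_contra h
  exact absurd (hg.abs_le_of_ne h) (not_le.2 hx)

theorem memLp (hg : BoundedSupported A B g) (p : ℝ≥0∞) : MemLp g p volume := by
  have h1 : g = indicator (Icc (-A) A) g := by
    rw [indicator_eq_self.2 hg.support]
  rw [h1, memLp_indicator_iff_restrict measurableSet_Icc]
  exact MemLp.of_bound hg.measurable.aestronglyMeasurable B
    (Filter.Eventually.of_forall fun x => hg.bound x)

theorem integrable (hg : BoundedSupported A B g) : Integrable g volume :=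
  memLp_one_iff_integrable.1 (hg.memLp 1)

theorem integrable_mul (hg : BoundedSupported A B g) {f : ℝ → ℝ} (hf : Integrable f volume) :
    Integrable (fun x => f x * g x) volume :=
  hf.mul_bdd (c := B) hg.measurable.aestronglyMeasurable
    (Filter.Eventually.of_forall fun x => by simpa using hg.bound x)

theorem measurable_dil (hg : BoundedSupported A B g) (j k : ℤ) : Measurable (dil g j k) := by
  unfold dil
  exact (hg.measurable.comp ((measurable_id.const_mul _).sub_const _)).const_mul _

theorem abs_dil_le (hg : BoundedSupported A B g) (j k : ℤ) (x : ℝ) :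
    |dil g j k x| ≤ (2 : ℝ) ^ ((j : ℝ) / 2) * B := by
  unfold dil
  rw [abs_mul, abs_of_pos (Real.rpow_pos_of_pos two_pos _)]
  exact mul_le_mul_of_nonneg_left (hg.bound _) (Real.rpow_nonneg two_pos.le _)

theorem dil_support (hg : BoundedSupported A B g) {j k : ℤ} {x : ℝ} (hx : dil g j k x ≠ 0) :
    |(2 : ℝ) ^ j * x - k| ≤ A :=
  hg.abs_le_of_ne (right_ne_zero_of_mul hx)

theorem dil (hg : BoundedSupported A B g) (j k : ℤ) :
    BoundedSupported (((2 : ℝ) ^ j)⁻¹ * (A + |(k : ℝ)|)) ((2 : ℝ) ^ ((j : ℝ) / 2) * B)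
      (dil g j k) := by
  refine ⟨hg.measurable_dil j k, hg.abs_dil_le j k, fun x hx => ?_⟩
  have h := hg.dil_support hx
  have h2 : (0 : ℝ) < 2 ^ j := by positivity
  rw [mem_Icc, ← abs_le, ← div_eq_inv_mul, le_div_iff₀ h2]
  calc |x| * 2 ^ j = |2 ^ j * x - k + k| := by
        rw [sub_add_cancel, abs_mul, abs_of_pos h2, mul_comm]
    _ ≤ _ := (abs_add_le _ _).trans (by linarith)

/-- At most `2⌈A⌉ + 1` translates are nonzero at a point. -/
theorem card_ne_zero_le (hg : BoundedSupported A B g) (hA : 0 ≤ A) (s : Finset ℤ) (y : ℝ) :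
    ((s.filter fun k : ℤ => g (y - k) ≠ 0).card : ℝ) ≤ overlap A :=
  card_overlap hA y _ fun _ hk => hg.abs_le_of_ne (Finset.mem_filter.1 hk).2

theorem sum_abs_le (hg : BoundedSupported A B g) (hA : 0 ≤ A) (s : Finset ℤ) (y : ℝ) :
    ∑ k ∈ s, |g (y - k)| ≤ overlap A * B := by
  calc ∑ k ∈ s, |g (y - k)| = ∑ k ∈ s.filter (fun k : ℤ => g (y - k) ≠ 0), |g (y - k)| := by
        rw [Finset.sum_filter]
        refine Finset.sum_congr rfl fun k _ => ?_
        by_cases h : g (y - k) = 0 <;> simp [h]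
    _ ≤ (s.filter fun k : ℤ => g (y - k) ≠ 0).card • B :=
        Finset.sum_le_card_nsmul _ _ _ fun k _ => hg.bound _
    _ ≤ overlap A * B := by
        rw [nsmul_eq_mul]
        exact mul_le_mul_of_nonneg_right (hg.card_ne_zero_le hA s y) hg.nonneg

theorem sum_abs_dil_le (hg : BoundedSupported A B g) (hA : 0 ≤ A) (s : Finset ℤ) (j : ℤ) (x : ℝ) :
    ∑ k ∈ s, |PrivateWavelet.dil g j k x| ≤ (2 : ℝ) ^ ((j : ℝ) / 2) * (overlap A * B) := by
  simp only [PrivateWavelet.dil, abs_mul, abs_of_pos (Real.rpow_pos_of_pos two_pos _),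
    ← Finset.mul_sum]
  exact mul_le_mul_of_nonneg_left (hg.sum_abs_le hA s _) (Real.rpow_nonneg two_pos.le _)

end BoundedSupported

theorem lintegral_dil_rpow (g : ℝ → ℝ) (j k : ℤ) {r : ℝ} (hr : 0 ≤ r) :
    ∫⁻ x, ‖dil g j k x‖ₑ ^ r =
      ENNReal.ofReal ((2 : ℝ) ^ ((j : ℝ) * (r / 2 - 1))) * ∫⁻ x, ‖g x‖ₑ ^ r := by
  have h0 : (0 : ℝ) < 2 ^ j := by positivity
  have h1 : ∀ x, ‖dil g j k x‖ₑ ^ r = ENNReal.ofReal ((2 : ℝ) ^ ((j : ℝ) / 2 * r)) *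
      ‖g ((2 : ℝ) ^ j * x - k)‖ₑ ^ r := by
    intro x
    rw [dil, enorm_mul, ENNReal.mul_rpow_of_nonneg _ _ hr,
      Real.enorm_of_nonneg (Real.rpow_nonneg two_pos.le _),
      ENNReal.ofReal_rpow_of_nonneg (Real.rpow_nonneg two_pos.le _) hr,
      ← Real.rpow_mul two_pos.le]
  simp only [h1]
  rw [lintegral_const_mul' _ _ ENNReal.ofReal_ne_top,
    lintegral_comp_affine (fun x => ‖g x‖ₑ ^ r) h0, ← mul_assoc, ← ENNReal.ofReal_mul (by positivity)]
  congr 2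
  rw [two_zpow_eq_rpow, ← Real.rpow_neg two_pos.le, ← Real.rpow_add two_pos]
  congr 1
  ring

theorem integral_dil_mul_dil (g h : ℝ → ℝ) (j k l : ℤ) :
    ∫ x, dil g j k x * dil h j l x = ∫ x, g (x - k) * h (x - l) := by
  have h0 : (0 : ℝ) < 2 ^ j := by positivity
  have h1 : ∀ x, dil g j k x * dil h j l x =
      (2 : ℝ) ^ j * (g ((2 : ℝ) ^ j * x - 0 - k) * h ((2 : ℝ) ^ j * x - 0 - l)) := by
    intro x
    rw [dil, dil, ← sq_two_rpow_half j, sub_zero]; ring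
  simp only [h1]
  rw [integral_const_mul, integral_comp_affine (fun x => g (x - k) * h (x - l)) h0, ← mul_assoc,
    mul_inv_cancel₀ h0.ne', one_mul]

theorem OrthonormalShifts.integral_dil {g : ℝ → ℝ} (hg : OrthonormalShifts g) (j k l : ℤ) :
    ∫ x, dil g j k x * dil g j l x = if k = l then 1 else 0 := by
  rw [integral_dil_mul_dil, hg.2]

/-- A function carried by at most one point vanishes almost everywhere and cannot have norm one.
This supplies the sign of `A`, which is not assumed. -/
theorem OrthonormalShifts.pos_of_supported {g : ℝ → ℝ} (hg : OrthonormalShifts g) {A : ℝ}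
    (h : Function.support g ⊆ Icc (-A) A) : 0 < A := by
  by_contra hA
  have h1 : ∀ᵐ x, g x = 0 := by
    have h2 : ∀ᵐ x : ℝ, x ≠ 0 := by
      simp [ae_iff, measure_singleton]
    filter_upwards [h2] with x hx
    by_contra hne
    have := h hne
    rw [mem_Icc] at this
    exact hx (by linarith)
  have h3 := hg.2 0 0
  simp only [Int.cast_zero, sub_zero, if_true] at h3
  rw [integral_congr_ae (g := fun _ => (0 : ℝ)) (by filter_upwards [h1] with x hx; simp [hx])] at h3
  simp at h3

/-- Outside the index range the supports are disjoint. This is why every projection of a function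
carried by `[-T, T]` is a finite sum. -/
theorem coeff_eq_zero {A B T : ℝ} {g f : ℝ → ℝ} (hg : BoundedSupported A B g)
    (hf : Function.support f ⊆ Icc (-T) T) (j : ℕ) {k : ℤ} (hk : k ∉ translates A T j) :
    coeff g f j k = 0 := by
  unfold coeff
  have : ∀ x, f x * dil g j k x = 0 := by
    intro x
    by_contra hne
    have h1 := abs_le.2 (hf (left_ne_zero_of_mul hne))
    have h2 := hg.dil_support (right_ne_zero_of_mul hne)
    apply hk
    have h3 : |(k : ℝ)| ≤ 2 ^ j * T + A := by
      have h4 : (k : ℝ) = 2 ^ j * x - ((2 : ℝ) ^ (j : ℤ) * x - k) := by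
        rw [zpow_natCast]; ring
      rw [h4]
      refine (abs_sub _ _).trans (add_le_add ?_ h2)
      rw [abs_mul, abs_of_pos (by positivity)]
      gcongr
    rw [translates, Finset.mem_Icc, neg_le, Int.le_floor, Int.le_floor]
    push_cast
    constructor <;> linarith [abs_le.1 h3]
  simp [this]

theorem card_translates_le {A T : ℝ} (hA : 0 ≤ A) (hT : 0 ≤ T) (j : ℕ) :
    ((translates A T j).card : ℝ) ≤ (2 * (T + A) + 1) * 2 ^ j := by
  have h0 : 0 ≤ (2 : ℝ) ^ j * T + A := by positivity
  have h1 : (1 : ℝ) ≤ 2 ^ j := one_le_pow₀ one_le_two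
  have h2 : 0 ≤ ⌊(2 : ℝ) ^ j * T + A⌋ := Int.floor_nonneg.2 h0
  rw [translates, Int.card_Icc]
  have h3 : (((⌊(2 : ℝ) ^ j * T + A⌋ + 1 - -⌊(2 : ℝ) ^ j * T + A⌋).toNat : ℤ) : ℝ)
      = 2 * (⌊(2 : ℝ) ^ j * T + A⌋ : ℝ) + 1 := by
    rw [Int.toNat_of_nonneg (by omega)]
    push_cast; ring
  have h4 := Int.floor_le ((2 : ℝ) ^ j * T + A)
  have h5 : (((⌊(2 : ℝ) ^ j * T + A⌋ + 1 - -⌊(2 : ℝ) ^ j * T + A⌋).toNat : ℤ) : ℝ)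
      = ((⌊(2 : ℝ) ^ j * T + A⌋ + 1 - -⌊(2 : ℝ) ^ j * T + A⌋).toNat : ℝ) := by norm_cast
  rw [← h5, h3]
  nlinarith

end PrivateWavelet

namespace PrivateWavelet

/-! ### Projections onto the resolution spaces -/

/-- The wavelet projection at level `j` of a function that vanishes outside `[-T, T]`. -/
noncomputable def levelPart (g : ℝ → ℝ) (A T : ℝ) (j : ℕ) (f : ℝ → ℝ) (x : ℝ) : ℝ :=
  ∑ k ∈ translates A T j, coeff g f j k * dil g j k x

section Projection

open scoped InnerProductSpace

instance hasOrthogonalProjection_shiftSpan (g : ℝ → ℝ) (j : ℤ) :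
    (shiftSpan g j).HasOrthogonalProjection := by
  have : CompleteSpace (shiftSpan g j) :=
    (Submodule.isClosed_topologicalClosure _).completeSpace_coe
  infer_instance

variable {A B T : ℝ} {g f : ℝ → ℝ}

theorem inner_toLp {f g : ℝ → ℝ} (hf : MemLp f 2 volume) (hg : MemLp g 2 volume) :
    ⟪hf.toLp f, hg.toLp g⟫_ℝ = ∫ x, f x * g x := by
  rw [MeasureTheory.L2.inner_def]
  refine integral_congr_ae ?_
  filter_upwards [hf.coeFn_toLp, hg.coeFn_toLp] with x h1 h2
  rw [h1, h2]
  simp [mul_comm]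

theorem mem_orthogonal_shiftSpan (hg : BoundedSupported A B g) (j : ℤ)
    (u : Lp ℝ 2 (volume : Measure ℝ))
    (h : ∀ k : ℤ, ⟪((hg.dil j k).memLp 2).toLp _, u⟫_ℝ = 0) : u ∈ (shiftSpan g j)ᗮ := by
  rw [shiftSpan, Submodule.orthogonal_closure, Submodule.mem_orthogonal]
  intro v hv
  induction hv using Submodule.span_induction with
  | mem v hv =>
    obtain ⟨k, hk⟩ := hv
    have : v = ((hg.dil j k).memLp 2).toLp _ :=
      Lp.ext (hk.trans ((hg.dil j k).memLp 2).coeFn_toLp.symm)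
    rw [this, h]
  | zero => simp
  | add x y _ _ hx hy => rw [inner_add_left, hx, hy, add_zero]
  | smul a x _ hx => rw [inner_smul_left, hx, mul_zero]

theorem toLp_dil_mem_shiftSpan (hg : BoundedSupported A B g) (j k : ℤ) :
    ((hg.dil j k).memLp 2).toLp _ ∈ shiftSpan g j :=
  Submodule.le_topologicalClosure _
    (Submodule.subset_span ⟨k, ((hg.dil j k).memLp 2).coeFn_toLp⟩)

/-- The finite sum lies in the closed span, and the residual is orthogonal to every generator: by
orthonormality for indices in `translates`, and because both terms vanish for the others. -/
theorem starProjection_shiftSpan (hg : BoundedSupported A B g) (ho : OrthonormalShifts g)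
    (hf : MemLp f 2 volume) (hfT : Function.support f ⊆ Icc (-T) T) (j : ℕ) :
    (shiftSpan g j).starProjection (hf.toLp f) =
      ∑ k ∈ translates A T j, coeff g f j k • ((hg.dil j k).memLp 2).toLp _ := by
  refine Submodule.eq_starProjection_of_mem_orthogonal
    (Submodule.sum_mem _ fun k _ => Submodule.smul_mem _ _ (toLp_dil_mem_shiftSpan hg j k)) ?_
  refine mem_orthogonal_shiftSpan hg j _ fun l => ?_
  rw [inner_sub_right, inner_sum, inner_toLp]
  simp only [inner_smul_right, inner_toLp, ho.integral_dil]
  have h1 : ∫ x, dil g j l x * f x = coeff g f j l := by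
    unfold coeff; simp only [mul_comm]
  rw [h1]
  by_cases hl : l ∈ translates A T j
  · simp [hl]
  · simp [hl, coeff_eq_zero hg hfT j hl]

theorem coeFn_sum_toLp (hg : BoundedSupported A B g) (j : ℕ) (s : Finset ℤ) (c : ℤ → ℝ) :
    (((∑ k ∈ s, c k • ((hg.dil j k).memLp 2).toLp _ : Lp ℝ 2 (volume : Measure ℝ))) : ℝ → ℝ)
      =ᵐ[volume] fun x => ∑ k ∈ s, c k * dil g j k x := by
  have h1 : (∑ k ∈ s, c k • ((hg.dil j k).memLp 2).toLp (dil g j k)) =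
      (memLp_finsetSum s fun k _ => ((hg.dil j k).memLp 2).const_mul (c k)).toLp
        (fun x => ∑ k ∈ s, c k * dil g j k x) := by
    classical
    induction s using Finset.induction_on with
    | empty => 
      symm
      simp only [Finset.sum_empty]
      exact MemLp.toLp_zero _
    | insert a s ha ih =>
      rw [Finset.sum_insert ha, ih]
      apply Lp.ext
      refine (Lp.coeFn_add _ _).trans ?_
      refine .trans ?_ (MemLp.coeFn_toLp _).symm
      filter_upwards [Lp.coeFn_smul (c a) (((hg.dil j a).memLp 2).toLp _),
        ((hg.dil j a).memLp 2).coeFn_toLp,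
        (memLp_finsetSum s fun k _ => ((hg.dil j k).memLp 2).const_mul (c k)).coeFn_toLp]
        with x h1 h2 h3
      rw [Pi.add_apply, h1, h3, Finset.sum_insert ha, Pi.smul_apply, h2, smul_eq_mul]
  rw [h1]
  exact MemLp.coeFn_toLp _

theorem coeFn_starProjection_shiftSpan (hg : BoundedSupported A B g) (ho : OrthonormalShifts g)
    (hf : MemLp f 2 volume) (hfT : Function.support f ⊆ Icc (-T) T) (j : ℕ) :
    ((shiftSpan g j).starProjection (hf.toLp f) : ℝ → ℝ) =ᵐ[volume] levelPart g A T j f := by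
  rw [starProjection_shiftSpan hg ho hf hfT]
  exact coeFn_sum_toLp hg j _ _

/-- If `W = Uᗮ ⊓ V` with `U ≤ V`, the projection onto `V` splits. -/
theorem starProjection_split {E : Type*} [NormedAddCommGroup E] [InnerProductSpace ℝ E]
    (U V W : Submodule ℝ E) [U.HasOrthogonalProjection] [V.HasOrthogonalProjection]
    [W.HasOrthogonalProjection] (hUV : U ≤ V) (hW : W = Uᗮ ⊓ V) (x : E) :
    V.starProjection x = U.starProjection x + W.starProjection x := by
  have h : W.starProjection x = V.starProjection x - U.starProjection x := by
    refine Submodule.eq_starProjection_of_mem_of_inner_eq_zero ?_ ?_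
    · rw [hW]
      refine ⟨?_, V.sub_mem (V.starProjection_apply_mem x) (hUV (U.starProjection_apply_mem x))⟩
      have h1 : V.starProjection x - U.starProjection x =
          (x - U.starProjection x) - (x - V.starProjection x) := by abel
      rw [h1]
      exact Uᗮ.sub_mem (Submodule.sub_starProjection_mem_orthogonal x)
        (Submodule.orthogonal_le hUV (Submodule.sub_starProjection_mem_orthogonal x))
    · intro w hw
      rw [hW] at hw
      have h1 : x - (V.starProjection x - U.starProjection x) =
          (x - V.starProjection x) + U.starProjection x := by abel
      rw [h1, inner_add_left,
        (Submodule.mem_orthogonal' _ _).1 (Submodule.sub_starProjection_mem_orthogonal x) w hw.2,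
        (Submodule.mem_orthogonal _ _).1 hw.1 _ (U.starProjection_apply_mem x), add_zero]
  rw [h]; abel

end Projection

/-! ### The two-scale decomposition -/

theorem dil_comp_dilation (g : ℝ → ℝ) (i j : ℕ) (k : ℤ) (x : ℝ) :
    (2 : ℝ) ^ ((j : ℝ) / 2) * dil g i k (2 ^ j * x) = dil g ((i + j : ℕ) : ℤ) k x := by
  unfold dil
  rw [← mul_assoc, ← Real.rpow_add two_pos, ← mul_assoc, zpow_natCast, zpow_natCast, ← pow_add]
  congr 2
  push_cast; ring

theorem coeff_comp_dilation (g f : ℝ → ℝ) (i j : ℕ) (k : ℤ) :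
    coeff g (fun x => f (((2 : ℝ) ^ j)⁻¹ * x)) i k =
      (2 : ℝ) ^ ((j : ℝ) / 2) * coeff g f ((i + j : ℕ) : ℤ) k := by
  unfold coeff
  have h0 : (0 : ℝ) < (2 ^ j)⁻¹ := by positivity
  have h1 : ∀ x, f (((2 : ℝ) ^ j)⁻¹ * x) * dil g i k x =
      (fun y => f y * dil g i k (2 ^ j * y)) (((2 : ℝ) ^ j)⁻¹ * x - 0) := by
    intro x
    simp only [sub_zero]
    rw [mul_inv_cancel_left₀ (by positivity)]
  simp only [h1]
  rw [integral_comp_affine (fun y => f y * dil g i k (2 ^ j * y)) h0 0, inv_inv,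
    ← integral_const_mul, ← integral_const_mul]
  congr 1
  ext x
  have h2 : dil g i k (2 ^ j * x) = (2 : ℝ) ^ (-((j : ℝ) / 2)) * dil g ((i + j : ℕ) : ℤ) k x := by
    rw [← dil_comp_dilation, ← mul_assoc, ← Real.rpow_add two_pos]
    simp
  rw [h2]
  have h3 : (2 : ℝ) ^ j = (2 : ℝ) ^ ((j : ℝ) / 2) * (2 : ℝ) ^ ((j : ℝ) / 2) := by
    rw [← Real.rpow_add two_pos, add_halves, Real.rpow_natCast]
  have h4 : (2 : ℝ) ^ ((j : ℝ) / 2) * (2 : ℝ) ^ (-((j : ℝ) / 2)) = 1 := by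
    rw [← Real.rpow_add two_pos]; simp
  rw [h3]
  linear_combination (2 : ℝ) ^ ((j : ℝ) / 2) * f x * dil g ((i + j : ℕ) : ℤ) k x * h4

/-- Stretching `f` by `2^j` stretches its support to radius `2^j T`, and with this radius the index
sets of the two sides coincide exactly. -/
theorem levelPart_comp_dilation (g f : ℝ → ℝ) (A T : ℝ) (i j : ℕ) (x : ℝ) :
    levelPart g A (2 ^ j * T) i (fun x => f (((2 : ℝ) ^ j)⁻¹ * x)) (2 ^ j * x) =
      levelPart g A T (i + j) f x := by
  unfold levelPart
  have h1 : translates A (2 ^ j * T) i = translates A T (i + j) := by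
    unfold translates
    rw [← mul_assoc, ← pow_add]
  rw [h1]
  refine Finset.sum_congr rfl fun k _ => ?_
  rw [coeff_comp_dilation, ← dil_comp_dilation g i j k x]
  ring

theorem levelPart_one_of_memLp {A B T : ℝ} {φ ψ f : ℝ → ℝ} (hφ : BoundedSupported A B φ)
    (hψ : BoundedSupported A B ψ) (hm : GeneratesMRA φ) (hw : IsMotherWavelet φ ψ)
    (hf : MemLp f 2 volume) (hfT : Function.support f ⊆ Icc (-T) T) :
    levelPart φ A T 1 f =ᵐ[volume] fun x => levelPart φ A T 0 f x + levelPart ψ A T 0 f x := by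
  have h1 := starProjection_split (shiftSpan φ 0) (shiftSpan φ 1) (shiftSpan ψ 0)
    (hm.nested 0) hw.span_eq (hf.toLp f)
  have e1 := coeFn_starProjection_shiftSpan hφ hm.orthonormal hf hfT 1
  have e2 := coeFn_starProjection_shiftSpan hφ hm.orthonormal hf hfT 0
  have e3 := coeFn_starProjection_shiftSpan hψ hw.orthonormal hf hfT 0
  have h2 := Lp.coeFn_add ((shiftSpan φ 0).starProjection (hf.toLp f))
    ((shiftSpan ψ 0).starProjection (hf.toLp f))
  rw [← h1] at h2
  simp only [Nat.cast_one, Nat.cast_zero] at e1 e2 e3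
  filter_upwards [e1, e2, e3, h2] with x h1 h2 h3 h4
  rw [← h1, ← h2, ← h3, h4, Pi.add_apply]

theorem memLp_comp_dilation {f : ℝ → ℝ} (hf : MemLp f 2 volume) {a : ℝ} (ha : a ≠ 0) :
    MemLp (fun x => f (a * x)) 2 volume := by
  have h : MemLp f 2 (Measure.map (a * ·) volume) := by
    rw [Real.map_volume_mul_left ha]
    exact hf.smul_measure ENNReal.ofReal_ne_top
  exact h.comp_of_map (measurable_const_mul a).aemeasurable

theorem ae_comp_mul_left {p : ℝ → Prop} (h : ∀ᵐ x, p x) {a : ℝ} (ha : a ≠ 0) : ∀ᵐ x, p (a * x) := by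
  have h1 : ∀ᵐ x ∂(Measure.map (a * ·) volume), p x := by
    rw [Real.map_volume_mul_left ha]
    exact Measure.ae_smul_measure h _
  exact ae_of_ae_map (measurable_const_mul a).aemeasurable h1

/-- `IsMotherWavelet` only relates levels `0` and `1`. The general two-scale identity is that one,
applied to the stretched function `x ↦ f (2⁻ʲ x)` and scaled back. -/
theorem levelPart_succ_of_memLp {A B T : ℝ} {φ ψ f : ℝ → ℝ} (hφ : BoundedSupported A B φ)
    (hψ : BoundedSupported A B ψ) (hm : GeneratesMRA φ) (hw : IsMotherWavelet φ ψ)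
    (hf : MemLp f 2 volume) (hfT : Function.support f ⊆ Icc (-T) T) (j : ℕ) :
    levelPart φ A T (j + 1) f =ᵐ[volume]
      fun x => levelPart φ A T j f x + levelPart ψ A T j f x := by
  have h0 : (0 : ℝ) < 2 ^ j := by positivity
  have h1 := levelPart_one_of_memLp (T := 2 ^ j * T) hφ hψ hm hw
    (memLp_comp_dilation hf (inv_ne_zero h0.ne')) (by
      intro x hx
      have h2 := abs_le.2 (hfT hx)
      rw [abs_mul, abs_of_pos (inv_pos.2 h0), inv_mul_le_iff₀ h0] at h2
      exact abs_le.1 h2)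
  filter_upwards [ae_comp_mul_left h1 h0.ne'] with x hx
  simp only [levelPart_comp_dilation, zero_add] at hx
  rw [add_comm j 1]
  exact hx

/-! ### Truncation -/

/-- Truncation of `f` at height `M`. -/
noncomputable def truncate (M : ℕ) (f : ℝ → ℝ) (x : ℝ) : ℝ := max (-(M : ℝ)) (min (f x) M)

theorem abs_truncate_le (M : ℕ) (f : ℝ → ℝ) (x : ℝ) : |truncate M f x| ≤ M := by
  unfold truncate
  have : (0 : ℝ) ≤ M := M.cast_nonneg
  rw [abs_le]
  exact ⟨le_max_left _ _, max_le (by linarith) (min_le_right _ _)⟩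

theorem abs_truncate_le_abs (M : ℕ) (f : ℝ → ℝ) (x : ℝ) : |truncate M f x| ≤ |f x| := by
  unfold truncate
  have : (0 : ℝ) ≤ M := M.cast_nonneg
  rcases le_total 0 (f x) with h | h
  · rw [max_eq_right (le_trans (by linarith) (le_min h this)), abs_of_nonneg (le_min h this),
      abs_of_nonneg h]
    exact min_le_left _ _
  · rw [min_eq_left (h.trans this), abs_of_nonpos (max_le (by linarith) h), abs_of_nonpos h]
    exact neg_le_neg (le_max_right _ _)

theorem truncate_eventually_eq (f : ℝ → ℝ) (x : ℝ) :
    ∀ᶠ M : ℕ in Filter.atTop, truncate M f x = f x := by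
  filter_upwards [Filter.eventually_ge_atTop ⌈|f x|⌉₊] with M hM
  have h1 : |f x| ≤ M := (Nat.le_ceil _).trans (by exact_mod_cast hM)
  have h2 := abs_le.1 h1
  unfold truncate
  rw [min_eq_left h2.2, max_eq_right h2.1]

theorem measurable_truncate {f : ℝ → ℝ} (hf : Measurable f) (M : ℕ) : Measurable (truncate M f) :=
  measurable_const.max (hf.min measurable_const)

theorem support_truncate {f : ℝ → ℝ} (M : ℕ) : Function.support (truncate M f) ⊆ Function.support f := by
  intro x hx hfx
  apply hx
  have := abs_truncate_le_abs M f x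
  rw [hfx, abs_zero] at this
  exact abs_nonpos_iff.1 this

theorem boundedSupported_truncate {f : ℝ → ℝ} (hf : Measurable f) {T : ℝ}
    (hfT : Function.support f ⊆ Icc (-T) T) (M : ℕ) : BoundedSupported T M (truncate M f) :=
  ⟨measurable_truncate hf M, abs_truncate_le M f, (support_truncate M).trans hfT⟩

theorem tendsto_coeff_truncate {A B : ℝ} {g f : ℝ → ℝ} (hg : BoundedSupported A B g)
    (hf : Measurable f) (hfi : Integrable f volume) (j k : ℤ) :
    Filter.Tendsto (fun M : ℕ => coeff g (truncate M f) j k) Filter.atTop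
      (nhds (coeff g f j k)) := by
  unfold coeff
  refine tendsto_integral_of_dominated_convergence
    (fun x => |f x| * ((2 : ℝ) ^ ((j : ℝ) / 2) * B)) ?_ ?_ ?_ ?_
  · exact fun M => ((measurable_truncate hf M).mul (hg.measurable_dil j k)).aestronglyMeasurable
  · exact hfi.abs.mul_const _
  · intro M
    refine Filter.Eventually.of_forall fun x => ?_
    rw [Real.norm_eq_abs, abs_mul]
    exact mul_le_mul (abs_truncate_le_abs M f x) (hg.abs_dil_le j k x) (abs_nonneg _) (abs_nonneg _)
  · refine Filter.Eventually.of_forall fun x => ?_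
    refine Filter.Tendsto.mul_const _ (tendsto_const_nhds.congr' ?_)
    filter_upwards [truncate_eventually_eq f x] with M hM
    exact hM.symm

theorem tendsto_levelPart_truncate {A B T : ℝ} {g f : ℝ → ℝ} (hg : BoundedSupported A B g)
    (hf : Measurable f) (hfi : Integrable f volume) (j : ℕ) (x : ℝ) :
    Filter.Tendsto (fun M : ℕ => levelPart g A T j (truncate M f) x) Filter.atTop
      (nhds (levelPart g A T j f x)) :=
  tendsto_finsetSum _ fun k _ => (tendsto_coeff_truncate hg hf hfi j k).mul_const _

/-- Square integrability is removed by truncation: each coefficient converges by dominated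
convergence and each level is a finite sum, so the identity for all truncations passes to the limit
pointwise. -/
theorem levelPart_succ {A B T : ℝ} {φ ψ f : ℝ → ℝ} (hφ : BoundedSupported A B φ)
    (hψ : BoundedSupported A B ψ) (hm : GeneratesMRA φ) (hw : IsMotherWavelet φ ψ)
    (hf : Measurable f) (hfi : Integrable f volume) (hfT : Function.support f ⊆ Icc (-T) T) (j : ℕ) :
    levelPart φ A T (j + 1) f =ᵐ[volume]
      fun x => levelPart φ A T j f x + levelPart ψ A T j f x := by
  have h1 : ∀ᵐ x, ∀ M : ℕ, levelPart φ A T (j + 1) (truncate M f) x =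
      levelPart φ A T j (truncate M f) x + levelPart ψ A T j (truncate M f) x := by
    rw [ae_all_iff]
    intro M
    exact levelPart_succ_of_memLp hφ hψ hm hw ((boundedSupported_truncate hf hfT M).memLp 2)
      ((support_truncate M).trans hfT) j
  filter_upwards [h1] with x hx
  refine tendsto_nhds_unique (tendsto_levelPart_truncate hφ hf hfi (j + 1) x) ?_
  simp only [hx]
  exact (tendsto_levelPart_truncate hφ hf hfi j x).add (tendsto_levelPart_truncate hψ hf hfi j x)

end PrivateWavelet

namespace PrivateWavelet

/-! ### Convergence of the projections in `L¹` -/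

section Convergence

variable {A B T : ℝ} {g φ ψ f : ℝ → ℝ}

theorem measurable_levelPart (hg : BoundedSupported A B g) (T : ℝ) (j : ℕ) (f : ℝ → ℝ) :
    Measurable (levelPart g A T j f) :=
  Finset.measurable_fun_sum _ fun k _ => (hg.measurable_dil j k).const_mul _

theorem abs_le_of_mem_translates {j : ℕ} {k : ℤ} (hk : k ∈ translates A T j) :
    |(k : ℝ)| ≤ 2 ^ j * T + A := by
  rw [translates, Finset.mem_Icc, neg_le, Int.le_floor, Int.le_floor] at hk
  push_cast at hk
  exact abs_le.2 ⟨by linarith, hk.2⟩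

theorem abs_le_of_dil_ne_zero (hg : BoundedSupported A B g) (hA : 0 ≤ A) {j : ℕ} {k : ℤ}
    (hk : k ∈ translates A T j) {x : ℝ} (hx : dil g j k x ≠ 0) : |x| ≤ T + 2 * A := by
  have h1 := hg.dil_support hx
  have h2 := abs_le_of_mem_translates hk
  rw [zpow_natCast] at h1
  have h3 : (1 : ℝ) ≤ 2 ^ j := one_le_pow₀ one_le_two
  have h4 : 2 ^ j * |x| ≤ 2 ^ j * T + 2 * A := by
    calc 2 ^ j * |x| = |(2 ^ j * x - k) + k| := by
          rw [sub_add_cancel, abs_mul, abs_of_pos (by positivity : (0 : ℝ) < 2 ^ j)]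
      _ ≤ _ := (abs_add_le _ _).trans (by linarith)
  have h5 : 2 ^ j * |x| ≤ 2 ^ j * (T + 2 * A) := by nlinarith
  exact le_of_mul_le_mul_left h5 (by positivity)

theorem support_levelPart (hg : BoundedSupported A B g) (hA : 0 ≤ A) (T : ℝ) (j : ℕ) (f : ℝ → ℝ) :
    Function.support (levelPart g A T j f) ⊆ Icc (-(T + 2 * A)) (T + 2 * A) := by
  intro x hx
  obtain ⟨k, hk, hne⟩ := Finset.exists_ne_zero_of_sum_ne_zero hx
  exact abs_le.1 (abs_le_of_dil_ne_zero hg hA hk (right_ne_zero_of_mul hne))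

/-- Projections onto an increasing family of closed subspaces with dense union converge strongly to
the identity. -/
theorem tendsto_eLpNorm_two_levelPart (hφ : BoundedSupported A B φ) (hm : GeneratesMRA φ)
    (hf : MemLp f 2 volume) (hfT : Function.support f ⊆ Icc (-T) T) :
    Filter.Tendsto (fun j : ℕ => eLpNorm (fun x => levelPart φ A T j f x - f x) 2 volume)
      Filter.atTop (nhds 0) := by
  have h1 := Submodule.starProjection_tendsto_self (fun j : ℤ => shiftSpan φ j)
    (monotone_int_of_le_succ hm.nested) (hf.toLp f) hm.dense.ge
  have h2 := h1.comp (tendsto_natCast_atTop_atTop (R := ℤ))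
  rw [Lp.tendsto_Lp_iff_tendsto_eLpNorm'] at h2
  refine h2.congr fun j => eLpNorm_congr_ae ?_
  filter_upwards [coeFn_starProjection_shiftSpan hφ hm.orthonormal hf hfT j, hf.coeFn_toLp]
    with x h3 h4
  simp only [Function.comp, Pi.sub_apply]
  rw [h3, h4]

theorem eLpNorm_one_le_two_of_support {h : ℝ → ℝ} (hh : AEStronglyMeasurable h volume) {R : ℝ}
    (hR : Function.support h ⊆ Icc (-R) R) :
    eLpNorm h 1 volume ≤ eLpNorm h 2 volume * ENNReal.ofReal (2 * R) ^ (1 / 2 : ℝ) := by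
  have h1 : h = indicator (Icc (-R) R) h := (indicator_eq_self.2 hR).symm
  have h2 : ∀ p, eLpNorm h p volume = eLpNorm h p (volume.restrict (Icc (-R) R)) := by
    intro p
    conv_lhs => rw [h1]
    exact eLpNorm_indicator_eq_eLpNorm_restrict measurableSet_Icc
  rw [h2, h2]
  refine (eLpNorm_le_eLpNorm_mul_rpow_measure_univ (q := 2) one_le_two hh.restrict).trans ?_
  rw [Measure.restrict_apply_univ, Real.volume_Icc]
  apply le_of_eq
  congr 2
  · congr 1; ring
  · norm_num

/-- All errors live on the fixed interval of radius `T + 2A`, where the `L²` norm controls the `L¹`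
norm. -/
theorem tendsto_eLpNorm_one_levelPart_of_memLp (hφ : BoundedSupported A B φ) (hA : 0 ≤ A)
    (hm : GeneratesMRA φ)
    (hf : MemLp f 2 volume) (hfT : Function.support f ⊆ Icc (-T) T) :
    Filter.Tendsto (fun j : ℕ => eLpNorm (fun x => levelPart φ A T j f x - f x) 1 volume)
      Filter.atTop (nhds 0) := by
  have h1 := ENNReal.Tendsto.mul_const (b := ENNReal.ofReal (2 * (T + 2 * A)) ^ (1 / 2 : ℝ))
    (tendsto_eLpNorm_two_levelPart hφ hm hf hfT)
    (Or.inr (ENNReal.rpow_ne_top_of_nonneg (by norm_num) ENNReal.ofReal_ne_top))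
  rw [zero_mul] at h1
  refine tendsto_of_tendsto_of_tendsto_of_le_of_le tendsto_const_nhds h1 (fun _ => zero_le) ?_
  intro j
  refine eLpNorm_one_le_two_of_support
    ((measurable_levelPart hφ T j f).aestronglyMeasurable.sub hf.1) ?_
  intro x hx
  by_cases h2 : levelPart φ A T j f x = 0
  · have h3 : x ∈ Function.support f := by
      intro h3; exact hx (by rw [Pi.sub_apply, h2, h3, sub_zero])
    exact Icc_subset_Icc (by linarith) (by linarith) (hfT h3)
  · exact support_levelPart hφ hA T j f h2

theorem enorm_coeff_le (g f : ℝ → ℝ) (j k : ℤ) :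
    ‖coeff g f j k‖ₑ ≤ ∫⁻ x, ‖f x‖ₑ * ‖dil g j k x‖ₑ := by
  unfold coeff
  refine (enorm_integral_le_lintegral_enorm _).trans ?_
  simp only [enorm_mul, le_refl]

theorem sum_enorm_dil_le (hg : BoundedSupported A B g) (hA : 0 ≤ A) (s : Finset ℤ) (j : ℤ) (x : ℝ) :
    ∑ k ∈ s, ‖dil g j k x‖ₑ ≤ ENNReal.ofReal ((2 : ℝ) ^ ((j : ℝ) / 2) * (overlap A * B)) := by
  refine le_trans (le_of_eq ?_) (ENNReal.ofReal_le_ofReal (hg.sum_abs_dil_le hA s j x))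
  rw [ENNReal.ofReal_sum_of_nonneg fun _ _ => abs_nonneg _]
  exact Finset.sum_congr rfl fun k _ => Real.enorm_eq_ofReal_abs _

/-- The factor `2^{j/2}` from the overlapping wavelets at a point cancels against the factor
`2^{-j/2}` in the `L¹` norm of a single wavelet. The point is that the bound does not depend on `j`.
-/
theorem eLpNorm_one_levelPart_le (hg : BoundedSupported A B g) (hA : 0 ≤ A) (hf : Measurable f)
    (j : ℕ) :
    eLpNorm (levelPart g A T j f) 1 volume ≤
      ENNReal.ofReal (overlap A * B) * (∫⁻ x, ‖g x‖ₑ) * eLpNorm f 1 volume := by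
  rw [eLpNorm_one_eq_lintegral_enorm, eLpNorm_one_eq_lintegral_enorm]
  have hd : ∀ k : ℤ, ∫⁻ x, ‖dil g j k x‖ₑ =
      ENNReal.ofReal ((2 : ℝ) ^ (-((j : ℝ) / 2))) * ∫⁻ x, ‖g x‖ₑ := by
    intro k
    have := lintegral_dil_rpow g j k (r := 1) zero_le_one
    simp only [ENNReal.rpow_one] at this
    rw [this]
    congr 3
    push_cast; ring
  have hmul : ENNReal.ofReal ((2 : ℝ) ^ ((j : ℝ) / 2) * (overlap A * B)) *
      ENNReal.ofReal ((2 : ℝ) ^ (-((j : ℝ) / 2))) = ENNReal.ofReal (overlap A * B) := by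
    rw [← ENNReal.ofReal_mul' (by positivity)]
    congr 1
    rw [mul_right_comm, ← Real.rpow_add two_pos]
    simp
  calc ∫⁻ x, ‖levelPart g A T j f x‖ₑ
      ≤ ∫⁻ x, ∑ k ∈ translates A T j, ‖coeff g f j k‖ₑ * ‖dil g j k x‖ₑ := by
        refine lintegral_mono fun x => (enorm_sum_le _ _).trans (le_of_eq ?_)
        simp only [enorm_mul]
    _ = ∑ k ∈ translates A T j, ‖coeff g f j k‖ₑ * ∫⁻ x, ‖dil g j k x‖ₑ := by
        rw [lintegral_finsetSum _ fun k _ => ((hg.measurable_dil j k).enorm.const_mul _)]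
        exact Finset.sum_congr rfl fun k _ => lintegral_const_mul _ (hg.measurable_dil j k).enorm
    _ ≤ ∑ k ∈ translates A T j, (∫⁻ x, ‖f x‖ₑ * ‖dil g j k x‖ₑ) *
          (ENNReal.ofReal ((2 : ℝ) ^ (-((j : ℝ) / 2))) * ∫⁻ x, ‖g x‖ₑ) := by
        refine Finset.sum_le_sum fun k _ => ?_
        rw [hd]
        gcongr
        exact enorm_coeff_le g f j k
    _ = (∫⁻ x, ‖f x‖ₑ * ∑ k ∈ translates A T j, ‖dil g j k x‖ₑ) *
          (ENNReal.ofReal ((2 : ℝ) ^ (-((j : ℝ) / 2))) * ∫⁻ x, ‖g x‖ₑ) := by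
        rw [← Finset.sum_mul]
        congr 1
        simp only [Finset.mul_sum]
        exact (lintegral_finsetSum _ fun k _ => hf.enorm.mul (hg.measurable_dil j k).enorm).symm
    _ ≤ (∫⁻ x, ‖f x‖ₑ * ENNReal.ofReal ((2 : ℝ) ^ ((j : ℝ) / 2) * (overlap A * B))) *
          (ENNReal.ofReal ((2 : ℝ) ^ (-((j : ℝ) / 2))) * ∫⁻ x, ‖g x‖ₑ) := by
        gcongr with x
        have := sum_enorm_dil_le hg hA (translates A T j) j x
        simpa using this
    _ = _ := by
        rw [lintegral_mul_const _ hf.enorm, ← hmul]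
        ring

theorem coeff_sub (hg : BoundedSupported A B g) {f₁ f₂ : ℝ → ℝ} (h₁ : Integrable f₁ volume)
    (h₂ : Integrable f₂ volume) (j k : ℤ) :
    coeff g (fun x => f₁ x - f₂ x) j k = coeff g f₁ j k - coeff g f₂ j k := by
  unfold coeff
  rw [← integral_sub ((hg.dil j k).integrable_mul h₁) ((hg.dil j k).integrable_mul h₂)]
  simp only [sub_mul]

theorem levelPart_sub (hg : BoundedSupported A B g) {f₁ f₂ : ℝ → ℝ} (h₁ : Integrable f₁ volume)
    (h₂ : Integrable f₂ volume) (T : ℝ) (j : ℕ) (x : ℝ) :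
    levelPart g A T j (fun x => f₁ x - f₂ x) x = levelPart g A T j f₁ x - levelPart g A T j f₂ x := by
  unfold levelPart
  rw [← Finset.sum_sub_distrib]
  exact Finset.sum_congr rfl fun k _ => by rw [coeff_sub hg h₁ h₂]; ring

theorem tendsto_eLpNorm_one_truncate (hf : Measurable f) (hfi : Integrable f volume) :
    Filter.Tendsto (fun M : ℕ => eLpNorm (fun x => f x - truncate M f x) 1 volume)
      Filter.atTop (nhds 0) := by
  simp only [eLpNorm_one_eq_lintegral_enorm]
  have h0 : (0 : ℝ≥0∞) = ∫⁻ _x : ℝ, 0 := by simp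
  rw [h0]
  refine tendsto_lintegral_of_dominated_convergence (fun x => 2 * ‖f x‖ₑ) ?_ ?_ ?_ ?_
  · exact fun M => (hf.sub (measurable_truncate hf M)).enorm
  · intro M
    refine Filter.Eventually.of_forall fun x => ?_
    refine enorm_sub_le.trans ?_
    simp only [two_mul]
    gcongr ‖f x‖ₑ + ?_
    rw [Real.enorm_eq_ofReal_abs, Real.enorm_eq_ofReal_abs]
    exact ENNReal.ofReal_le_ofReal (abs_truncate_le_abs M f x)
  · rw [lintegral_const_mul _ hf.enorm]
    exact ENNReal.mul_ne_top ENNReal.ofNat_ne_top hfi.2.ne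
  · refine Filter.Eventually.of_forall fun x => tendsto_const_nhds.congr' ?_
    filter_upwards [truncate_eventually_eq f x] with M hM
    rw [hM, sub_self, enorm_zero]

/-- A density argument: bounded truncations are handled in `L²`, and the remainder is small in `L¹`
and stays small under all projections by the uniform bound. -/
theorem tendsto_eLpNorm_one_levelPart (hφ : BoundedSupported A B φ) (hA : 0 ≤ A)
    (hm : GeneratesMRA φ) (hf : Measurable f) (hfi : Integrable f volume)
    (hfT : Function.support f ⊆ Icc (-T) T) :
    Filter.Tendsto (fun j : ℕ => eLpNorm (fun x => levelPart φ A T j f x - f x) 1 volume)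
      Filter.atTop (nhds 0) := by
  set K : ℝ≥0∞ := ENNReal.ofReal (overlap A * B) * (∫⁻ x, ‖φ x‖ₑ) with hK
  have hKtop : K ≠ ⊤ := ENNReal.mul_ne_top ENNReal.ofReal_ne_top hφ.integrable.2.ne
  rw [ENNReal.tendsto_nhds_zero]
  intro ε hε
  have ht := tendsto_eLpNorm_one_truncate hf hfi
  have ht2 := ENNReal.Tendsto.const_mul (a := K + 1) ht
    (Or.inr (ENNReal.add_ne_top.2 ⟨hKtop, ENNReal.one_ne_top⟩))
  rw [mul_zero, ENNReal.tendsto_nhds_zero] at ht2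
  have hε2 : 0 < ε / 2 := ENNReal.div_pos hε.ne' ENNReal.ofNat_ne_top
  obtain ⟨M, hM⟩ := (ht2 (ε / 2) hε2).exists
  have hb := boundedSupported_truncate hf hfT M
  have h2 := tendsto_eLpNorm_one_levelPart_of_memLp hφ hA hm (hb.memLp 2) hb.support
  rw [ENNReal.tendsto_nhds_zero] at h2
  filter_upwards [h2 (ε / 2) hε2] with j hj
  have hdecomp : (fun x => levelPart φ A T j f x - f x) =
      (levelPart φ A T j (fun x => f x - truncate M f x) +
        fun x => levelPart φ A T j (truncate M f) x - truncate M f x) -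
          fun x => f x - truncate M f x := by
    ext x
    simp only [Pi.add_apply, Pi.sub_apply, levelPart_sub hφ hfi hb.integrable]
    ring
  have m0 : Measurable fun x => f x - truncate M f x := hf.sub hb.measurable
  have m1 := measurable_levelPart hφ T j (fun x => f x - truncate M f x)
  have m2 := (measurable_levelPart hφ T j (truncate M f)).sub hb.measurable
  rw [hdecomp]
  calc _ ≤ K * eLpNorm (fun x => f x - truncate M f x) 1 volume + ε / 2 +
        eLpNorm (fun x => f x - truncate M f x) 1 volume := by
        refine (eLpNorm_sub_le (m1.add m2).aestronglyMeasurable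
          m0.aestronglyMeasurable le_rfl).trans ?_
        gcongr
        refine (eLpNorm_add_le m1.aestronglyMeasurable m2.aestronglyMeasurable le_rfl).trans ?_
        exact add_le_add (eLpNorm_one_levelPart_le hφ hA m0 j) hj
    _ = (K + 1) * eLpNorm (fun x => f x - truncate M f x) 1 volume + ε / 2 := by ring
    _ ≤ ε / 2 + ε / 2 := by gcongr
    _ = ε := ENNReal.add_halves ε

/-- The wavelet partial sums `P₀f + ∑_{j < J} Q_j f`. -/
noncomputable def partialSum (φ ψ : ℝ → ℝ) (A T : ℝ) (J : ℕ) (f : ℝ → ℝ) (x : ℝ) : ℝ :=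
  levelPart φ A T 0 f x + ∑ j ∈ Finset.range J, levelPart ψ A T j f x

theorem measurable_partialSum (hφ : BoundedSupported A B φ) (hψ : BoundedSupported A B ψ)
    (T : ℝ) (J : ℕ) (f : ℝ → ℝ) : Measurable (partialSum φ ψ A T J f) :=
  (measurable_levelPart hφ T 0 f).add
    (Finset.measurable_fun_sum _ fun j _ => measurable_levelPart hψ T j f)

theorem partialSum_ae_eq (hφ : BoundedSupported A B φ) (hψ : BoundedSupported A B ψ)
    (hm : GeneratesMRA φ) (hw : IsMotherWavelet φ ψ)
    (hf : Measurable f) (hfi : Integrable f volume) (hfT : Function.support f ⊆ Icc (-T) T) (J : ℕ) :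
    partialSum φ ψ A T J f =ᵐ[volume] levelPart φ A T J f := by
  induction J with
  | zero => exact Filter.Eventually.of_forall fun x => by simp [partialSum]
  | succ J ih =>
    filter_upwards [ih, levelPart_succ hφ hψ hm hw hf hfi hfT J] with x h1 h2
    rw [h2, ← h1, partialSum, partialSum, Finset.sum_range_succ, add_assoc]

/-- Along a subsequence the wavelet partial sums of an integrable function converge a.e. -/
theorem exists_seq_tendsto_partialSum (hφ : BoundedSupported A B φ) (hψ : BoundedSupported A B ψ)
    (hA : 0 ≤ A) (hm : GeneratesMRA φ) (hw : IsMotherWavelet φ ψ)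
    (hf : Measurable f) (hfi : Integrable f volume) (hfT : Function.support f ⊆ Icc (-T) T) :
    ∃ ns : ℕ → ℕ, StrictMono ns ∧ ∀ᵐ x, Filter.Tendsto (fun i => partialSum φ ψ A T (ns i) f x)
      Filter.atTop (nhds (f x)) := by
  have h1 : TendstoInMeasure volume (fun J => partialSum φ ψ A T J f) Filter.atTop f := by
    refine tendstoInMeasure_of_tendsto_eLpNorm one_ne_zero
      (fun J => (measurable_partialSum hφ hψ T J f).aestronglyMeasurable)
      hf.aestronglyMeasurable ?_
    refine (tendsto_eLpNorm_one_levelPart hφ hA hm hf hfi hfT).congr fun J => ?_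
    refine eLpNorm_congr_ae ?_
    filter_upwards [partialSum_ae_eq hφ hψ hm hw hf hfi hfT J] with x hx
    rw [Pi.sub_apply, hx]
  exact h1.exists_seq_tendsto_ae

end Convergence

end PrivateWavelet

namespace PrivateWavelet

/-! ### Norms of finite sequences -/

theorem sum_rpow_le_of_exponent_le {ι : Type*} (s : Finset ι) (a : ι → ℝ≥0∞) {p r : ℝ} (hp : 0 < p)
    (hpr : p ≤ r) : (∑ k ∈ s, a k ^ r) ^ (1 / r) ≤ (∑ k ∈ s, a k ^ p) ^ (1 / p) := by
  have hr : 0 < r := hp.trans_le hpr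
  set S := (∑ k ∈ s, a k ^ p) ^ (1 / p) with hS
  have hSp : S ^ p = ∑ k ∈ s, a k ^ p := by
    rw [hS, ← ENNReal.rpow_mul, one_div_mul_cancel hp.ne', ENNReal.rpow_one]
  have hle : ∀ k ∈ s, a k ≤ S := by
    intro k hk
    rw [← ENNReal.rpow_le_rpow_iff hp, hSp]
    exact Finset.single_le_sum (f := fun k => a k ^ p) (fun _ _ => zero_le) hk
  rw [one_div, ENNReal.rpow_inv_le_iff hr]
  calc ∑ k ∈ s, a k ^ r = ∑ k ∈ s, a k ^ p * a k ^ (r - p) := by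
        refine Finset.sum_congr rfl fun k _ => ?_
        rw [← ENNReal.rpow_add_of_nonneg _ _ hp.le (by linarith)]
        congr 1; ring
    _ ≤ ∑ k ∈ s, a k ^ p * S ^ (r - p) := by
        refine Finset.sum_le_sum fun k hk => ?_
        gcongr
        exact hle k hk
    _ = S ^ r := by
        rw [← Finset.sum_mul, ← hSp, ← ENNReal.rpow_add_of_nonneg _ _ hp.le (by linarith)]
        congr 1; ring

theorem sum_rpow_le_card_mul {ι : Type*} (s : Finset ι) (a : ι → ℝ≥0∞) {p r : ℝ} (hr : 0 < r)
    (hrp : r ≤ p) :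
    (∑ k ∈ s, a k ^ r) ^ (1 / r) ≤ (s.card : ℝ≥0∞) ^ (1 / r - 1 / p) * (∑ k ∈ s, a k ^ p) ^ (1 / p) := by
  have hp : 0 < p := hr.trans_le hrp
  have h1 := ENNReal.rpow_sum_le_const_mul_sum_rpow s (fun k => a k ^ r) (p := p / r)
    ((one_le_div hr).2 hrp)
  have h2 : ∀ k, (a k ^ r) ^ (p / r) = a k ^ p := by
    intro k
    rw [← ENNReal.rpow_mul, mul_div_cancel₀ _ hr.ne']
  simp only [h2] at h1
  have h3 := ENNReal.rpow_le_rpow h1 (one_div_pos.2 hp).le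
  rw [← ENNReal.rpow_mul, ENNReal.mul_rpow_of_nonneg _ _ (one_div_pos.2 hp).le,
    ← ENNReal.rpow_mul] at h3
  convert h3 using 2
  · field_simp
  · congr 1
    field_simp

/-! ### Norms of wavelet sums -/

section Bias

variable {A B T : ℝ} {g φ ψ f : ℝ → ℝ}

/-- Only boundedly many terms are nonzero at `x`, so the power mean inequality costs a power of the
overlap and not of the cardinality of `s`. -/
theorem enorm_sum_dil_rpow_le (hg : BoundedSupported A B g) (hA : 0 ≤ A) {r : ℝ} (hr : 1 ≤ r)
    (s : Finset ℤ) (c : ℤ → ℝ) (j : ℤ) (x : ℝ) :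
    ‖∑ k ∈ s, c k * dil g j k x‖ₑ ^ r ≤ ENNReal.ofReal (overlap A) ^ (r - 1) *
      ∑ k ∈ s, ‖c k‖ₑ ^ r * ‖dil g j k x‖ₑ ^ r := by
  classical
  set t := s.filter fun k : ℤ => g ((2 : ℝ) ^ j * x - k) ≠ 0 with ht
  have h1 : ∑ k ∈ s, c k * dil g j k x = ∑ k ∈ t, c k * dil g j k x := by
    rw [ht, Finset.sum_filter]
    refine Finset.sum_congr rfl fun k _ => ?_
    by_cases h : g ((2 : ℝ) ^ j * x - k) = 0 <;> simp [h, dil]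
  have h2 : (t.card : ℝ≥0∞) ≤ ENNReal.ofReal (overlap A) := by
    rw [← ENNReal.ofReal_natCast]
    exact ENNReal.ofReal_le_ofReal (hg.card_ne_zero_le hA s _)
  rw [h1]
  calc ‖∑ k ∈ t, c k * dil g j k x‖ₑ ^ r ≤ (∑ k ∈ t, ‖c k * dil g j k x‖ₑ) ^ r :=
        ENNReal.rpow_le_rpow (enorm_sum_le _ _) (by linarith)
    _ ≤ (t.card : ℝ≥0∞) ^ (r - 1) * ∑ k ∈ t, ‖c k * dil g j k x‖ₑ ^ r :=
        ENNReal.rpow_sum_le_const_mul_sum_rpow t _ hr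
    _ ≤ ENNReal.ofReal (overlap A) ^ (r - 1) * ∑ k ∈ s, ‖c k * dil g j k x‖ₑ ^ r := by
        refine mul_le_mul' (ENNReal.rpow_le_rpow h2 (by linarith)) ?_
        exact Finset.sum_le_sum_of_subset (Finset.filter_subset _ _)
    _ = _ := by
        congr 1
        refine Finset.sum_congr rfl fun k _ => ?_
        rw [enorm_mul, ENNReal.mul_rpow_of_nonneg _ _ (by linarith)]

theorem lintegral_sum_dil_rpow_le (hg : BoundedSupported A B g) (hA : 0 ≤ A) {r : ℝ} (hr : 1 ≤ r)
    (s : Finset ℤ) (c : ℤ → ℝ) (j : ℤ) :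
    ∫⁻ x, ‖∑ k ∈ s, c k * dil g j k x‖ₑ ^ r ≤ ENNReal.ofReal (overlap A) ^ (r - 1) *
      (ENNReal.ofReal ((2 : ℝ) ^ ((j : ℝ) * (r / 2 - 1))) * ∫⁻ x, ‖g x‖ₑ ^ r) *
        ∑ k ∈ s, ‖c k‖ₑ ^ r := by
  refine (lintegral_mono fun x => enorm_sum_dil_rpow_le hg hA hr s c j x).trans (le_of_eq ?_)
  have hm : ∀ k : ℤ, Measurable fun x => ‖dil g j k x‖ₑ ^ r := fun k =>
    (hg.measurable_dil j k).enorm.pow_const r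
  rw [lintegral_const_mul _ (Finset.measurable_fun_sum _ fun k _ => (hm k).const_mul _),
    lintegral_finsetSum _ fun k _ => (hm k).const_mul _, mul_assoc]
  congr 1
  rw [Finset.mul_sum]
  refine Finset.sum_congr rfl fun k _ => ?_
  rw [lintegral_const_mul _ (hm k), lintegral_dil_rpow g j k (by linarith), mul_comm]

theorem eLpNorm_ofReal_eq {α : Type*} {m : MeasurableSpace α} {μ : Measure α} {r : ℝ} (hr : 0 < r)
    (f : α → ℝ) : eLpNorm f (ENNReal.ofReal r) μ = (∫⁻ x, ‖f x‖ₑ ^ r ∂μ) ^ (1 / r) := by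
  rw [eLpNorm_eq_lintegral_rpow_enorm_toReal (by simpa using hr) ENNReal.ofReal_ne_top,
    ENNReal.toReal_ofReal hr.le]

theorem sum_rpow_le_eLpNorm_count {p : ℝ} (hp : 0 < p) (c : ℤ → ℝ) (s : Finset ℤ) :
    (∑ k ∈ s, ‖c k‖ₑ ^ p) ^ (1 / p) ≤ eLpNorm c (ENNReal.ofReal p) Measure.count := by
  rw [eLpNorm_ofReal_eq hp, lintegral_count]
  exact ENNReal.rpow_le_rpow (ENNReal.sum_le_tsum s) (one_div_pos.2 hp).le

/-- The `Lʳ` norm of one resolution level in terms of the `ℓᵖ` norm of its coefficients. -/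
theorem exists_eLpNorm_levelPart_le (hg : BoundedSupported A B g) (hA : 0 ≤ A) (hT : 0 ≤ T)
    {p r : ℝ} (hp : 1 ≤ p) (hr : 1 ≤ r) :
    ∃ C : ℝ, 0 ≤ C ∧ ∀ (f : ℝ → ℝ) (j : ℕ), eLpNorm (levelPart g A T j f) (ENNReal.ofReal r) volume ≤
      ENNReal.ofReal (C * (2 : ℝ) ^ ((j : ℝ) * (1 / 2 - 1 / r + max (1 / r - 1 / p) 0))) *
        eLpNorm (fun k : ℤ => coeff g f j k) (ENNReal.ofReal p) Measure.count := by
  have hr0 : 0 < r := by linarith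
  have hp0 : 0 < p := by linarith
  set G := eLpNorm g (ENNReal.ofReal r) volume with hG
  have hGt : G ≠ ⊤ := (hg.memLp _).2.ne
  have hO : 0 ≤ overlap A := (zero_le_one).trans (one_le_overlap hA)
  -- `κ 2^j` bounds the number of translates at level `j`; `κ ≥ 1` lets powers of `κ` with exponent
  -- in `[0, 1]` be replaced by `κ`.
  set κ : ℝ := 2 * (T + A) + 1 with hκ
  have hκ1 : 1 ≤ κ := by rw [hκ]; linarith
  refine ⟨overlap A ^ ((r - 1) * (1 / r)) * G.toReal * κ, by positivity, fun f j => ?_⟩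
  set c : ℤ → ℝ := fun k => coeff g f j k with hc
  set N := eLpNorm c (ENNReal.ofReal p) Measure.count with hN
  have h1 : eLpNorm (levelPart g A T j f) (ENNReal.ofReal r) volume ≤
      ENNReal.ofReal (overlap A ^ ((r - 1) * (1 / r)) * G.toReal * (2 : ℝ) ^ ((j : ℝ) * (1 / 2 - 1 / r)))
        * (∑ k ∈ translates A T j, ‖c k‖ₑ ^ r) ^ (1 / r) := by
    rw [eLpNorm_ofReal_eq hr0]
    refine (ENNReal.rpow_le_rpow (lintegral_sum_dil_rpow_le hg hA hr (translates A T j) c j)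
      (one_div_pos.2 hr0).le).trans (le_of_eq ?_)
    have hr1 : 0 ≤ 1 / r := (one_div_pos.2 hr0).le
    rw [ENNReal.mul_rpow_of_nonneg _ _ hr1, ENNReal.mul_rpow_of_nonneg _ _ hr1,
      ENNReal.mul_rpow_of_nonneg _ _ hr1, ← eLpNorm_ofReal_eq hr0, ← hG, ← ENNReal.rpow_mul,
      ENNReal.ofReal_rpow_of_nonneg (by positivity) hr1, ← Real.rpow_mul two_pos.le,
      ENNReal.ofReal_rpow_of_nonneg hO (mul_nonneg (by linarith) hr1),
      ENNReal.ofReal_mul (by positivity), ENNReal.ofReal_mul (by positivity),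
      ENNReal.ofReal_toReal hGt]
    have e1 : (((j : ℕ) : ℤ) : ℝ) * (r / 2 - 1) * (1 / r) = (j : ℝ) * (1 / 2 - 1 / r) := by
      push_cast
      field_simp
    rw [e1]
    ring
  -- For `p ≤ r` the embedding of `ℓᵖ` into `ℓʳ` is free. For `r ≤ p` Hölder costs the number of
  -- translates to the power `1/r - 1/p`.
  have h2 : (∑ k ∈ translates A T j, ‖c k‖ₑ ^ r) ^ (1 / r) ≤
      ENNReal.ofReal (κ * (2 : ℝ) ^ ((j : ℝ) * max (1 / r - 1 / p) 0)) * N := by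
    rcases le_total p r with hpr | hrp
    · have e1 : 1 / r - 1 / p ≤ 0 := sub_nonpos.2 (one_div_le_one_div_of_le hp0 hpr)
      rw [max_eq_right e1, mul_zero, Real.rpow_zero, mul_one]
      calc _ ≤ (∑ k ∈ translates A T j, ‖c k‖ₑ ^ p) ^ (1 / p) :=
            sum_rpow_le_of_exponent_le _ _ hp0 hpr
        _ ≤ 1 * N := by rw [one_mul]; exact sum_rpow_le_eLpNorm_count hp0 c _
        _ ≤ _ := by
            gcongr
            rw [← ENNReal.ofReal_one]
            exact ENNReal.ofReal_le_ofReal hκ1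
    · have e1 : 0 ≤ 1 / r - 1 / p := sub_nonneg.2 (one_div_le_one_div_of_le hr0 hrp)
      have e2 : 1 / r - 1 / p ≤ 1 := by
        have : 1 / r ≤ 1 := (div_le_one hr0).2 hr
        have : 0 ≤ 1 / p := by positivity
        linarith
      rw [max_eq_left e1]
      refine (sum_rpow_le_card_mul _ _ hr0 hrp).trans ?_
      refine mul_le_mul' ?_ (sum_rpow_le_eLpNorm_count hp0 c _)
      rw [← ENNReal.ofReal_natCast, ENNReal.ofReal_rpow_of_nonneg (Nat.cast_nonneg _) e1]
      apply ENNReal.ofReal_le_ofReal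
      calc ((translates A T j).card : ℝ) ^ (1 / r - 1 / p)
          ≤ (κ * 2 ^ j) ^ (1 / r - 1 / p) :=
            Real.rpow_le_rpow (Nat.cast_nonneg _) (card_translates_le hA hT j) e1
        _ = κ ^ (1 / r - 1 / p) * (2 : ℝ) ^ ((j : ℝ) * (1 / r - 1 / p)) := by
            rw [Real.mul_rpow (by linarith) (by positivity), ← Real.rpow_natCast 2 j,
              ← Real.rpow_mul two_pos.le]
        _ ≤ _ := by
            gcongr
            calc κ ^ (1 / r - 1 / p) ≤ κ ^ (1 : ℝ) := Real.rpow_le_rpow_of_exponent_le hκ1 e2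
              _ = κ := Real.rpow_one κ
  refine h1.trans ((mul_le_mul_right h2 _).trans (le_of_eq ?_))
  rw [← mul_assoc, ← ENNReal.ofReal_mul (by positivity)]
  congr 2
  rw [mul_add (j : ℝ), Real.rpow_add two_pos]
  ring

/-! ### Besov classes: coefficients, norms and approximation -/

variable {s p L : ℝ} {q : ℝ≥0∞}

theorem eLpNorm_coeff_father_le (hf : f ∈ densityClass φ ψ s p q L T) :
    eLpNorm (fun k : ℤ => coeff φ f 0 k) (ENNReal.ofReal p) Measure.count ≤ ENNReal.ofReal L :=
  le_self_add.trans hf.2.2.2.2.2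

theorem eLpNorm_coeff_mother_le (hq : q ≠ 0) (hf : f ∈ densityClass φ ψ s p q L T) (j : ℕ) :
    eLpNorm (fun k : ℤ => coeff ψ f j k) (ENNReal.ofReal p) Measure.count ≤
      ENNReal.ofReal ((2 : ℝ) ^ (-((j : ℝ) * (s + 1 / 2 - 1 / p))) * L) := by
  have h1 := (enorm_le_eLpNorm_count (fun j : ℕ =>
    ENNReal.ofReal ((2 : ℝ) ^ ((j : ℝ) * (s + 1 / 2 - 1 / p))) *
      eLpNorm (fun k : ℤ => coeff ψ f j k) (ENNReal.ofReal p) Measure.count) j hq).trans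
    (le_add_self.trans hf.2.2.2.2.2)
  rw [enorm_eq_self] at h1
  have h2 := mul_le_mul_right h1
    (ENNReal.ofReal ((2 : ℝ) ^ (-((j : ℝ) * (s + 1 / 2 - 1 / p)))))
  rw [← mul_assoc, ← ENNReal.ofReal_mul (by positivity), ← Real.rpow_add two_pos, neg_add_cancel,
    Real.rpow_zero, ENNReal.ofReal_one, one_mul, ← ENNReal.ofReal_mul (by positivity)] at h2
  exact h2

theorem two_rpow_neg_mul (t : ℝ) (j : ℕ) : (2 : ℝ) ^ (-((j : ℝ) * t)) = ((2 : ℝ) ^ (-t)) ^ j := by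
  rw [← Real.rpow_natCast, ← Real.rpow_mul two_pos.le]
  congr 1; ring

/-- Densities in a Besov ball are approximated by their wavelet partial sums in `Lʳ`. -/
theorem exists_approximation (hφ : BoundedSupported A B φ) (hψ : BoundedSupported A B ψ)
    (hA : 0 ≤ A) (hT : 0 ≤ T) (hm : GeneratesMRA φ) (hw : IsMotherWavelet φ ψ) (hL : 0 ≤ L)
    (hq : q ≠ 0) {r : ℝ} (hp : 1 ≤ p) (hr : 1 ≤ r) (hs' : 0 < effSmoothness s p r) :
    ∃ C : ℝ, 0 ≤ C ∧ ∀ f ∈ densityClass φ ψ s p q L T,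
      eLpNorm f (ENNReal.ofReal r) volume ≤ ENNReal.ofReal C ∧
      ∀ J : ℕ, eLpNorm (fun x => f x - partialSum φ ψ A T J f x) (ENNReal.ofReal r) volume ≤
        ENNReal.ofReal (C * (2 : ℝ) ^ (-((J : ℝ) * effSmoothness s p r))) := by
  have hr1 : 1 ≤ ENNReal.ofReal r := by
    rw [← ENNReal.ofReal_one]; exact ENNReal.ofReal_le_ofReal hr
  obtain ⟨C₁, hC₁, hb₁⟩ := exists_eLpNorm_levelPart_le hφ hA hT hp hr
  obtain ⟨C₂, hC₂, hb₂⟩ := exists_eLpNorm_levelPart_le hψ hA hT hp hr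
  set t := effSmoothness s p r with ht
  set z : ℝ := (2 : ℝ) ^ (-t) with hz
  have hz0 : 0 < z := Real.rpow_pos_of_pos two_pos _
  have hz1 : z < 1 := Real.rpow_lt_one_of_one_lt_of_neg one_lt_two (by linarith)
  have hlevel : ∀ f ∈ densityClass φ ψ s p q L T, ∀ j : ℕ,
      eLpNorm (levelPart ψ A T j f) (ENNReal.ofReal r) volume ≤ ENNReal.ofReal (C₂ * L * z ^ j) := by
    intro f hf j
    refine (hb₂ f j).trans ((mul_le_mul_right (eLpNorm_coeff_mother_le hq hf j) _).trans (le_of_eq ?_))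
    rw [← ENNReal.ofReal_mul (by positivity)]
    congr 1
    -- The effective smoothness arises here, since `(1/r - 1/p)₊ = (1/p - 1/r)₊ - (1/p - 1/r)`.
    have e1 : (j : ℝ) * (1 / 2 - 1 / r + max (1 / r - 1 / p) 0) + -((j : ℝ) * (s + 1 / 2 - 1 / p))
        = -((j : ℝ) * t) := by
      have : max (1 / r - 1 / p) 0 = max (1 / p - 1 / r) 0 - (1 / p - 1 / r) := by
        rcases le_total (1 / p) (1 / r) with h | h
        · rw [max_eq_left (by linarith), max_eq_right (by linarith)]; ring
        · rw [max_eq_right (by linarith), max_eq_left (by linarith)]; ring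
      rw [this, ht, effSmoothness]
      ring
    rw [hz, ← two_rpow_neg_mul, ← e1, Real.rpow_add two_pos]
    ring
  have hbias : ∀ f ∈ densityClass φ ψ s p q L T, ∀ J : ℕ,
      eLpNorm (fun x => f x - partialSum φ ψ A T J f x) (ENNReal.ofReal r) volume ≤
        ENNReal.ofReal (C₂ * L / (1 - z) * z ^ J) := by
    intro f hf J
    obtain ⟨ns, hns, hlim⟩ := exists_seq_tendsto_partialSum hφ hψ hA hm hw hf.1 hf.2.2.1
      hf.2.2.2.2.1
    -- Convergence in `Lʳ` is not yet known. Fatou's lemma along the almost everywhere convergent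
    -- subsequence replaces it, so that only the finite sums from level `J` on have to be estimated.
    refine (Lp.eLpNorm_lim_le_liminf_eLpNorm
      (f := fun i x => partialSum φ ψ A T (ns i) f x - partialSum φ ψ A T J f x)
      (fun i => ((measurable_partialSum hφ hψ T _ f).sub
        (measurable_partialSum hφ hψ T _ f)).aestronglyMeasurable) _ ?_).trans ?_
    · filter_upwards [hlim] with x hx
      exact hx.sub_const _
    · refine Filter.liminf_le_of_frequently_le' (Filter.Eventually.frequently ?_)
      filter_upwards [hns.tendsto_atTop.eventually_ge_atTop J] with i hi
      have e1 : (fun x => partialSum φ ψ A T (ns i) f x - partialSum φ ψ A T J f x) =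
          ∑ j ∈ Finset.Ico J (ns i), levelPart ψ A T j f := by
        ext x
        rw [Finset.sum_apply, Finset.sum_Ico_eq_sub _ hi, partialSum, partialSum]
        ring
      rw [e1]
      refine (eLpNorm_sum_le (fun j _ => (measurable_levelPart hψ T j f).aestronglyMeasurable)
        hr1).trans ?_
      refine (Finset.sum_le_sum fun j _ => hlevel f hf j).trans ?_
      rw [← ENNReal.ofReal_sum_of_nonneg fun j _ => by positivity]
      apply ENNReal.ofReal_le_ofReal
      rw [← Finset.mul_sum]
      have := geom_sum_Ico_le_of_lt_one (m := J) (n := ns i) hz0.le hz1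
      calc _ ≤ C₂ * L * (z ^ J / (1 - z)) := by gcongr
        _ = _ := by ring
  have h1z : 0 < 1 - z := by linarith
  refine ⟨C₁ * L + C₂ * L / (1 - z), by positivity, fun f hf => ⟨?_, fun J => ?_⟩⟩
  -- The bias bound with no mother levels shows that `f` lies in `Lʳ` with a uniform norm; the
  -- variance bound needs this later.
  · have h1 := hbias f hf 0
    have h2 := (hb₁ f 0).trans (mul_le_mul_right (eLpNorm_coeff_father_le hf) _)
    have e1 : f = (fun x => f x - partialSum φ ψ A T 0 f x) + levelPart φ A T 0 f := by
      ext x; simp [partialSum]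
    conv_lhs => rw [e1]
    refine (eLpNorm_add_le (hf.1.sub (measurable_partialSum hφ hψ T 0 f)).aestronglyMeasurable
      (measurable_levelPart hφ T 0 f).aestronglyMeasurable hr1).trans ((add_le_add h1 h2).trans ?_)
    rw [← ENNReal.ofReal_mul (by positivity), ← ENNReal.ofReal_add (by positivity) (by positivity)]
    apply ENNReal.ofReal_le_ofReal
    simp [add_comm]
  · refine (hbias f hf J).trans (ENNReal.ofReal_le_ofReal ?_)
    rw [two_rpow_neg_mul]
    gcongr
    have : 0 ≤ C₁ * L := by positivity
    linarith

end Bias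

end PrivateWavelet

namespace PrivateWavelet

/-! ### Exponential moments -/

section ExponentialMoments

theorem lintegral_pi_prod {ι : Type*} [Fintype ι] {Ω : ι → Type*} [∀ i, MeasurableSpace (Ω i)]
    (μ : ∀ i, Measure (Ω i)) [∀ i, IsProbabilityMeasure (μ i)] (F : ∀ i, Ω i → ℝ≥0∞)
    (hF : ∀ i, Measurable (F i)) :
    ∫⁻ ω, ∏ i, F i (ω i) ∂(Measure.pi μ) = ∏ i, ∫⁻ y, F i y ∂(μ i) := by
  refine (lintegral_prod_eq_prod_lintegral_of_indepFun Finset.univ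
    (fun i (ω : ∀ i, Ω i) => F i (ω i)) (iIndepFun_pi fun i => (hF i).aemeasurable)
    fun i => (hF i).comp (measurable_pi_apply i)).trans ?_
  refine Finset.prod_congr rfl fun i _ => ?_
  exact (measurePreserving_eval μ i).lintegral_comp (hF i)

theorem lintegral_laplaceLaw_exp_mul {t : ℝ} (ht : |t| < 1) :
    ∫⁻ x, ENNReal.ofReal (Real.exp (t * x)) ∂laplaceLaw = ENNReal.ofReal (1 / (1 - t ^ 2)) := by
  obtain ⟨h1, h2⟩ := abs_lt.1 ht
  have hm : Measurable fun x : ℝ => ENNReal.ofReal (1 / 2 * Real.exp (-|x|)) := by fun_prop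
  have hm2 : Measurable fun x : ℝ => ENNReal.ofReal (Real.exp (t * x)) := by fun_prop
  rw [laplaceLaw, lintegral_withDensity_eq_lintegral_mul _ hm hm2]
  have hsplit := lintegral_add_compl (μ := (volume : Measure ℝ))
    ((fun x : ℝ => ENNReal.ofReal (1 / 2 * Real.exp (-|x|))) *
      fun x : ℝ => ENNReal.ofReal (Real.exp (t * x))) (measurableSet_Iic (a := (0 : ℝ)))
  rw [← hsplit, compl_Iic]
  have e1 : ∫⁻ x in Iic (0 : ℝ), ((fun x : ℝ => ENNReal.ofReal (1 / 2 * Real.exp (-|x|))) *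
      fun x : ℝ => ENNReal.ofReal (Real.exp (t * x))) x = ENNReal.ofReal (1 / 2 * (1 / (1 + t))) := by
    have : ∫ x in Iic (0 : ℝ), 1 / 2 * Real.exp ((1 + t) * x) = 1 / 2 * (1 / (1 + t)) := by
      rw [integral_const_mul, integral_exp_mul_Iic (by linarith)]; simp
    rw [← this, ofReal_integral_eq_lintegral_ofReal
      ((integrableOn_exp_mul_Iic (by linarith) 0).const_mul _)
      (Filter.Eventually.of_forall fun x => by positivity)]
    refine setLIntegral_congr_fun measurableSet_Iic fun x hx => ?_
    simp only [Pi.mul_apply]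
    rw [← ENNReal.ofReal_mul (by positivity), abs_of_nonpos hx, mul_assoc, ← Real.exp_add]
    congr 3; ring
  have e2 : ∫⁻ x in Ioi (0 : ℝ), ((fun x : ℝ => ENNReal.ofReal (1 / 2 * Real.exp (-|x|))) *
      fun x : ℝ => ENNReal.ofReal (Real.exp (t * x))) x = ENNReal.ofReal (1 / 2 * (1 / (1 - t))) := by
    have : ∫ x in Ioi (0 : ℝ), 1 / 2 * Real.exp ((t - 1) * x) = 1 / 2 * (1 / (1 - t)) := by
      rw [integral_const_mul, integral_exp_mul_Ioi (by linarith), ← neg_sub t 1, mul_zero,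
        Real.exp_zero, neg_div, ← div_neg]
    rw [← this, ofReal_integral_eq_lintegral_ofReal
      ((integrableOn_exp_mul_Ioi (by linarith) 0).const_mul _)
      (Filter.Eventually.of_forall fun x => by positivity)]
    refine setLIntegral_congr_fun measurableSet_Ioi fun x hx => ?_
    simp only [Pi.mul_apply]
    rw [← ENNReal.ofReal_mul (by positivity), abs_of_pos hx, mul_assoc, ← Real.exp_add]
    congr 3; ring
  have h3 : 0 < 1 + t := by linarith
  have h4 : 0 < 1 - t := by linarith
  rw [e1, e2, ← ENNReal.ofReal_add (by positivity) (by positivity)]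
  congr 1
  have h5 : 1 - t ^ 2 ≠ 0 := by nlinarith
  field_simp
  ring

instance isProbabilityMeasure_laplaceLaw : IsProbabilityMeasure laplaceLaw := by
  constructor
  have := lintegral_laplaceLaw_exp_mul (t := 0) (by simp)
  simpa using this

instance isProbabilityMeasure_noiseLaw (A T : ℝ) (j₁ : ℕ) :
    IsProbabilityMeasure (noiseLaw A T j₁) := by
  unfold noiseLaw; infer_instance

/-- Away from the poles at `|t| = 1` the exact value satisfies `1 / (1 - t²) ≤ 1 + 2t²`. -/
theorem lintegral_laplaceLaw_exp_mul_le {t : ℝ} (ht : t ^ 2 ≤ 1 / 4) :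
    ∫⁻ x, ENNReal.ofReal (Real.exp (t * x)) ∂laplaceLaw ≤ ENNReal.ofReal (Real.exp (2 * t ^ 2)) := by
  have h1 : |t| < 1 := by rw [← sq_lt_one_iff_abs_lt_one]; linarith
  rw [lintegral_laplaceLaw_exp_mul h1]
  apply ENNReal.ofReal_le_ofReal
  refine le_trans ?_ (Real.add_one_le_exp _)
  rw [div_le_iff₀ (by linarith)]
  nlinarith [sq_nonneg t]

/-- Bernstein's argument: `eᵘ ≤ 1 + u + u²` for `|u| ≤ 1`, then `1 + v ≤ eᵛ` after integration, so
that the linear term cancels against the centering. -/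
theorem lintegral_exp_centered_le {P : Measure ℝ} [IsProbabilityMeasure P] {G : ℝ → ℝ}
    (hG : Measurable G) {M V t : ℝ} (hM : ∀ x, |G x| ≤ M) (hV : ∫ x, G x ^ 2 ∂P ≤ V)
    (ht : |t| * M ≤ 1) :
    ∫⁻ x, ENNReal.ofReal (Real.exp (t * (G x - ∫ y, G y ∂P))) ∂P ≤
      ENNReal.ofReal (Real.exp (t ^ 2 * V)) := by
  have hi : Integrable G P := Integrable.of_bound hG.aestronglyMeasurable M
    (Filter.Eventually.of_forall hM)
  have hi2 : Integrable (fun x => G x ^ 2) P := Integrable.of_bound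
    (hG.pow_const 2).aestronglyMeasurable (M ^ 2) (Filter.Eventually.of_forall fun x => by
      rw [Real.norm_eq_abs, abs_pow]
      exact pow_le_pow_left₀ (abs_nonneg _) (hM x) 2)
  have hpt : ∀ x, Real.exp (t * (G x - ∫ y, G y ∂P)) ≤
      Real.exp (-(t * ∫ y, G y ∂P)) * (1 + t * G x + t ^ 2 * G x ^ 2) := by
    intro x
    have h1 : |t * G x| ≤ 1 := by
      rw [abs_mul]
      exact (mul_le_mul_of_nonneg_left (hM x) (abs_nonneg t)).trans ht
    have h2 := (abs_le.1 (Real.abs_exp_sub_one_sub_id_le h1)).2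
    have h3 : t * (G x - ∫ y, G y ∂P) = -(t * ∫ y, G y ∂P) + t * G x := by ring
    rw [h3, Real.exp_add]
    refine mul_le_mul_of_nonneg_left ?_ (Real.exp_pos _).le
    nlinarith
  have hint : Integrable (fun x => Real.exp (-(t * ∫ y, G y ∂P)) * (1 + t * G x + t ^ 2 * G x ^ 2)) P :=
    (((integrable_const 1).add (hi.const_mul t)).add (hi2.const_mul _)).const_mul _
  refine (lintegral_mono fun x => ENNReal.ofReal_le_ofReal (hpt x)).trans ?_
  rw [← ofReal_integral_eq_lintegral_ofReal hint (Filter.Eventually.of_forall fun x =>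
    (Real.exp_pos _).le.trans (hpt x))]
  apply ENNReal.ofReal_le_ofReal
  have hval : ∫ x, (1 + t * G x + t ^ 2 * G x ^ 2) ∂P =
      1 + t * ∫ y, G y ∂P + t ^ 2 * ∫ y, G y ^ 2 ∂P := by
    have i1 : Integrable (fun x => 1 + t * G x) P := (integrable_const 1).add (hi.const_mul t)
    rw [integral_add i1 (hi2.const_mul _), integral_add (integrable_const 1) (hi.const_mul t),
      integral_const_mul, integral_const_mul]
    simp
  rw [integral_const_mul, hval]
  calc Real.exp (-(t * ∫ y, G y ∂P)) * (1 + t * ∫ y, G y ∂P + t ^ 2 * ∫ y, G y ^ 2 ∂P)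
      ≤ Real.exp (-(t * ∫ y, G y ∂P)) * Real.exp (t * ∫ y, G y ∂P + t ^ 2 * V) := by
        refine mul_le_mul_of_nonneg_left ?_ (Real.exp_pos _).le
        have h1 := Real.add_one_le_exp (t * ∫ y, G y ∂P + t ^ 2 * V)
        nlinarith [mul_le_mul_of_nonneg_left hV (sq_nonneg t)]
    _ = Real.exp (t ^ 2 * V) := by
        rw [← Real.exp_add]; congr 1; ring

/-- Exponential moments of the mean of bounded variables perturbed by Laplace noise. -/
theorem lintegral_exp_mean_le {ι : Type*} [Fintype ι] {P : Measure ℝ} [IsProbabilityMeasure P]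
    {G : ℝ → ℝ} (hG : Measurable G) {M V D l : ℝ} (hM : ∀ x, |G x| ≤ M)
    (hV : ∫ x, G x ^ 2 ∂P ≤ V) (b : ι → ℝ) (hD : ∑ c, b c ^ 2 ≤ D) {n : ℕ} (hn : 1 ≤ n)
    (hlM : |l| * M ≤ n) (hlV : l ^ 2 * V ≤ n) (hlD : 4 * (l ^ 2 * D) ≤ n) :
    ∫⁻ ω : Fin n → ℝ × (ι → ℝ), ENNReal.ofReal (Real.exp (l * ((1 / (n : ℝ)) *
        ∑ i, (G (ω i).1 + ∑ c, b c * (ω i).2 c) - ∫ x, G x ∂P)))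
      ∂(Measure.pi fun _ => P.prod (Measure.pi fun _ => laplaceLaw)) ≤
        ENNReal.ofReal (Real.exp (3 / 2)) := by
  have hn0 : (0 : ℝ) < n := by exact_mod_cast hn
  have hn1 : (1 : ℝ) ≤ n := by exact_mod_cast hn
  -- Each observation carries the exponent `l / n`; the exponential of the mean then factorises over
  -- observations and over noise coordinates.
  set t := l / n with ht
  set m := ∫ x, G x ∂P with hm
  have ht2 : t ^ 2 = l ^ 2 / (n : ℝ) ^ 2 := by rw [ht, div_pow]
  have hdecomp : ∀ ω : Fin n → ℝ × (ι → ℝ), ENNReal.ofReal (Real.exp (l * ((1 / (n : ℝ)) *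
        ∑ i, (G (ω i).1 + ∑ c, b c * (ω i).2 c) - m))) =
      ∏ i, (ENNReal.ofReal (Real.exp (t * (G (ω i).1 - m))) *
        ∏ c, ENNReal.ofReal (Real.exp (t * b c * (ω i).2 c))) := by
    intro ω
    have h1 : l * ((1 / (n : ℝ)) * ∑ i, (G (ω i).1 + ∑ c, b c * (ω i).2 c) - m) =
        ∑ i, (t * (G (ω i).1 - m) + ∑ c, t * b c * (ω i).2 c) := by
      simp only [mul_assoc t, ← Finset.mul_sum, ← mul_add, Finset.sum_add_distrib,
        Finset.sum_sub_distrib, Finset.sum_const, Finset.card_univ, Fintype.card_fin, nsmul_eq_mul]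
      rw [ht]
      field_simp
      ring
    rw [h1, Real.exp_sum, ENNReal.ofReal_prod_of_nonneg fun _ _ => (Real.exp_pos _).le]
    refine Finset.prod_congr rfl fun i _ => ?_
    rw [Real.exp_add, ENNReal.ofReal_mul (Real.exp_pos _).le, Real.exp_sum,
      ENNReal.ofReal_prod_of_nonneg fun _ _ => (Real.exp_pos _).le]
  simp only [hdecomp]
  have mX : Measurable fun x : ℝ => ENNReal.ofReal (Real.exp (t * (G x - m))) := by fun_prop
  have mW : Measurable fun w : ι → ℝ => ∏ c, ENNReal.ofReal (Real.exp (t * b c * w c)) := by fun_prop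
  rw [lintegral_pi_prod (fun _ : Fin n => P.prod (Measure.pi fun _ : ι => laplaceLaw))
    (fun _ y => ENNReal.ofReal (Real.exp (t * (G y.1 - m))) *
        ∏ c, ENNReal.ofReal (Real.exp (t * b c * y.2 c)))
    (fun _ => (mX.comp measurable_fst).mul (mW.comp measurable_snd))]
  rw [lintegral_prod_mul mX.aemeasurable mW.aemeasurable,
    lintegral_pi_prod (fun _ : ι => laplaceLaw)
      (fun c y => ENNReal.ofReal (Real.exp (t * b c * y))) (fun c => by fun_prop)]
  have hX : ∫⁻ x, ENNReal.ofReal (Real.exp (t * (G x - m))) ∂P ≤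
      ENNReal.ofReal (Real.exp (t ^ 2 * V)) := by
    refine lintegral_exp_centered_le hG hM hV ?_
    rw [ht, abs_div, abs_of_pos hn0, div_mul_eq_mul_div, div_le_one hn0]
    exact hlM
  have hW : ∏ c, ∫⁻ x, ENNReal.ofReal (Real.exp (t * b c * x)) ∂laplaceLaw ≤
      ENNReal.ofReal (Real.exp (2 * (t ^ 2 * D))) := by
    have h1 : ∀ c, ∫⁻ x, ENNReal.ofReal (Real.exp (t * b c * x)) ∂laplaceLaw ≤
        ENNReal.ofReal (Real.exp (2 * (t * b c) ^ 2)) := by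
      intro c
      refine lintegral_laplaceLaw_exp_mul_le ?_
      have h2 : b c ^ 2 ≤ D :=
        (Finset.single_le_sum (f := fun c => b c ^ 2) (fun _ _ => sq_nonneg _)
          (Finset.mem_univ c)).trans hD
      rw [mul_pow, ht2, div_mul_eq_mul_div, div_le_iff₀ (by positivity)]
      nlinarith [mul_le_mul_of_nonneg_left h2 (sq_nonneg l)]
    refine (Finset.prod_le_prod' fun c _ => h1 c).trans ?_
    rw [← ENNReal.ofReal_prod_of_nonneg fun _ _ => (Real.exp_pos _).le, ← Real.exp_sum]
    apply ENNReal.ofReal_le_ofReal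
    apply Real.exp_le_exp.2
    simp only [mul_pow, ← Finset.mul_sum]
    gcongr
  calc _ ≤ ∏ _i : Fin n, (ENNReal.ofReal (Real.exp (t ^ 2 * V)) *
        ENNReal.ofReal (Real.exp (2 * (t ^ 2 * D)))) :=
        Finset.prod_le_prod' fun i _ => mul_le_mul' hX hW
    _ = ENNReal.ofReal (Real.exp (n * (t ^ 2 * V + 2 * (t ^ 2 * D)))) := by
        rw [Finset.prod_const, Finset.card_univ, Fintype.card_fin,
          ← ENNReal.ofReal_mul (Real.exp_pos _).le, ← Real.exp_add,
          ← ENNReal.ofReal_pow (Real.exp_pos _).le, ← Real.exp_nat_mul]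
    _ ≤ _ := by
        apply ENNReal.ofReal_le_ofReal
        apply Real.exp_le_exp.2
        rw [ht2]
        -- The exponent `3/2` is `1 + 1/2`: the hypotheses give `l² V / n ≤ 1` and `2 l² D / n ≤
        -- 1/2`.
        have e1 : (n : ℝ) * (l ^ 2 / (n : ℝ) ^ 2 * V + 2 * (l ^ 2 / (n : ℝ) ^ 2 * D)) =
          (l ^ 2 * V + 2 * (l ^ 2 * D)) / n := by field_simp
        rw [e1, div_le_iff₀ hn0]
        linarith

theorem abs_rpow_le_exp {r : ℝ} (hr : 0 ≤ r) (u : ℝ) :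
    |u| ^ r ≤ (1 + (⌈r⌉₊.factorial : ℝ)) * Real.exp |u| := by
  have h0 := abs_nonneg u
  have hf : (0 : ℝ) < ⌈r⌉₊.factorial := by exact_mod_cast Nat.factorial_pos _
  have he : 1 ≤ Real.exp |u| := Real.one_le_exp h0
  rcases le_total |u| 1 with h | h
  · have := Real.rpow_le_one h0 h hr
    nlinarith
  · have h1 : |u| ^ r ≤ |u| ^ (⌈r⌉₊ : ℝ) := Real.rpow_le_rpow_of_exponent_le h (Nat.le_ceil r)
    rw [Real.rpow_natCast] at h1
    have h2 := Real.pow_div_factorial_le_exp (x := |u|) h0 ⌈r⌉₊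
    rw [div_le_iff₀ hf] at h2
    nlinarith

/-- Moments of a random variable are controlled by its exponential moments. -/
theorem lintegral_rpow_le_of_exp {Ω : Type*} [MeasurableSpace Ω] {μ : Measure Ω} {S : Ω → ℝ}
    (hS : Measurable S) {r l K : ℝ} (hr : 0 ≤ r) (hl : 0 < l)
    (h1 : ∫⁻ ω, ENNReal.ofReal (Real.exp (l * S ω)) ∂μ ≤ ENNReal.ofReal K)
    (h2 : ∫⁻ ω, ENNReal.ofReal (Real.exp (-l * S ω)) ∂μ ≤ ENNReal.ofReal K) :
    ∫⁻ ω, ‖S ω‖ₑ ^ r ∂μ ≤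
      ENNReal.ofReal ((1 + (⌈r⌉₊.factorial : ℝ)) * (l⁻¹) ^ r) * (2 * ENNReal.ofReal K) := by
  have hpt : ∀ ω, ‖S ω‖ₑ ^ r ≤ ENNReal.ofReal ((1 + (⌈r⌉₊.factorial : ℝ)) * (l⁻¹) ^ r) *
      (ENNReal.ofReal (Real.exp (l * S ω)) + ENNReal.ofReal (Real.exp (-l * S ω))) := by
    intro ω
    rw [Real.enorm_eq_ofReal_abs, ENNReal.ofReal_rpow_of_nonneg (abs_nonneg _) hr,
      ← ENNReal.ofReal_add (Real.exp_pos _).le (Real.exp_pos _).le,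
      ← ENNReal.ofReal_mul (by positivity)]
    apply ENNReal.ofReal_le_ofReal
    have h3 := abs_rpow_le_exp hr (l * S ω)
    have h4 : Real.exp |l * S ω| ≤ Real.exp (l * S ω) + Real.exp (-l * S ω) := by
      rcases abs_choice (l * S ω) with h | h <;> rw [h]
      · linarith [Real.exp_pos (-l * S ω)]
      · rw [neg_mul]; linarith [Real.exp_pos (l * S ω)]
    have h5 : |S ω| ^ r = (l⁻¹) ^ r * |l * S ω| ^ r := by
      rw [← Real.mul_rpow (by positivity) (abs_nonneg _), abs_mul, abs_of_pos hl,
        inv_mul_cancel_left₀ hl.ne']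
    rw [h5, mul_comm (1 + (⌈r⌉₊.factorial : ℝ)), mul_assoc]
    refine mul_le_mul_of_nonneg_left ?_ (by positivity)
    refine h3.trans (mul_le_mul_of_nonneg_left h4 (by positivity))
  refine (lintegral_mono hpt).trans ?_
  rw [lintegral_const_mul _ (by fun_prop), lintegral_add_left (by fun_prop)]
  gcongr
  rw [two_mul]
  exact add_le_add h1 h2

/-- A Rosenthal type bound for means of bounded variables perturbed by Laplace noise. -/
theorem lintegral_mean_rpow_le {ι : Type*} [Fintype ι] {P : Measure ℝ} [IsProbabilityMeasure P]
    {G : ℝ → ℝ} (hG : Measurable G) {M V D r : ℝ} (hM0 : 0 < M) (hV0 : 0 ≤ V) (hD0 : 0 ≤ D)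
    (hM : ∀ x, |G x| ≤ M)
    (hV : ∫ x, G x ^ 2 ∂P ≤ V) (b : ι → ℝ) (hD : ∑ c, b c ^ 2 ≤ D) {n : ℕ} (hn : 1 ≤ n)
    (hr : 0 ≤ r) :
    ∫⁻ ω : Fin n → ℝ × (ι → ℝ), ‖(1 / (n : ℝ)) * ∑ i, (G (ω i).1 + ∑ c, b c * (ω i).2 c) -
        ∫ x, G x ∂P‖ₑ ^ r ∂(Measure.pi fun _ => P.prod (Measure.pi fun _ => laplaceLaw)) ≤
      ENNReal.ofReal (2 * (1 + (⌈r⌉₊.factorial : ℝ)) * Real.exp (3 / 2) *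
        (M / n + √(V / n) + 2 * √(D / n)) ^ r) := by
  have hn0 : (0 : ℝ) < n := by exact_mod_cast hn
  -- With exponent `1 / Λ`, each of the three summands secures one of the three smallness conditions
  -- on the exponential moment.
  set Λ := M / n + √(V / n) + 2 * √(D / n) with hΛ
  have hMn : 0 < M / n := by positivity
  have hΛ0 : 0 < Λ := by positivity
  have hs1 : 0 ≤ √(V / n) := Real.sqrt_nonneg _
  have hs2 : 0 ≤ √(D / n) := Real.sqrt_nonneg _
  have hlM : Λ⁻¹ * M ≤ n := by
    rw [inv_mul_le_iff₀ hΛ0]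
    have : M = (M / n) * n := by field_simp
    rw [this]
    gcongr
    linarith
  have hlV : Λ⁻¹ ^ 2 * V ≤ n := by
    rw [inv_pow, inv_mul_le_iff₀ (by positivity)]
    have h1 : V = √(V / n) ^ 2 * n := by
      rw [Real.sq_sqrt (by positivity)]; field_simp
    rw [h1]
    gcongr
    linarith
  have hlD : 4 * (Λ⁻¹ ^ 2 * D) ≤ n := by
    rw [mul_left_comm, inv_pow, inv_mul_le_iff₀ (by positivity)]
    have h1 : 4 * D = (2 * √(D / n)) ^ 2 * n := by
      rw [mul_pow, Real.sq_sqrt (by positivity)]; field_simp; ring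
    rw [h1]
    gcongr
    linarith
  have hl : 0 < Λ⁻¹ := inv_pos.2 hΛ0
  have h1 := lintegral_exp_mean_le hG hM hV b hD hn (l := Λ⁻¹) (by rwa [abs_of_pos hl]) hlV hlD
  have h2 := lintegral_exp_mean_le hG hM hV b hD hn (l := -Λ⁻¹)
    (by rwa [abs_neg, abs_of_pos hl]) (by rwa [neg_sq]) (by rwa [neg_sq])
  have hS : Measurable fun ω : Fin n → ℝ × (ι → ℝ) =>
      (1 / (n : ℝ)) * ∑ i, (G (ω i).1 + ∑ c, b c * (ω i).2 c) - ∫ x, G x ∂P := by fun_prop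
  refine (lintegral_rpow_le_of_exp hS hr hl h1 h2).trans (le_of_eq ?_)
  rw [inv_inv, ← ENNReal.ofReal_ofNat 2, ← ENNReal.ofReal_mul (by positivity),
    ← ENNReal.ofReal_mul (by positivity)]
  congr 1
  ring

end ExponentialMoments

end PrivateWavelet

namespace PrivateWavelet

/-! ### Kernels of the linear estimator -/

section Kernel

theorem sum_coeffIndex {A T : ℝ} {j₁ : ℕ} {M : Type*} [AddCommMonoid M]
    (F : CoeffIndex A T j₁ → M) (a : ℤ → M) (b : ℕ → ℤ → M)
    (ha : ∀ k : {k : ℤ // k ∈ translates A T 0}, F (.inl k) = a k)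
    (hb : ∀ (j : Fin (j₁ + 1)) (k : {k : ℤ // k ∈ translates A T (j : ℕ)}),
      F (.inr ⟨j, k⟩) = b j k) :
    ∑ c, F c = ∑ k ∈ translates A T 0, a k +
      ∑ j ∈ Finset.range (j₁ + 1), ∑ k ∈ translates A T j, b j k := by
  rw [Fintype.sum_sum_type, Fintype.sum_sigma, Finset.sum_range]
  congr 1
  · simp only [ha]
    exact Finset.sum_coe_sort (translates A T 0) a
  · refine Finset.sum_congr rfl fun j _ => ?_
    simp only [hb]
    exact Finset.sum_coe_sort (translates A T (j : ℕ)) (b j)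

/-- The resolution level of an index. -/
def level {A T : ℝ} {j₁ : ℕ} : CoeffIndex A T j₁ → ℕ
  -- The father coefficients have the same scale as the coarsest mother coefficients, hence level
  -- `0` here, not `-1`.
  | .inl _ => 0
  | .inr ⟨j, _⟩ => j

theorem two_rpow_half_natCast (j : ℕ) : (2 : ℝ) ^ ((j : ℝ) / 2) = √2 ^ j := by
  rw [Real.sqrt_eq_rpow, ← Real.rpow_natCast, ← Real.rpow_mul two_pos.le]
  congr 1; ring

theorem sum_two_rpow_half_le (j₁ : ℕ) : ∑ j ∈ Finset.range (j₁ + 1), (2 : ℝ) ^ ((j : ℝ) / 2) ≤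
    √2 / (√2 - 1) * (2 : ℝ) ^ ((j₁ : ℝ) / 2) := by
  simp only [two_rpow_half_natCast]
  have h1 : 1 < √2 := by rw [Real.lt_sqrt] <;> norm_num
  rw [geom_sum_eq h1.ne', div_mul_eq_mul_div, pow_succ']
  gcongr
  linarith

variable {A B T : ℝ} {φ ψ : ℝ → ℝ} {j₁ : ℕ}

theorem measurable_atom (hφ : BoundedSupported A B φ) (hψ : BoundedSupported A B ψ)
    (c : CoeffIndex A T j₁) : Measurable (atom φ ψ c) := by
  rcases c with k | ⟨j, k⟩
  · exact hφ.measurable_dil _ _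
  · exact hψ.measurable_dil _ _

theorem atom_eq_zero (hφ : BoundedSupported A B φ) (hψ : BoundedSupported A B ψ) (hA : 0 ≤ A)
    (c : CoeffIndex A T j₁) {x : ℝ} (hx : x ∉ Icc (-(T + 2 * A)) (T + 2 * A)) :
    atom φ ψ c x = 0 := by
  by_contra hne
  apply hx
  rcases c with k | ⟨j, k⟩
  · exact abs_le.1 (abs_le_of_dil_ne_zero (j := 0) hφ hA k.2 hne)
  · exact abs_le.1 (abs_le_of_dil_ne_zero hψ hA k.2 hne)

/-- Sums over all indices of quantities that are controlled level by level. -/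
theorem sum_coeffIndex_le (F : CoeffIndex A T j₁ → ℝ) (a : ℤ → ℝ) (b : ℕ → ℤ → ℝ) {K : ℝ}
    (hK : 0 ≤ K)
    (ha : ∀ k : {k : ℤ // k ∈ translates A T 0}, F (.inl k) = a k)
    (hb : ∀ (j : Fin (j₁ + 1)) (k : {k : ℤ // k ∈ translates A T (j : ℕ)}),
      F (.inr ⟨j, k⟩) = b j k)
    (ha' : ∑ k ∈ translates A T 0, a k ≤ K)
    (hb' : ∀ j, ∑ k ∈ translates A T j, b j k ≤ K * (2 : ℝ) ^ ((j : ℝ) / 2)) :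
    ∑ c, F c ≤ K * (1 + √2 / (√2 - 1)) * (2 : ℝ) ^ ((j₁ : ℝ) / 2) := by
  rw [sum_coeffIndex F a b ha hb]
  have h1 : ∑ j ∈ Finset.range (j₁ + 1), ∑ k ∈ translates A T j, b j k ≤
      K * (√2 / (√2 - 1) * (2 : ℝ) ^ ((j₁ : ℝ) / 2)) := by
    refine (Finset.sum_le_sum fun j _ => hb' j).trans ?_
    rw [← Finset.mul_sum]
    exact mul_le_mul_of_nonneg_left (sum_two_rpow_half_le j₁) hK
  have h2 : (1 : ℝ) ≤ (2 : ℝ) ^ ((j₁ : ℝ) / 2) := Real.one_le_rpow one_le_two (by positivity)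
  have h3 : K ≤ K * (2 : ℝ) ^ ((j₁ : ℝ) / 2) := le_mul_of_one_le_right hK h2
  nlinarith

/-- The nonnegative majorant of the kernel of the estimator, with weights growing in the level. -/
noncomputable def majorant (φ ψ : ℝ → ℝ) (A T : ℝ) (j₁ : ℕ) (x y : ℝ) : ℝ :=
  ∑ c : CoeffIndex A T j₁, (2 : ℝ) ^ (((level c : ℝ) - j₁) / 2) * (|atom φ ψ c x| * |atom φ ψ c y|)

/-- The constant `1 + √2 / (√2 - 1)` that bounds geometric sums over the levels. -/
noncomputable def geomConst : ℝ := 1 + √2 / (√2 - 1)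

theorem geomConst_pos : 0 < geomConst := by
  have h1 : 1 < √2 := by rw [Real.lt_sqrt] <;> norm_num
  have : 0 < √2 - 1 := by linarith
  unfold geomConst
  positivity

theorem sum_dil_mul_dil_le {g : ℝ → ℝ} (hg : BoundedSupported A B g) (hA : 0 ≤ A) (s : Finset ℤ) (j : ℤ)
    (x y : ℝ) : ∑ k ∈ s, |dil g j k x| * |dil g j k y| ≤
      overlap A * B ^ 2 * ((2 : ℝ) ^ ((j : ℝ) / 2) * (2 : ℝ) ^ ((j : ℝ) / 2)) := by
  calc ∑ k ∈ s, |dil g j k x| * |dil g j k y|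
      ≤ ∑ k ∈ s, |dil g j k x| * ((2 : ℝ) ^ ((j : ℝ) / 2) * B) :=
        Finset.sum_le_sum fun k _ => mul_le_mul_of_nonneg_left (hg.abs_dil_le j k y) (abs_nonneg _)
    _ ≤ (2 : ℝ) ^ ((j : ℝ) / 2) * (overlap A * B) * ((2 : ℝ) ^ ((j : ℝ) / 2) * B) := by
        rw [← Finset.sum_mul]
        exact mul_le_mul_of_nonneg_right (hg.sum_abs_dil_le hA s j x)
          (mul_nonneg (Real.rpow_nonneg two_pos.le _) hg.nonneg)
    _ = _ := by ring

/-- Level `j` contributes order `2^{(j₁-j)/2} 2^j = 2^{j₁/2} 2^{j/2}`, still a geometric sum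
dominated by its last term. Favouring the coarse levels by this weight therefore does not change the
order `2^{j₁}`. -/
theorem sum_weighted_atom_le (hφ : BoundedSupported A B φ) (hψ : BoundedSupported A B ψ)
    (hA : 0 ≤ A) (T : ℝ) (j₁ : ℕ) (x y : ℝ) :
    ∑ c : CoeffIndex A T j₁, (2 : ℝ) ^ (((j₁ : ℝ) - level c) / 2) *
      (|atom φ ψ c x| * |atom φ ψ c y|) ≤ overlap A * B ^ 2 * geomConst * 2 ^ j₁ := by
  have hO : 0 ≤ overlap A := zero_le_one.trans (one_le_overlap hA)
  have hw : ∀ j : ℕ, (2 : ℝ) ^ (((j₁ : ℝ) - j) / 2) =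
      (2 : ℝ) ^ ((j₁ : ℝ) / 2) * (2 : ℝ) ^ (-((j : ℝ) / 2)) := by
    intro j
    rw [← Real.rpow_add two_pos]; congr 1; ring
  have hlev : ∀ (g : ℝ → ℝ), BoundedSupported A B g → ∀ j : ℕ,
      ∑ k ∈ translates A T j, (2 : ℝ) ^ (((j₁ : ℝ) - j) / 2) * (|dil g j k x| * |dil g j k y|) ≤
        overlap A * B ^ 2 * (2 : ℝ) ^ ((j₁ : ℝ) / 2) * (2 : ℝ) ^ ((j : ℝ) / 2) := by
    intro g hg j
    rw [← Finset.mul_sum, hw]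
    have h1 := sum_dil_mul_dil_le hg hA (translates A T j) j x y
    have h2 : (2 : ℝ) ^ (-((j : ℝ) / 2)) * (2 : ℝ) ^ ((j : ℝ) / 2) = 1 := by
      rw [← Real.rpow_add two_pos]; simp
    push_cast at h1
    calc _ ≤ (2 : ℝ) ^ ((j₁ : ℝ) / 2) * (2 : ℝ) ^ (-((j : ℝ) / 2)) *
          (overlap A * B ^ 2 * ((2 : ℝ) ^ ((j : ℝ) / 2) * (2 : ℝ) ^ ((j : ℝ) / 2))) :=
          mul_le_mul_of_nonneg_left h1 (by positivity)
      _ = overlap A * B ^ 2 * (2 : ℝ) ^ ((j₁ : ℝ) / 2) * ((2 : ℝ) ^ (-((j : ℝ) / 2)) *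
            (2 : ℝ) ^ ((j : ℝ) / 2)) * (2 : ℝ) ^ ((j : ℝ) / 2) := by ring
      _ = _ := by rw [h2, mul_one]
  have h := sum_coeffIndex_le (A := A) (T := T) (j₁ := j₁)
    (fun c => (2 : ℝ) ^ (((j₁ : ℝ) - level c) / 2) * (|atom φ ψ c x| * |atom φ ψ c y|))
    (fun k => (2 : ℝ) ^ (((j₁ : ℝ) - (0 : ℕ)) / 2) * (|dil φ (0 : ℕ) k x| * |dil φ (0 : ℕ) k y|))
    (fun j k => (2 : ℝ) ^ (((j₁ : ℝ) - j) / 2) * (|dil ψ j k x| * |dil ψ j k y|))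
    (K := overlap A * B ^ 2 * (2 : ℝ) ^ ((j₁ : ℝ) / 2)) (by positivity)
    (fun k => rfl) (fun j k => rfl) (by simpa using hlev φ hφ 0) (hlev ψ hψ)
  refine h.trans (le_of_eq ?_)
  have h3 : (2 : ℝ) ^ j₁ = (2 : ℝ) ^ ((j₁ : ℝ) / 2) * (2 : ℝ) ^ ((j₁ : ℝ) / 2) := by
    rw [← Real.rpow_add two_pos, add_halves, Real.rpow_natCast]
  rw [h3, geomConst]
  ring

theorem sum_atom_le (hφ : BoundedSupported A B φ) (hψ : BoundedSupported A B ψ)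
    (hA : 0 ≤ A) (T : ℝ) (j₁ : ℕ) (x y : ℝ) :
    ∑ c : CoeffIndex A T j₁, |atom φ ψ c x| * |atom φ ψ c y| ≤
      overlap A * B ^ 2 * geomConst * 2 ^ j₁ := by
  refine le_trans (Finset.sum_le_sum fun c _ => ?_) (sum_weighted_atom_le hφ hψ hA T j₁ x y)
  refine le_mul_of_one_le_left (by positivity) (Real.one_le_rpow one_le_two ?_)
  have : (level c : ℝ) ≤ j₁ := by
    rcases c with k | ⟨j, k⟩
    · simp [level]
    · have := j.2
      simp only [level]
      exact_mod_cast (by omega : (j : ℕ) ≤ j₁)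
  linarith

/-- Cauchy–Schwarz with reciprocal weights on the levels. One factor is bounded by `2^{j₁}`; the
other retains the dependence on both points and has bounded integrals. -/
theorem sq_sum_atom_le (hφ : BoundedSupported A B φ) (hψ : BoundedSupported A B ψ)
    (hA : 0 ≤ A) (T : ℝ) (j₁ : ℕ) (x y : ℝ) :
    (∑ c : CoeffIndex A T j₁, atom φ ψ c y * atom φ ψ c x) ^ 2 ≤
      overlap A * B ^ 2 * geomConst * 2 ^ j₁ * majorant φ ψ A T j₁ x y := by
  have h1 : |∑ c : CoeffIndex A T j₁, atom φ ψ c y * atom φ ψ c x| ≤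
      ∑ c : CoeffIndex A T j₁, |atom φ ψ c x| * |atom φ ψ c y| := by
    refine (Finset.abs_sum_le_sum_abs _ _).trans (le_of_eq ?_)
    simp only [abs_mul, mul_comm]
  rw [← sq_abs]
  refine (pow_le_pow_left₀ (abs_nonneg _) h1 2).trans ?_
  have h2 : ∀ c : CoeffIndex A T j₁, 0 ≤ |atom φ ψ c x| * |atom φ ψ c y| := fun c => by positivity
  refine (Finset.sum_sq_le_sum_mul_sum_of_sq_le_mul Finset.univ
    (f := fun c : CoeffIndex A T j₁ =>
      (2 : ℝ) ^ (((j₁ : ℝ) - level c) / 2) * (|atom φ ψ c x| * |atom φ ψ c y|))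
    (g := fun c => (2 : ℝ) ^ (((level c : ℝ) - j₁) / 2) * (|atom φ ψ c x| * |atom φ ψ c y|))
    (fun c _ => mul_nonneg (by positivity) (h2 c)) (fun c _ => mul_nonneg (by positivity) (h2 c))
    (fun c _ => ?_)).trans ?_
  · have : (2 : ℝ) ^ (((j₁ : ℝ) - level c) / 2) * (2 : ℝ) ^ (((level c : ℝ) - j₁) / 2) = 1 := by
      rw [← Real.rpow_add two_pos]
      have : ((j₁ : ℝ) - level c) / 2 + ((level c : ℝ) - j₁) / 2 = 0 := by ring
      rw [this, Real.rpow_zero]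
    refine le_of_eq ?_
    linear_combination (-(|atom φ ψ c x| * |atom φ ψ c y|) ^ 2) * this
  · exact mul_le_mul_of_nonneg_right (sum_weighted_atom_le hφ hψ hA T j₁ x y)
      (Finset.sum_nonneg fun c _ => mul_nonneg (by positivity) (h2 c))

theorem majorant_nonneg (φ ψ : ℝ → ℝ) (A T : ℝ) (j₁ : ℕ) (x y : ℝ) :
    0 ≤ majorant φ ψ A T j₁ x y :=
  Finset.sum_nonneg fun c _ => by positivity

theorem majorant_comm (φ ψ : ℝ → ℝ) (A T : ℝ) (j₁ : ℕ) (x y : ℝ) :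
    majorant φ ψ A T j₁ x y = majorant φ ψ A T j₁ y x := by
  unfold majorant
  simp only [mul_comm |atom φ ψ _ x|]

theorem measurable_majorant (hφ : BoundedSupported A B φ) (hψ : BoundedSupported A B ψ)
    (T : ℝ) (j₁ : ℕ) : Measurable fun z : ℝ × ℝ => majorant φ ψ A T j₁ z.1 z.2 := by
  unfold majorant
  refine Finset.measurable_fun_sum _ fun c _ => Measurable.const_mul ?_ _
  have := measurable_atom hφ hψ c
  exact ((this.comp measurable_fst).abs).mul ((this.comp measurable_snd).abs)

theorem majorant_le (hφ : BoundedSupported A B φ) (hψ : BoundedSupported A B ψ)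
    (hA : 0 ≤ A) (T : ℝ) (j₁ : ℕ) (x y : ℝ) :
    majorant φ ψ A T j₁ x y ≤ overlap A * B ^ 2 * geomConst * 2 ^ j₁ := by
  refine le_trans (Finset.sum_le_sum fun c _ => ?_) (sum_atom_le hφ hψ hA T j₁ x y)
  refine mul_le_of_le_one_left (by positivity) (Real.rpow_le_one_of_one_le_of_nonpos one_le_two ?_)
  have : (level c : ℝ) ≤ j₁ := by
    rcases c with k | ⟨j, k⟩
    · simp [level]
    · have := j.2
      simp only [level]
      exact_mod_cast (by omega : (j : ℕ) ≤ j₁)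
  linarith

theorem integral_abs_le {g : ℝ → ℝ} (hg : BoundedSupported A B g) (hA : 0 ≤ A) :
    ∫ x, |g x| ≤ B * (2 * A) := by
  have h1 : ∫ x, |g x| = ∫ x in Icc (-A) A, |g x| := by
    rw [← integral_indicator measurableSet_Icc]
    congr 1
    symm
    rw [indicator_eq_self]
    intro x hx
    exact hg.support (by simpa using hx)
  rw [h1]
  have h2 : ∫ x in Icc (-A) A, |g x| ≤ ∫ _x in Icc (-A) A, B :=
    setIntegral_mono hg.integrable.abs.integrableOn (by simp) fun x => hg.bound x
  refine h2.trans (le_of_eq ?_)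
  have : (0 : ℝ) ≤ A - -A := by linarith
  simp only [setIntegral_const, smul_eq_mul, measureReal_def, Real.volume_Icc,
    ENNReal.toReal_ofReal this]
  ring

theorem integral_abs_dil (g : ℝ → ℝ) (j k : ℤ) :
    ∫ x, |dil g j k x| = (2 : ℝ) ^ (-((j : ℝ) / 2)) * ∫ x, |g x| := by
  have h0 : (0 : ℝ) < 2 ^ j := by positivity
  have h1 : ∀ x, |dil g j k x| = (2 : ℝ) ^ ((j : ℝ) / 2) * |g ((2 : ℝ) ^ j * x - k)| := by
    intro x
    rw [dil, abs_mul, abs_of_pos (Real.rpow_pos_of_pos two_pos _)]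
  simp only [h1]
  rw [integral_const_mul, integral_comp_affine (fun x => |g x|) h0, ← mul_assoc]
  congr 1
  rw [two_zpow_eq_rpow, ← Real.rpow_neg two_pos.le, ← Real.rpow_add two_pos]
  congr 1; ring

theorem integrable_atom (hφ : BoundedSupported A B φ) (hψ : BoundedSupported A B ψ)
    (c : CoeffIndex A T j₁) : Integrable (atom φ ψ c) volume := by
  rcases c with k | ⟨j, k⟩
  · exact (hφ.dil _ _).integrable
  · exact (hψ.dil _ _).integrable

/-- Without weights each level would contribute a constant, by cancellation of `2^{j/2}` and
`2^{-j/2}`, and the total bound would grow with the number of levels. The weights `2^{(j-j₁)/2}`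
make the sum bounded uniformly in `j₁`, which avoids a logarithmic loss. -/
theorem lintegral_majorant_le (hφ : BoundedSupported A B φ) (hψ : BoundedSupported A B ψ)
    (hA : 0 ≤ A) (T : ℝ) (j₁ : ℕ) (x : ℝ) :
    ∫⁻ y, ENNReal.ofReal (majorant φ ψ A T j₁ x y) ≤
      ENNReal.ofReal (overlap A * B * (B * (2 * A)) * geomConst) := by
  have hO : 0 ≤ overlap A := zero_le_one.trans (one_le_overlap hA)
  have hB := hφ.nonneg
  have hi : ∀ c : CoeffIndex A T j₁, Integrable (fun y => (2 : ℝ) ^ (((level c : ℝ) - j₁) / 2) *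
      (|atom φ ψ c x| * |atom φ ψ c y|)) volume := fun c =>
    (((integrable_atom hφ hψ c).abs).const_mul _).const_mul _
  have hint : Integrable (fun y => majorant φ ψ A T j₁ x y) volume :=
    integrable_finsetSum _ fun c _ => hi c
  rw [← ofReal_integral_eq_lintegral_ofReal hint
    (Filter.Eventually.of_forall fun y => majorant_nonneg φ ψ A T j₁ x y)]
  apply ENNReal.ofReal_le_ofReal
  unfold majorant
  rw [integral_finsetSum _ fun c _ => hi c]
  simp only [integral_const_mul]
  have hw : ∀ j : ℕ, (2 : ℝ) ^ (((j : ℝ) - j₁) / 2) =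
      (2 : ℝ) ^ (-((j₁ : ℝ) / 2)) * (2 : ℝ) ^ ((j : ℝ) / 2) := by
    intro j
    rw [← Real.rpow_add two_pos]; congr 1; ring
  have hlev : ∀ (g : ℝ → ℝ), BoundedSupported A B g → ∀ j : ℕ,
      ∑ k ∈ translates A T j, (2 : ℝ) ^ (((j : ℝ) - j₁) / 2) *
        (|dil g j k x| * ∫ y, |dil g j k y|) ≤
        overlap A * B * (B * (2 * A)) * (2 : ℝ) ^ (-((j₁ : ℝ) / 2)) * (2 : ℝ) ^ ((j : ℝ) / 2) := by
    intro g hg j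
    simp only [integral_abs_dil]
    rw [← Finset.mul_sum, ← Finset.sum_mul, hw]
    have h1 := hg.sum_abs_dil_le hA (translates A T j) j x
    have h2 : (2 : ℝ) ^ ((j : ℝ) / 2) * (2 : ℝ) ^ (-((j : ℝ) / 2)) = 1 := by
      rw [← Real.rpow_add two_pos]; simp
    have h3 := integral_abs_le hg hA
    have h4 : 0 ≤ ∫ y, |g y| := integral_nonneg fun _ => abs_nonneg _
    push_cast at h1 ⊢
    calc _ ≤ (2 : ℝ) ^ (-((j₁ : ℝ) / 2)) * (2 : ℝ) ^ ((j : ℝ) / 2) *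
          ((2 : ℝ) ^ ((j : ℝ) / 2) * (overlap A * B) *
            ((2 : ℝ) ^ (-((j : ℝ) / 2)) * (B * (2 * A)))) := by gcongr
      _ = overlap A * B * (B * (2 * A)) * (2 : ℝ) ^ (-((j₁ : ℝ) / 2)) * ((2 : ℝ) ^ ((j : ℝ) / 2) *
            (2 : ℝ) ^ (-((j : ℝ) / 2))) * (2 : ℝ) ^ ((j : ℝ) / 2) := by ring
      _ = _ := by rw [h2, mul_one]
  have h := sum_coeffIndex_le (A := A) (T := T) (j₁ := j₁)
    (fun c => (2 : ℝ) ^ (((level c : ℝ) - j₁) / 2) * (|atom φ ψ c x| * ∫ y, |atom φ ψ c y|))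
    (fun k => (2 : ℝ) ^ ((((0 : ℕ) : ℝ) - j₁) / 2) * (|dil φ (0 : ℕ) k x| * ∫ y, |dil φ (0 : ℕ) k y|))
    (fun j k => (2 : ℝ) ^ (((j : ℝ) - j₁) / 2) * (|dil ψ j k x| * ∫ y, |dil ψ j k y|))
    (K := overlap A * B * (B * (2 * A)) * (2 : ℝ) ^ (-((j₁ : ℝ) / 2))) (by positivity)
    (fun k => rfl) (fun j k => rfl) (by simpa using hlev φ hφ 0) (hlev ψ hψ)
  refine h.trans (le_of_eq ?_)
  have h3 : (2 : ℝ) ^ (-((j₁ : ℝ) / 2)) * (2 : ℝ) ^ ((j₁ : ℝ) / 2) = 1 := by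
    rw [← Real.rpow_add two_pos]; simp
  rw [geomConst]
  linear_combination (overlap A * B * (B * (2 * A)) * (1 + √2 / (√2 - 1))) * h3

/-- Schur's test: the operator with kernel `k` is bounded on `Lʳ`. -/
theorem lintegral_schur {k : ℝ → ℝ → ℝ≥0∞} (hk : Measurable (Function.uncurry k))
    {K : ℝ≥0∞} (hK : K ≠ ⊤) (h1 : ∀ x, ∫⁻ y, k x y ≤ K) (h2 : ∀ y, ∫⁻ x, k x y ≤ K) {f : ℝ → ℝ≥0∞}
    (hf : Measurable f) {r : ℝ} (hr : 1 ≤ r) :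
    ∫⁻ x, (∫⁻ y, k x y * f y) ^ r ≤ K ^ r * ∫⁻ y, f y ^ r := by
  have hr0 : 0 < r := by linarith
  have hkx : ∀ x, Measurable (k x) := fun x => hk.comp measurable_prodMk_left
  have hpt : ∀ x, (∫⁻ y, k x y * f y) ^ r ≤ K ^ (r - 1) * ∫⁻ y, k x y * f y ^ r := by
    intro x
    -- The row `k x` is viewed as a measure of mass at most `K`; Hölder's inequality for it compares
    -- the `L¹` and `Lʳ` norms of `f`.
    set ν := volume.withDensity (k x) with hν
    have e1 : ∀ g : ℝ → ℝ≥0∞, Measurable g → ∫⁻ y, g y ∂ν = ∫⁻ y, k x y * g y := by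
      intro g hg
      rw [hν, lintegral_withDensity_eq_lintegral_mul _ (hkx x) hg]
      rfl
    have e2 : ν univ ≤ K := by
      have := e1 (fun _ => 1) measurable_const
      simp only [lintegral_one, mul_one] at this
      rw [this]; exact h1 x
    have h := eLpNorm_le_eLpNorm_mul_rpow_measure_univ (μ := ν) (p := 1) (q := ENNReal.ofReal r)
      (by rw [← ENNReal.ofReal_one]; exact ENNReal.ofReal_le_ofReal hr) hf.aestronglyMeasurable
    rw [eLpNorm_one_eq_lintegral_enorm, eLpNorm_eq_lintegral_rpow_enorm_toReal
      (by simpa using hr0) ENNReal.ofReal_ne_top, ENNReal.toReal_ofReal hr0.le,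
      ENNReal.toReal_one] at h
    simp only [enorm_eq_self] at h
    rw [e1 f hf, e1 _ (hf.pow_const r)] at h
    have h' := ENNReal.rpow_le_rpow h hr0.le
    rw [ENNReal.mul_rpow_of_nonneg _ _ hr0.le, ← ENNReal.rpow_mul, ← ENNReal.rpow_mul,
      one_div_mul_cancel hr0.ne', ENNReal.rpow_one, mul_comm] at h'
    refine h'.trans ?_
    gcongr
    have e3 : (1 / 1 - 1 / r) * r = r - 1 := by field_simp
    rw [e3]
    exact ENNReal.rpow_le_rpow e2 (by linarith)
  calc ∫⁻ x, (∫⁻ y, k x y * f y) ^ r ≤ ∫⁻ x, K ^ (r - 1) * ∫⁻ y, k x y * f y ^ r :=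
        lintegral_mono hpt
    _ = K ^ (r - 1) * ∫⁻ x, ∫⁻ y, k x y * f y ^ r := by
        rw [lintegral_const_mul' _ _ (ENNReal.rpow_ne_top_of_nonneg (by linarith) hK)]
    _ = K ^ (r - 1) * ∫⁻ y, ∫⁻ x, k x y * f y ^ r := by
        rw [lintegral_lintegral_swap]
        exact (hk.mul ((hf.pow_const r).comp measurable_snd)).aemeasurable
    _ ≤ K ^ (r - 1) * ∫⁻ y, K * f y ^ r := by
        gcongr with y
        have hky : Measurable fun x => k x y := hk.comp measurable_prodMk_right
        rw [lintegral_mul_const _ hky]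
        gcongr
        exact h2 y
    _ = K ^ r * ∫⁻ y, f y ^ r := by
        rw [lintegral_const_mul _ (hf.pow_const r), ← mul_assoc]
        congr 1
        nth_rewrite 2 [← ENNReal.rpow_one K]
        rw [← ENNReal.rpow_add_of_nonneg _ _ (by linarith) zero_le_one]
        congr 1; ring

end Kernel

end PrivateWavelet

namespace PrivateWavelet

/-! ### The risk of the linear estimator -/

section Risk

theorem lintegral_densityLaw {f : ℝ → ℝ} (hf : Measurable f) {g : ℝ → ℝ≥0∞} (hg : Measurable g) :
    ∫⁻ x, g x ∂(densityLaw f) = ∫⁻ x, ENNReal.ofReal (f x) * g x := by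
  rw [densityLaw, lintegral_withDensity_eq_lintegral_mul _ hf.ennreal_ofReal hg]
  rfl

theorem integral_densityLaw {f : ℝ → ℝ} (hf : Measurable f) (h0 : ∀ x, 0 ≤ f x) (g : ℝ → ℝ) :
    ∫ x, g x ∂(densityLaw f) = ∫ x, f x * g x := by
  rw [densityLaw, integral_withDensity_eq_integral_toReal_smul hf.ennreal_ofReal
    (Filter.Eventually.of_forall fun x => ENNReal.ofReal_lt_top)]
  simp only [ENNReal.toReal_ofReal (h0 _), smul_eq_mul]

theorem isProbabilityMeasure_densityLaw {f : ℝ → ℝ} (h0 : ∀ x, 0 ≤ f x)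
    (hi : Integrable f volume) (h1 : ∫ x, f x = 1) : IsProbabilityMeasure (densityLaw f) := by
  constructor
  rw [densityLaw, withDensity_apply _ MeasurableSet.univ, Measure.restrict_univ,
    ← ofReal_integral_eq_lintegral_ofReal hi (Filter.Eventually.of_forall h0), h1,
    ENNReal.ofReal_one]

variable {A B T : ℝ} {φ ψ : ℝ → ℝ}

/-- The kernel of the wavelet projection. -/
noncomputable def waveletKernel (φ ψ : ℝ → ℝ) (A T : ℝ) (j₁ : ℕ) (x y : ℝ) : ℝ :=
  ∑ c : CoeffIndex A T j₁, atom φ ψ c y * atom φ ψ c x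

theorem measurable_waveletKernel (hφ : BoundedSupported A B φ) (hψ : BoundedSupported A B ψ)
    (T : ℝ) (j₁ : ℕ) (x : ℝ) : Measurable (waveletKernel φ ψ A T j₁ x) :=
  Finset.measurable_fun_sum _ fun c _ => (measurable_atom hφ hψ c).mul_const _

theorem abs_waveletKernel_le (hφ : BoundedSupported A B φ) (hψ : BoundedSupported A B ψ)
    (hA : 0 ≤ A) (T : ℝ) (j₁ : ℕ) (x y : ℝ) :
    |waveletKernel φ ψ A T j₁ x y| ≤ overlap A * B ^ 2 * geomConst * 2 ^ j₁ := by
  refine (Finset.abs_sum_le_sum_abs _ _).trans ?_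
  simp only [abs_mul]
  exact sum_atom_le hφ hψ hA T j₁ y x

/-- This identifies the mean of the estimator. The levels `0, …, j₁` are the first `j₁ + 1` mother
levels, whence the index of the partial sum. -/
theorem integral_waveletKernel (hφ : BoundedSupported A B φ) (hψ : BoundedSupported A B ψ)
    {f : ℝ → ℝ} (hf : Measurable f) (h0 : ∀ x, 0 ≤ f x) (hi : Integrable f volume) (j₁ : ℕ) (x : ℝ) :
    ∫ y, waveletKernel φ ψ A T j₁ x y ∂(densityLaw f) = partialSum φ ψ A T (j₁ + 1) f x := by
  rw [integral_densityLaw hf h0]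
  unfold waveletKernel
  simp only [Finset.mul_sum, ← mul_assoc]
  have hint : ∀ c : CoeffIndex A T j₁, Integrable (fun y => f y * atom φ ψ c y * atom φ ψ c x) volume := by
    intro c
    refine Integrable.mul_const ?_ _
    rcases c with k | ⟨j, k⟩
    · exact (hφ.dil _ _).integrable_mul hi
    · exact (hψ.dil _ _).integrable_mul hi
  rw [integral_finsetSum _ fun c _ => hint c]
  simp only [integral_mul_const]
  rw [sum_coeffIndex (A := A) (T := T) (j₁ := j₁)
    (fun c => (∫ y, f y * atom φ ψ c y) * atom φ ψ c x)
    (fun k => coeff φ f (0 : ℕ) k * dil φ (0 : ℕ) k x) (fun j k => coeff ψ f j k * dil ψ j k x)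
    (fun k => rfl) (fun j k => rfl)]
  rfl

/-- Exchanging the sums over coefficients and observations brings the estimator at `x` into the form
treated by `lintegral_mean_rpow_le`. -/
theorem linearEstimator_privateView (φ ψ : ℝ → ℝ) (A T : ℝ) (j₁ n : ℕ) (α : ℝ)
    (ω : Fin n → ℝ × (CoeffIndex A T j₁ → ℝ)) (x : ℝ) :
    linearEstimator φ ψ (fun i => privateView φ ψ α (ω i).1 (ω i).2) x =
      (1 / (n : ℝ)) * ∑ i, (waveletKernel φ ψ A T j₁ x (ω i).1 +
        ∑ c : CoeffIndex A T j₁, (noiseScale φ ψ α c * atom φ ψ c x) * (ω i).2 c) := by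
  unfold linearEstimator privateView waveletKernel
  simp only [mul_assoc, Finset.sum_mul, ← Finset.mul_sum]
  congr 1
  rw [Finset.sum_comm]
  refine Finset.sum_congr rfl fun i _ => ?_
  rw [← Finset.sum_add_distrib]
  refine Finset.sum_congr rfl fun c _ => ?_
  ring

theorem supNorm_le {g : ℝ → ℝ} (hg : BoundedSupported A B g) : supNorm g ≤ B :=
  ciSup_le hg.bound

theorem supNorm_nonneg (g : ℝ → ℝ) : 0 ≤ supNorm g := Real.iSup_nonneg fun _ => abs_nonneg _

/-- The constant in the bound of the noise level by `2 ^ (j₁ / 2) / α`. -/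
noncomputable def noiseConst (A B : ℝ) : ℝ := 4 * overlap A * B * geomConst

/-- The mother noise is already of order `2^{j₁/2} / α` at every level; using the same bound for the
smaller father noise does not affect the rate. -/
theorem abs_noiseScale_le (hφ : BoundedSupported A B φ) (hψ : BoundedSupported A B ψ) (hA : 0 ≤ A)
    {α : ℝ} (hα : 0 < α) {j₁ : ℕ} (c : CoeffIndex A T j₁) :
    noiseScale φ ψ α c ^ 2 ≤ (noiseConst A B / α) ^ 2 * 2 ^ j₁ := by
  have hO : 0 ≤ overlap A := zero_le_one.trans (one_le_overlap hA)
  have hB := hφ.nonneg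
  have h2 : (2 : ℝ) ^ j₁ = ((2 : ℝ) ^ ((j₁ : ℝ) / 2)) ^ 2 := by
    rw [sq, ← Real.rpow_add two_pos, add_halves, Real.rpow_natCast]
  have hs : 1 < √2 := by rw [Real.lt_sqrt] <;> norm_num
  have hs0 : 0 ≤ √2 / (√2 - 1) := div_nonneg (by linarith) (by linarith)
  have h3 : (1 : ℝ) ≤ (2 : ℝ) ^ ((j₁ : ℝ) / 2) := Real.one_le_rpow one_le_two (by positivity)
  have hφB := supNorm_le hφ
  have hψB := supNorm_le hψ
  have hφ0 := supNorm_nonneg φ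
  have hψ0 := supNorm_nonneg ψ
  rw [h2, ← mul_pow]
  rcases c with k | ⟨j, k⟩
  · refine pow_le_pow_left₀ (div_nonneg (by positivity) hα.le) ?_ 2
    simp only [noiseConst, geomConst]
    calc 4 * overlap A * supNorm φ / α ≤ 4 * overlap A * B / α * 1 * 1 := by
          rw [mul_one, mul_one]; gcongr
      _ ≤ 4 * overlap A * B / α * (1 + √2 / (√2 - 1)) * (2 : ℝ) ^ ((j₁ : ℝ) / 2) := by
          gcongr
          linarith
      _ = _ := by ring
  · have h4 : 0 ≤ 4 * overlap A * supNorm ψ / α := by positivity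
    refine pow_le_pow_left₀ (by simp only [noiseScale]; positivity) ?_ 2
    simp only [noiseScale, noiseConst, geomConst]
    calc _ ≤ 4 * overlap A * B / α * (1 + √2 / (√2 - 1)) * (2 : ℝ) ^ ((j₁ : ℝ) / 2) := by
          gcongr
          linarith
      _ = _ := by ring

theorem lossPow_le (r : ℝ) (hr : 1 ≤ r) (g h f : ℝ → ℝ) (hg : Measurable g) (hh : Measurable h) :
    lossPow r g f ≤ 2 ^ (r - 1) * ((∫⁻ x, ‖g x - h x‖ₑ ^ r) + ∫⁻ x, ‖f x - h x‖ₑ ^ r) := by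
  unfold lossPow
  have hgh : Measurable fun x => ‖g x - h x‖ₑ ^ r := (hg.sub hh).enorm.pow_const r
  rw [← lintegral_add_left hgh,
    ← lintegral_const_mul' _ _ (ENNReal.rpow_ne_top_of_nonneg (by linarith) ENNReal.ofNat_ne_top)]
  refine lintegral_mono fun x => ?_
  refine le_trans ?_ (ENNReal.rpow_add_le_mul_rpow_add_rpow _ _ hr)
  refine ENNReal.rpow_le_rpow ?_ (by linarith)
  have : g x - f x = (g x - h x) - (f x - h x) := by ring
  rw [this]
  exact enorm_sub_le

/-- Pointwise moment bound for the stochastic error of the linear estimator. -/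
theorem lintegral_error_rpow_le (hφ : BoundedSupported A B φ) (hψ : BoundedSupported A B ψ)
    (hA : 0 ≤ A) (hB : 0 < B) {f : ℝ → ℝ} (hf : Measurable f) (h0 : ∀ x, 0 ≤ f x)
    (hi : Integrable f volume) (h1 : ∫ x, f x = 1) {r : ℝ} (hr : 1 ≤ r) {n : ℕ} (hn : 1 ≤ n)
    {α : ℝ} (hα : 0 < α) (j₁ : ℕ) {K ρ : ℝ} (hK : 0 ≤ K) (hρ : 0 ≤ ρ) (hρ1 : ρ ≤ 1)
    (hd : (2 : ℝ) ^ j₁ / n ≤ K * ρ ^ 2) (hp : (2 : ℝ) ^ j₁ * 2 ^ j₁ / (n * α ^ 2) ≤ K * ρ ^ 2) (x : ℝ) :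
    ∫⁻ ω, ‖linearEstimator φ ψ (fun i => privateView φ ψ α (ω i).1 (ω i).2) x -
        partialSum φ ψ A T (j₁ + 1) f x‖ₑ ^ r ∂(sampleLaw f A T j₁ n) ≤
      ENNReal.ofReal (2 * (1 + (⌈r⌉₊.factorial : ℝ)) * Real.exp (3 / 2) *
        ((1 + overlap A * B ^ 2 * geomConst * K) * (2 + 2 * noiseConst A B)) ^ r * ρ ^ r *
          (1 + ∫ y, majorant φ ψ A T j₁ x y ∂(densityLaw f)) ^ r) := by
  have hO : 0 < overlap A := zero_lt_one.trans_le (one_le_overlap hA)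
  have hgc := geomConst_pos
  have hPr := isProbabilityMeasure_densityLaw h0 hi h1
  have hn0 : (0 : ℝ) < n := by exact_mod_cast hn
  set F := ∫ y, majorant φ ψ A T j₁ x y ∂(densityLaw f) with hF
  have hF0 : 0 ≤ F := integral_nonneg fun y => majorant_nonneg _ _ _ _ _ _ _
  set E := overlap A * B ^ 2 * geomConst with hE
  have hE0 : 0 < E := by positivity
  set N := noiseConst A B with hN
  have hN0 : 0 ≤ N := by rw [hN, noiseConst]; positivity
  have hmaj : Integrable (majorant φ ψ A T j₁ x) (densityLaw f) :=
    Integrable.of_bound ((measurable_majorant hφ hψ T j₁).comp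
      measurable_prodMk_left).aestronglyMeasurable (E * 2 ^ j₁)
      (Filter.Eventually.of_forall fun y => by
        rw [Real.norm_eq_abs, abs_of_nonneg (majorant_nonneg _ _ _ _ _ _ _)]
        exact majorant_le hφ hψ hA T j₁ x y)
  -- Keeping the local factor `F` here replaces a supremum of `f`, which may be infinite on the
  -- class.
  have hV : ∫ y, waveletKernel φ ψ A T j₁ x y ^ 2 ∂(densityLaw f) ≤ E * 2 ^ j₁ * F := by
    rw [hF, ← integral_const_mul]
    refine integral_mono_of_nonneg (Filter.Eventually.of_forall fun y => sq_nonneg _)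
      (hmaj.const_mul _) (Filter.Eventually.of_forall fun y => ?_)
    exact sq_sum_atom_le hφ hψ hA T j₁ x y
  have hD : ∑ c : CoeffIndex A T j₁, (noiseScale φ ψ α c * atom φ ψ c x) ^ 2 ≤
      (N / α) ^ 2 * 2 ^ j₁ * (E * 2 ^ j₁) := by
    calc _ ≤ ∑ c : CoeffIndex A T j₁, (N / α) ^ 2 * 2 ^ j₁ * (|atom φ ψ c x| * |atom φ ψ c x|) := by
          refine Finset.sum_le_sum fun c _ => ?_
          rw [mul_pow, abs_mul_abs_self, ← sq]
          exact mul_le_mul_of_nonneg_right (abs_noiseScale_le hφ hψ hA hα c) (sq_nonneg _)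
      _ ≤ _ := by
          rw [← Finset.mul_sum]
          exact mul_le_mul_of_nonneg_left (sum_atom_le hφ hψ hA T j₁ x x) (by positivity)
  have key := lintegral_mean_rpow_le (P := densityLaw f) (measurable_waveletKernel hφ hψ T j₁ x)
    (M := E * 2 ^ j₁) (by positivity) (by positivity) (by positivity)
    (abs_waveletKernel_le hφ hψ hA T j₁ x) hV _ hD hn (r := r) (by linarith)
  rw [integral_waveletKernel hφ hψ hf h0 hi] at key
  simp only [linearEstimator_privateView]
  refine le_trans key (ENNReal.ofReal_le_ofReal ?_)
  rw [mul_assoc _ (ρ ^ r), mul_assoc _ (_ ^ r) (ρ ^ r * _)]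
  refine mul_le_mul_of_nonneg_left ?_ (by positivity)
  rw [← mul_assoc (_ ^ r), ← Real.mul_rpow (by positivity) hρ, ← Real.mul_rpow (by positivity) (by linarith)]
  refine Real.rpow_le_rpow (by positivity) ?_ (by linarith)
  have hEK : 0 ≤ E * K := by positivity
  have hsq : √(E * K) ≤ 1 + E * K := by
    rw [Real.sqrt_le_left (by positivity)]; nlinarith
  -- The range term is even of order `ρ²`; `ρ ≤ 1` reduces it to `ρ`.
  have b1 : E * 2 ^ j₁ / n ≤ (1 + E * K) * ρ := by
    calc E * 2 ^ j₁ / n = E * (2 ^ j₁ / n) := by ring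
      _ ≤ E * (K * ρ ^ 2) := by gcongr
      _ = E * K * ρ * ρ := by ring
      _ ≤ E * K * ρ * 1 := by gcongr
      _ ≤ (1 + E * K) * ρ := by linarith
  have b2 : √(E * 2 ^ j₁ * F / n) ≤ (1 + E * K) * ρ * (1 + F) := by
    have hsF : √F ≤ 1 + F := by
      rw [Real.sqrt_le_left (by positivity)]; nlinarith
    calc √(E * 2 ^ j₁ * F / n) ≤ √(E * K * ρ ^ 2 * F) := by
          apply Real.sqrt_le_sqrt
          calc E * 2 ^ j₁ * F / n = E * (2 ^ j₁ / n) * F := by ring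
            _ ≤ E * (K * ρ ^ 2) * F := by gcongr
            _ = _ := by ring
      _ = √(E * K) * ρ * √F := by
          rw [Real.sqrt_mul (by positivity), Real.sqrt_mul (by positivity), Real.sqrt_sq hρ]
      _ ≤ _ := by gcongr
  have b3 : √((N / α) ^ 2 * 2 ^ j₁ * (E * 2 ^ j₁) / n) ≤ N * ((1 + E * K) * ρ) := by
    calc _ ≤ √(N ^ 2 * (E * K * ρ ^ 2)) := by
          apply Real.sqrt_le_sqrt
          calc (N / α) ^ 2 * 2 ^ j₁ * (E * 2 ^ j₁) / n =
              N ^ 2 * (E * (2 ^ j₁ * 2 ^ j₁ / (n * α ^ 2))) := by field_simp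
            _ ≤ N ^ 2 * (E * (K * ρ ^ 2)) := by gcongr
            _ = _ := by ring
      _ = N * (√(E * K) * ρ) := by
          rw [Real.sqrt_mul (by positivity), Real.sqrt_sq hN0, Real.sqrt_mul (by positivity),
            Real.sqrt_sq hρ]
      _ ≤ _ := by gcongr
  have hq : 0 ≤ (1 + E * K) * ρ := by positivity
  have hqF : 0 ≤ (1 + E * K) * ρ * F := by positivity
  have hqFN : 0 ≤ (1 + E * K) * ρ * F * N := by positivity
  -- The range and sampling terms fit into the summand `2`, and the privacy term, which has factor
  -- `2` in `lintegral_mean_rpow_le`, into `2N`.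
  have e1 : (1 + E * K) * (2 + 2 * N) * ρ * (1 + F) = 2 * ((1 + E * K) * ρ) +
    2 * ((1 + E * K) * ρ * F) + 2 * (N * ((1 + E * K) * ρ)) + 2 * ((1 + E * K) * ρ * F * N) := by ring
  have b2' : (1 + E * K) * ρ * (1 + F) = (1 + E * K) * ρ + (1 + E * K) * ρ * F := by ring
  have hqN : 0 ≤ N * ((1 + E * K) * ρ) := by positivity
  rw [b2'] at b2
  rw [e1]
  linarith

/-- The integrated stochastic error of the linear estimator. -/
theorem lintegral_lintegral_error_le (hφ : BoundedSupported A B φ) (hψ : BoundedSupported A B ψ)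
    (hA : 0 ≤ A) (hB : 0 < B) {f : ℝ → ℝ} (hfm : Measurable f) (hf0 : ∀ x, 0 ≤ f x)
    (hfi : Integrable f volume) (hf1 : ∫ x, f x = 1) {r : ℝ} (hr : 1 ≤ r) {Cf : ℝ} (hCf : 0 ≤ Cf)
    (hfr : ∫⁻ x, ENNReal.ofReal (f x) ^ r ≤ ENNReal.ofReal Cf) (hT : 0 < T) {n : ℕ} (hn : 1 ≤ n)
    {α : ℝ} (hα : 0 < α) (j₁ : ℕ) {K ρ C₁ : ℝ} (hK : 0 ≤ K) (hρ0 : 0 ≤ ρ) (hρ1 : ρ ≤ 1)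
    (hd : (2 : ℝ) ^ j₁ / n ≤ K * ρ ^ 2) (hp : (2 : ℝ) ^ j₁ * 2 ^ j₁ / (n * α ^ 2) ≤ K * ρ ^ 2)
    (hC₁0 : 0 ≤ C₁) (hC₁ : C₁ = 2 * (1 + (⌈r⌉₊.factorial : ℝ)) * Real.exp (3 / 2) *
        ((1 + overlap A * B ^ 2 * geomConst * K) * (2 + 2 * noiseConst A B)) ^ r) :
    ∫⁻ x, ∫⁻ ω, ‖linearEstimator φ ψ (fun i => privateView φ ψ α (ω i).1 (ω i).2) x -
        partialSum φ ψ A T (j₁ + 1) f x‖ₑ ^ r ∂(sampleLaw f A T j₁ n) ≤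
      ENNReal.ofReal (C₁ * ((2 : ℝ) ^ (r - 1) * (2 * (T + 2 * A) +
        (overlap A * B * (B * (2 * A)) * geomConst) ^ r * Cf)) * ρ ^ r) := by
  have hr0 : 0 < r := by linarith
  have hO : 0 < overlap A := zero_lt_one.trans_le (one_le_overlap hA)
  have hgc := geomConst_pos
  have hPr := isProbabilityMeasure_densityLaw hf0 hfi hf1
  set R := T + 2 * A with hR
  have hR0 : 0 < R := by positivity
  set H := overlap A * B * (B * (2 * A)) * geomConst with hH
  have hH0 : 0 ≤ H := by positivity
  set F : ℝ → ℝ := fun x => ∫ y, majorant φ ψ A T j₁ x y ∂(densityLaw f) with hFdef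
  have hF0 : ∀ x, 0 ≤ F x := fun x => integral_nonneg fun y => majorant_nonneg _ _ _ _ _ _ _
  have hmajm : Measurable (Function.uncurry fun x y => ENNReal.ofReal (majorant φ ψ A T j₁ x y)) :=
    (measurable_majorant hφ hψ T j₁).ennreal_ofReal
  have hF : ∀ x, ENNReal.ofReal (F x) =
      ∫⁻ y, ENNReal.ofReal (majorant φ ψ A T j₁ x y) * ENNReal.ofReal (f y) := by
    intro x
    have hmx : Measurable (majorant φ ψ A T j₁ x) :=
      (measurable_majorant hφ hψ T j₁).comp measurable_prodMk_left
    rw [hFdef, ofReal_integral_eq_lintegral_ofReal (Integrable.of_bound hmx.aestronglyMeasurable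
      (overlap A * B ^ 2 * geomConst * 2 ^ j₁)
      (Filter.Eventually.of_forall fun y => by
        rw [Real.norm_eq_abs, abs_of_nonneg (majorant_nonneg _ _ _ _ _ _ _)]
        exact majorant_le hφ hψ hA T j₁ x y))
      (Filter.Eventually.of_forall fun y => majorant_nonneg _ _ _ _ _ _ _),
      lintegral_densityLaw hfm hmx.ennreal_ofReal]
    simp only [mul_comm]
  -- `majorant` is symmetric, so one integral bound serves for both conditions in Schur's test.
  have hschur : ∫⁻ x, ENNReal.ofReal (F x) ^ r ≤ ENNReal.ofReal (H ^ r * Cf) := by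
    simp only [hF]
    refine (lintegral_schur hmajm (K := ENNReal.ofReal H) ENNReal.ofReal_ne_top
      (lintegral_majorant_le hφ hψ hA T j₁) (fun y => ?_) hfm.ennreal_ofReal hr).trans ?_
    · simp only [majorant_comm φ ψ A T j₁ _ y]
      exact lintegral_majorant_le hφ hψ hA T j₁ y
    · rw [ENNReal.ofReal_rpow_of_nonneg hH0 hr0.le,
        ENNReal.ofReal_mul (Real.rpow_nonneg hH0 r)]
      gcongr
  have h2r : (0 : ℝ) ≤ 2 ^ (r - 1) := Real.rpow_nonneg zero_le_two _
  have hHC : 0 ≤ H ^ r * Cf := mul_nonneg (Real.rpow_nonneg hH0 r) hCf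
  have hCρ : 0 ≤ C₁ * ρ ^ r := mul_nonneg hC₁0 (Real.rpow_nonneg hρ0 r)
  have h2top : (2 : ℝ≥0∞) ^ (r - 1) ≠ ⊤ :=
    ENNReal.rpow_ne_top_of_nonneg (by linarith) ENNReal.ofNat_ne_top
  calc _ ≤ ∫⁻ x, ENNReal.ofReal (C₁ * ρ ^ r) * (2 ^ (r - 1) * ((Icc (-R) R).indicator 1 x +
        ENNReal.ofReal (F x) ^ r)) := by
        refine lintegral_mono fun x => ?_
        -- All atoms vanish off `[-R, R]`, so the constant in `1 + F` is integrated over an interval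
        -- of length `2R` only.
        by_cases hx : x ∈ Icc (-R) R
        · refine (lintegral_error_rpow_le hφ hψ hA hB hfm hf0 hfi hf1 hr hn hα j₁ hK hρ0 hρ1
            hd hp x).trans ?_
          have h1F : 0 ≤ 1 + F x := by linarith [hF0 x]
          rw [← hC₁, ENNReal.ofReal_mul hCρ, indicator_of_mem hx, Pi.one_apply]
          refine mul_le_mul' le_rfl ?_
          rw [← ENNReal.ofReal_rpow_of_nonneg h1F hr0.le, ENNReal.ofReal_add zero_le_one (hF0 x),
            ENNReal.ofReal_one]
          have := ENNReal.rpow_add_le_mul_rpow_add_rpow 1 (ENNReal.ofReal (F x)) hr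
          rwa [ENNReal.one_rpow] at this
        · have h1 : ∀ ω : Fin n → ℝ × (CoeffIndex A T j₁ → ℝ),
              linearEstimator φ ψ (fun i => privateView φ ψ α (ω i).1 (ω i).2) x = 0 := fun ω =>
            Finset.sum_eq_zero fun c _ => by rw [atom_eq_zero hφ hψ hA c hx, mul_zero]
          have h2 : partialSum φ ψ A T (j₁ + 1) f x = 0 := by
            rw [← integral_waveletKernel hφ hψ hfm hf0 hfi]
            simp [waveletKernel, atom_eq_zero hφ hψ hA _ hx]
          simp [h1, h2, hr0]
    _ = ENNReal.ofReal (C₁ * ρ ^ r) * (2 ^ (r - 1) * (ENNReal.ofReal (2 * R) +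
        ∫⁻ x, ENNReal.ofReal (F x) ^ r)) := by
        rw [lintegral_const_mul' _ _ ENNReal.ofReal_ne_top, lintegral_const_mul' _ _ h2top,
          lintegral_add_left (measurable_one.indicator measurableSet_Icc),
          lintegral_indicator_one measurableSet_Icc, Real.volume_Icc]
        congr 4; ring
    _ ≤ ENNReal.ofReal (C₁ * ρ ^ r) * (2 ^ (r - 1) * (ENNReal.ofReal (2 * R) +
        ENNReal.ofReal (H ^ r * Cf))) := by gcongr
    _ = _ := by
        rw [← ENNReal.ofReal_add (by positivity) hHC, ← ENNReal.ofReal_ofNat 2,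
          ENNReal.ofReal_rpow_of_nonneg zero_le_two (by linarith),
          ← ENNReal.ofReal_mul h2r, ← ENNReal.ofReal_mul hCρ]
        congr 1; ring

/-- The risk bound of the linear estimator in terms of the highest resolution level. -/
theorem exists_linearRisk_le (hφ : BoundedSupported A B φ) (hψ : BoundedSupported A B ψ)
    (hA : 0 ≤ A) (hB : 0 < B) (hT : 0 < T) (hm : GeneratesMRA φ) (hw : IsMotherWavelet φ ψ)
    {s p L r K : ℝ} {q : ℝ≥0∞} (hL : 0 ≤ L) (hq : q ≠ 0) (hp : 1 ≤ p) (hr : 1 ≤ r)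
    (hs' : 0 < effSmoothness s p r) (hK : 0 ≤ K) :
    ∃ C : ℝ, 0 < C ∧ ∀ (n : ℕ) (α : ℝ) (j₁ : ℕ), 1 ≤ n → 0 < α →
      (2 : ℝ) ^ ((j₁ : ℝ) * (2 * effSmoothness s p r + 1)) ≤ K * n →
      (2 : ℝ) ^ ((j₁ : ℝ) * (2 * effSmoothness s p r + 2)) ≤ K * (n * α ^ 2) →
      ∀ f ∈ densityClass φ ψ s p q L T, linearRisk φ ψ A T r j₁ n α f ≤
        ENNReal.ofReal (C * (2 : ℝ) ^ (-((j₁ : ℝ) * (r * effSmoothness s p r)))) := by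
  obtain ⟨Ca, hCa, happ⟩ := exists_approximation (q := q) hφ hψ hA hT.le hm hw hL hq hp hr hs'
  set t := effSmoothness s p r with ht
  have hr0 : 0 < r := by linarith
  have hO : 0 < overlap A := zero_lt_one.trans_le (one_le_overlap hA)
  have hgc := geomConst_pos
  set C₁ := 2 * (1 + (⌈r⌉₊.factorial : ℝ)) * Real.exp (3 / 2) *
        ((1 + overlap A * B ^ 2 * geomConst * K) * (2 + 2 * noiseConst A B)) ^ r with hC₁
  have hN0 : 0 ≤ noiseConst A B := by rw [noiseConst]; positivity
  have hC₁0 : 0 ≤ C₁ := by positivity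
  set R := T + 2 * A with hR
  set H := overlap A * B * (B * (2 * A)) * geomConst with hH
  have hH0 : 0 ≤ H := by positivity
  set C₂ := (2 : ℝ) ^ (r - 1) * (2 * R + H ^ r * Ca ^ r) with hC₂
  have hR0 : 0 < R := by positivity
  have hC₂0 : 0 ≤ C₂ := by positivity
  refine ⟨(2 : ℝ) ^ (r - 1) * (C₁ * C₂ + Ca ^ r) + 1, by positivity, ?_⟩
  intro n α j₁ hn hα hd hpv f hf
  obtain ⟨hfm, hf0, hfi, hf1, hfT, hfJ⟩ := id hf
  have hn0 : (0 : ℝ) < n := by exact_mod_cast hn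
  have hPr := isProbabilityMeasure_densityLaw hf0 hfi hf1
  -- `ρ` is the target accuracy in `Lʳ`. The two hypotheses on `j₁` say exactly that the squared
  -- sampling and privacy deviations are at most `K ρ²`.
  set ρ := (2 : ℝ) ^ (-((j₁ : ℝ) * t)) with hρ
  have hρ0 : 0 < ρ := Real.rpow_pos_of_pos two_pos _
  have hρ1 : ρ ≤ 1 := Real.rpow_le_one_of_one_le_of_nonpos one_le_two (by
    have : 0 ≤ (j₁ : ℝ) * t := by positivity
    linarith)
  have hj : (2 : ℝ) ^ j₁ = (2 : ℝ) ^ (j₁ : ℝ) := (Real.rpow_natCast 2 j₁).symm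
  have hd' : (2 : ℝ) ^ j₁ / n ≤ K * ρ ^ 2 := by
    have e1 : (2 : ℝ) ^ j₁ = (2 : ℝ) ^ ((j₁ : ℝ) * (2 * t + 1)) * ρ ^ 2 := by
      rw [hj, hρ, sq, ← Real.rpow_add two_pos, ← Real.rpow_add two_pos]
      congr 1; ring
    rw [div_le_iff₀ hn0, e1]
    calc _ ≤ K * n * ρ ^ 2 := by gcongr
      _ = _ := by ring
  have hp' : (2 : ℝ) ^ j₁ * 2 ^ j₁ / (n * α ^ 2) ≤ K * ρ ^ 2 := by
    have e1 : (2 : ℝ) ^ j₁ * 2 ^ j₁ = (2 : ℝ) ^ ((j₁ : ℝ) * (2 * t + 2)) * ρ ^ 2 := by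
      rw [hj, hρ, sq, ← Real.rpow_add two_pos, ← Real.rpow_add two_pos, ← Real.rpow_add two_pos]
      congr 1; ring
    rw [div_le_iff₀ (by positivity), e1]
    calc _ ≤ K * (n * α ^ 2) * ρ ^ 2 := by gcongr
      _ = _ := by ring
  have hρr : (2 : ℝ) ^ (-((j₁ : ℝ) * (r * t))) = ρ ^ r := by
    rw [hρ, ← Real.rpow_mul two_pos.le]; congr 1; ring
  have hmeasE : Measurable fun z : (Fin n → ℝ × (CoeffIndex A T j₁ → ℝ)) × ℝ =>
      linearEstimator φ ψ (fun i => privateView φ ψ α (z.1 i).1 (z.1 i).2) z.2 := by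
    have hat : ∀ c : CoeffIndex A T j₁, Measurable (atom φ ψ c) := measurable_atom hφ hψ
    unfold linearEstimator privateView
    refine Finset.measurable_fun_sum _ fun c _ => Measurable.mul (Measurable.const_mul
      (Finset.measurable_fun_sum _ fun i _ => ?_) _) ((hat c).comp measurable_snd)
    have hc := hat c
    fun_prop
  have hmeasP := measurable_partialSum hφ hψ T (j₁ + 1) f
  -- The first omitted level is `j₁ + 1`; the extra factor `2^{-t}` is discarded.
  have hbias : ∫⁻ x, ‖f x - partialSum φ ψ A T (j₁ + 1) f x‖ₑ ^ r ≤ ENNReal.ofReal (Ca ^ r * ρ ^ r) := by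
    have h1 := (happ f hf).2 (j₁ + 1)
    rw [eLpNorm_ofReal_eq hr0, one_div, ENNReal.rpow_inv_le_iff hr0,
      ENNReal.ofReal_rpow_of_nonneg (by positivity) hr0.le] at h1
    refine h1.trans (ENNReal.ofReal_le_ofReal ?_)
    rw [← Real.mul_rpow hCa hρ0.le]
    refine Real.rpow_le_rpow (by positivity) ?_ hr0.le
    refine mul_le_mul_of_nonneg_left ?_ hCa
    refine Real.rpow_le_rpow_of_exponent_le one_le_two ?_
    push_cast
    have : ((j₁ : ℝ) + 1) * t = (j₁ : ℝ) * t + t := by ring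
    linarith
  have hf_r : ∫⁻ x, ENNReal.ofReal (f x) ^ r ≤ ENNReal.ofReal Ca ^ r := by
    have h1 := (happ f hf).1
    rw [eLpNorm_ofReal_eq hr0, one_div, ENNReal.rpow_inv_le_iff hr0] at h1
    refine le_trans (le_of_eq ?_) h1
    refine lintegral_congr fun x => ?_
    rw [Real.enorm_of_nonneg (hf0 x)]
  have hvar : ∫⁻ ω, ∫⁻ x, ‖linearEstimator φ ψ (fun i => privateView φ ψ α (ω i).1 (ω i).2) x -
        partialSum φ ψ A T (j₁ + 1) f x‖ₑ ^ r ∂volume ∂(sampleLaw f A T j₁ n) ≤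
      ENNReal.ofReal (C₁ * C₂ * ρ ^ r) := by
    have : IsProbabilityMeasure (sampleLaw f A T j₁ n) := by unfold sampleLaw; infer_instance
    rw [lintegral_lintegral_swap
      ((hmeasE.sub (hmeasP.comp measurable_snd)).enorm.pow_const r).aemeasurable]
    exact lintegral_lintegral_error_le hφ hψ hA hB hfm hf0 hfi hf1 hr (Real.rpow_nonneg hCa r)
      (by rwa [ENNReal.ofReal_rpow_of_nonneg hCa hr0.le] at hf_r) hT hn hα j₁ hK hρ0.le hρ1 hd' hp'
      hC₁0 hC₁
  unfold linearRisk
  calc _ ≤ ∫⁻ ω, 2 ^ (r - 1) * ((∫⁻ x, ‖linearEstimator φ ψ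
          (fun i => privateView φ ψ α (ω i).1 (ω i).2) x - partialSum φ ψ A T (j₁ + 1) f x‖ₑ ^ r) +
            ENNReal.ofReal (Ca ^ r * ρ ^ r)) ∂(sampleLaw f A T j₁ n) := by
        refine lintegral_mono fun ω => ?_
        refine (lossPow_le r hr _ _ f (hmeasE.comp measurable_prodMk_left) hmeasP).trans ?_
        exact mul_le_mul' le_rfl (add_le_add le_rfl hbias)
    _ = 2 ^ (r - 1) * ((∫⁻ ω, ∫⁻ x, ‖linearEstimator φ ψ
          (fun i => privateView φ ψ α (ω i).1 (ω i).2) x - partialSum φ ψ A T (j₁ + 1) f x‖ₑ ^ r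
            ∂volume ∂(sampleLaw f A T j₁ n)) + ENNReal.ofReal (Ca ^ r * ρ ^ r)) := by
        have : IsProbabilityMeasure (sampleLaw f A T j₁ n) := by unfold sampleLaw; infer_instance
        rw [lintegral_const_mul' _ _
            (ENNReal.rpow_ne_top_of_nonneg (by linarith) ENNReal.ofNat_ne_top),
          lintegral_add_right _ measurable_const]
        simp
    _ ≤ 2 ^ (r - 1) * (ENNReal.ofReal (C₁ * C₂ * ρ ^ r) + ENNReal.ofReal (Ca ^ r * ρ ^ r)) :=
        mul_le_mul' le_rfl (add_le_add hvar le_rfl)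
    _ = ENNReal.ofReal (2 ^ (r - 1) * (C₁ * C₂ + Ca ^ r) * ρ ^ r) := by
        rw [← ENNReal.ofReal_add (by positivity) (by positivity), ← ENNReal.ofReal_ofNat 2,
          ENNReal.ofReal_rpow_of_nonneg zero_le_two (by linarith),
          ← ENNReal.ofReal_mul (by positivity)]
        congr 1; ring
    _ ≤ _ := by
        rw [hρr]
        apply ENNReal.ofReal_le_ofReal
        gcongr
        linarith

end Risk

end PrivateWavelet

namespace PrivateWavelet

/-! ### Privacy of the Laplace mechanism -/

section Privacy

theorem pi_eq_withDensity {ι : Type*} [Fintype ι] {Ω : ι → Type*} [∀ i, MeasurableSpace (Ω i)]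
    (ν : ∀ i, Measure (Ω i)) [∀ i, IsProbabilityMeasure (ν i)] (h : ∀ i, Ω i → ℝ≥0∞)
    (hh : ∀ i, Measurable (h i)) [∀ i, SigmaFinite ((ν i).withDensity (h i))] :
    Measure.pi (fun i => (ν i).withDensity (h i)) =
      (Measure.pi ν).withDensity fun ω => ∏ i, h i (ω i) := by
  refine Measure.pi_eq fun s hs => ?_
  have hm : MeasurableSet (univ.pi s) := MeasurableSet.univ_pi hs
  rw [withDensity_apply _ hm, ← lintegral_indicator hm]
  have h1 : ∀ ω : ∀ i, Ω i, (univ.pi s).indicator (fun ω => ∏ i, h i (ω i)) ω =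
      ∏ i, (s i).indicator (h i) (ω i) := by
    intro ω
    by_cases hω : ω ∈ univ.pi s
    · rw [indicator_of_mem hω]
      exact Finset.prod_congr rfl fun i _ => (indicator_of_mem (hω i trivial) _).symm
    · rw [indicator_of_notMem hω]
      simp only [mem_univ_pi, not_forall] at hω
      obtain ⟨i, hi⟩ := hω
      exact (Finset.prod_eq_zero (Finset.mem_univ i) (indicator_of_notMem hi _)).symm
  simp only [h1]
  rw [lintegral_pi_prod ν (fun i => (s i).indicator (h i)) fun i => (hh i).indicator (hs i)]
  refine Finset.prod_congr rfl fun i _ => ?_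
  rw [withDensity_apply _ (hs i), lintegral_indicator (hs i)]

theorem rnDeriv_le_of_le_smul {α : Type*} {m : MeasurableSpace α} {μ ν : Measure α}
    [IsFiniteMeasure μ] [IsFiniteMeasure ν] {c : ℝ≥0∞} (hle : μ ≤ c • ν) :
    ∀ᵐ x ∂ν, μ.rnDeriv ν x ≤ c := by
  have hac : μ ≪ ν := fun s hs => by
    have := hle s
    rw [Measure.smul_apply, hs, smul_zero] at this
    exact le_antisymm this zero_le
  refine ae_le_of_forall_setLIntegral_le_of_sigmaFinite (Measure.measurable_rnDeriv μ ν)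
    fun s hs _ => ?_
  rw [Measure.setLIntegral_rnDeriv hac, setLIntegral_const]
  exact hle s

/-- Products of measures are monotone up to the product of the constants. -/
theorem pi_le_prod_smul {ι : Type*} [Fintype ι] {Ω : ι → Type*} [∀ i, MeasurableSpace (Ω i)]
    (μ ν : ∀ i, Measure (Ω i)) [∀ i, IsProbabilityMeasure (μ i)] [∀ i, IsProbabilityMeasure (ν i)]
    (c : ι → ℝ≥0∞) (h : ∀ i, μ i ≤ c i • ν i) :
    Measure.pi μ ≤ (∏ i, c i) • Measure.pi ν := by
  have hac : ∀ i, μ i ≪ ν i := fun i s hs => by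
    have := h i s
    rw [Measure.smul_apply, hs, smul_zero] at this
    exact le_antisymm this zero_le
  -- For densities the domination becomes a pointwise bound, and pointwise bounds multiply over the
  -- coordinates.
  have hd : ∀ i, (ν i).withDensity ((μ i).rnDeriv (ν i)) = μ i := fun i =>
    Measure.withDensity_rnDeriv_eq _ _ (hac i)
  have hs : ∀ i, SigmaFinite ((ν i).withDensity ((μ i).rnDeriv (ν i))) := fun i => by
    rw [hd i]; infer_instance
  have h1 := pi_eq_withDensity ν (fun i => (μ i).rnDeriv (ν i))
    fun i => Measure.measurable_rnDeriv (μ i) (ν i)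
  simp only [hd] at h1
  have hae : ∀ᵐ ω ∂(Measure.pi ν), ∏ i, (μ i).rnDeriv (ν i) (ω i) ≤ ∏ i, c i := by
    have h2 : ∀ i, ∀ᵐ ω ∂(Measure.pi ν), (μ i).rnDeriv (ν i) (ω i) ≤ c i := fun i =>
      (Measure.quasiMeasurePreserving_eval ν i).ae (rnDeriv_le_of_le_smul (h i))
    filter_upwards [ae_all_iff.2 h2] with ω hω
    exact Finset.prod_le_prod' fun i _ => hω i
  have h3 := withDensity_mono (μ := Measure.pi ν) hae
  rw [← h1] at h3
  refine h3.trans (le_of_eq ?_)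
  exact withDensity_const _

/-- Translating the noise by `(a' - a) / σ` turns one view into the other, and the triangle
inequality in the exponent bounds the ratio of the Laplace densities. -/
theorem map_laplaceLaw_le (a a' : ℝ) {σ : ℝ} (hσ : 0 < σ) :
    laplaceLaw.map (fun w => a + σ * w) ≤
      ENNReal.ofReal (Real.exp (|a - a'| / σ)) • laplaceLaw.map (fun w => a' + σ * w) := by
  refine Measure.le_iff.2 fun s hs => ?_
  have hm : ∀ b : ℝ, Measurable fun w : ℝ => b + σ * w := fun b => by fun_prop
  have hden : Measurable fun x : ℝ => ENNReal.ofReal (1 / 2 * Real.exp (-|x|)) := by fun_prop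
  have hval : ∀ b : ℝ, laplaceLaw.map (fun w => b + σ * w) s =
      ∫⁻ w, ENNReal.ofReal (1 / 2 * Real.exp (-|w|)) * s.indicator 1 (b + σ * w) := by
    intro b
    rw [Measure.map_apply (hm b) hs, laplaceLaw, withDensity_apply _ (hm b hs),
      ← lintegral_indicator (hm b hs)]
    refine lintegral_congr fun w => ?_
    by_cases hw : b + σ * w ∈ s
    · rw [indicator_of_mem (by exact hw), indicator_of_mem hw, Pi.one_apply, mul_one]
    · rw [indicator_of_notMem (by exact hw), indicator_of_notMem hw, mul_zero]
  rw [Measure.smul_apply, smul_eq_mul, hval, hval,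
    ← lintegral_const_mul' _ _ ENNReal.ofReal_ne_top,
    ← lintegral_add_right_eq_self _ ((a' - a) / σ)]
  refine lintegral_mono fun w => ?_
  have e1 : a + σ * (w + (a' - a) / σ) = a' + σ * w := by
    field_simp; ring
  rw [e1, ← mul_assoc, ← ENNReal.ofReal_mul (Real.exp_pos _).le]
  refine mul_le_mul' (ENNReal.ofReal_le_ofReal ?_) le_rfl
  rw [mul_left_comm, ← Real.exp_add]
  gcongr
  have h1 : |a - a'| / σ = |(a' - a) / σ| := by
    rw [abs_div, abs_of_pos hσ, abs_sub_comm]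
  rw [h1]
  have h2 : |w| ≤ |w + (a' - a) / σ| + |(a' - a) / σ| := by
    calc |w| = |(w + (a' - a) / σ) - (a' - a) / σ| := by rw [add_sub_cancel_right]
      _ ≤ _ := abs_sub _ _
  linarith

variable {A B T : ℝ} {φ ψ g : ℝ → ℝ}

theorem BoundedSupported.bounded_supNorm (hg : BoundedSupported A B g) :
    BoundedSupported A (supNorm g) g :=
  ⟨hg.measurable, fun x => le_ciSup (f := fun x => |g x|)
    ⟨B, by rintro _ ⟨y, rfl⟩; exact hg.bound y⟩ x, hg.support⟩

theorem supNorm_pos (hg : BoundedSupported A B g) (ho : OrthonormalShifts g) : 0 < supNorm g := by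
  refine lt_of_le_of_ne (supNorm_nonneg g) fun h0 => ?_
  have h1 : ∀ x, g x = 0 := fun x => by
    have := hg.bounded_supNorm.bound x
    rw [← h0] at this
    exact abs_nonpos_iff.1 this
  have := ho.2 0 0
  simp [h1] at this

theorem sum_abs_dil_sub_le (hg : BoundedSupported A B g) (hA : 0 ≤ A) (s : Finset ℤ) (j : ℤ)
    (x x' : ℝ) : ∑ k ∈ s, |dil g j k x - dil g j k x'| ≤
      2 * ((2 : ℝ) ^ ((j : ℝ) / 2) * (overlap A * B)) := by
  refine (Finset.sum_le_sum fun k _ => abs_sub _ _).trans ?_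
  rw [Finset.sum_add_distrib, two_mul]
  exact add_le_add (hg.sum_abs_dil_le hA s j x) (hg.sum_abs_dil_le hA s j x')

theorem noiseScale_pos (hφ : BoundedSupported A B φ) (hψ : BoundedSupported A B ψ) (hA : 0 ≤ A)
    (hoφ : OrthonormalShifts φ) (hoψ : OrthonormalShifts ψ) {α : ℝ} (hα : 0 < α) {j₁ : ℕ}
    (c : CoeffIndex A T j₁) : 0 < noiseScale φ ψ α c := by
  have hO : 0 < overlap A := zero_lt_one.trans_le (one_le_overlap hA)
  have h1 := supNorm_pos hφ hoφ
  have h2 := supNorm_pos hψ hoψ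
  have hs : 1 < √2 := by rw [Real.lt_sqrt] <;> norm_num
  have hs0 : 0 < √2 / (√2 - 1) := div_pos (by linarith) (by linarith)
  rcases c with k | ⟨j, k⟩
  · simp only [noiseScale]; positivity
  · simp only [noiseScale]; positivity

/-- Budget: half of `α` for the father coefficients, half for all mother levels together. Per level
at most `overlap A` wavelets are active at each of the two points. The factor `4` in the noise level
is two for the two points times two for the halving, and `√2 / (√2 - 1) · 2^{j₁/2}` is the bound of
the geometric sum over the mother levels. -/
theorem sum_abs_atom_sub_div_noiseScale_le (hφ : BoundedSupported A B φ)
    (hψ : BoundedSupported A B ψ) (hA : 0 ≤ A)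
    (hoφ : OrthonormalShifts φ) (hoψ : OrthonormalShifts ψ) {α : ℝ} (hα : 0 < α) (T : ℝ) (j₁ : ℕ)
    (x x' : ℝ) :
    ∑ c : CoeffIndex A T j₁, |atom φ ψ c x - atom φ ψ c x'| / noiseScale φ ψ α c ≤ α := by
  have hO : 0 < overlap A := zero_lt_one.trans_le (one_le_overlap hA)
  have h1 := supNorm_pos hφ hoφ
  have h2 := supNorm_pos hψ hoψ
  have hs : 1 < √2 := by rw [Real.lt_sqrt] <;> norm_num
  set κ := √2 / (√2 - 1) with hκ
  have hs0 : 0 < κ := div_pos (by linarith) (by linarith)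
  set Sψ := 4 * overlap A * supNorm ψ / α * κ * (2 : ℝ) ^ ((j₁ : ℝ) / 2) with hSψ
  have hSψ0 : 0 < Sψ := by positivity
  rw [sum_coeffIndex (A := A) (T := T) (j₁ := j₁)
    (fun c => |atom φ ψ c x - atom φ ψ c x'| / noiseScale φ ψ α c)
    (fun k => |dil φ 0 k x - dil φ 0 k x'| / (4 * overlap A * supNorm φ / α))
    (fun j k => |dil ψ j k x - dil ψ j k x'| / Sψ) (fun k => rfl) (fun j k => rfl)]
  have b1 : ∑ k ∈ translates A T 0, |dil φ 0 k x - dil φ 0 k x'| / (4 * overlap A * supNorm φ / α) ≤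
      α / 2 := by
    rw [← Finset.sum_div, div_le_iff₀ (by positivity)]
    refine (sum_abs_dil_sub_le hφ.bounded_supNorm hA _ 0 x x').trans (le_of_eq ?_)
    simp
    field_simp
    norm_num
  have b2 : ∑ j ∈ Finset.range (j₁ + 1), ∑ k ∈ translates A T j,
      |dil ψ j k x - dil ψ j k x'| / Sψ ≤ α / 2 := by
    simp only [← Finset.sum_div]
    rw [div_le_iff₀ hSψ0]
    calc _ ≤ ∑ j ∈ Finset.range (j₁ + 1), 2 * (overlap A * supNorm ψ) * (2 : ℝ) ^ ((j : ℝ) / 2) := by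
          refine Finset.sum_le_sum fun j _ => ?_
          refine (sum_abs_dil_sub_le hψ.bounded_supNorm hA _ j x x').trans (le_of_eq ?_)
          push_cast; ring
      _ ≤ 2 * (overlap A * supNorm ψ) * (κ * (2 : ℝ) ^ ((j₁ : ℝ) / 2)) := by
          rw [← Finset.mul_sum]
          exact mul_le_mul_of_nonneg_left (sum_two_rpow_half_le j₁) (by positivity)
      _ = α / 2 * Sψ := by
          rw [hSψ]; field_simp; ring
  linarith

/-- The Laplace channel is `α`-differentially private. -/
theorem locallyPrivate_laplaceChannel (hφ : BoundedSupported A B φ)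
    (hψ : BoundedSupported A B ψ) (hA : 0 ≤ A)
    (hoφ : OrthonormalShifts φ) (hoψ : OrthonormalShifts ψ) {α : ℝ} (hα : 0 < α) (T : ℝ) (j₁ : ℕ) :
    LocallyPrivate α (laplaceChannel φ ψ A T j₁ α) := by
  intro x x' s hs
  have hmeas : ∀ (b : ℝ) (c : CoeffIndex A T j₁),
      Measurable fun w : ℝ => b + noiseScale φ ψ α c * w := fun b c => by fun_prop
  have hprob : ∀ (b : ℝ) (c : CoeffIndex A T j₁),
      IsProbabilityMeasure (laplaceLaw.map fun w : ℝ => b + noiseScale φ ψ α c * w) := fun b c =>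
    Measure.isProbabilityMeasure_map (hmeas b c).aemeasurable
  have hch : ∀ y, laplaceChannel φ ψ A T j₁ α y =
      Measure.pi fun c : CoeffIndex A T j₁ =>
        laplaceLaw.map fun w : ℝ => atom φ ψ c y + noiseScale φ ψ α c * w := by
    intro y
    have := fun c => hprob (atom φ ψ c y) c
    exact Measure.pi_map_pi fun c => (hmeas (atom φ ψ c y) c).aemeasurable
  have p1 := fun c => hprob (atom φ ψ c x) c
  have p2 := fun c => hprob (atom φ ψ c x') c
  have h := pi_le_prod_smul _ _ _ fun c : CoeffIndex A T j₁ =>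
    map_laplaceLaw_le (atom φ ψ c x) (atom φ ψ c x') (noiseScale_pos hφ hψ hA hoφ hoψ hα c)
  rw [← hch, ← hch, ← ENNReal.ofReal_prod_of_nonneg fun _ _ => (Real.exp_pos _).le,
    ← Real.exp_sum] at h
  refine (h s).trans ?_
  rw [Measure.smul_apply, smul_eq_mul]
  gcongr
  exact sum_abs_atom_sub_div_noiseScale_le hφ hψ hA hoφ hoψ hα T j₁ x x'

end Privacy

end PrivateWavelet

namespace PrivateWavelet

/-! ### Iterated primitives and integration by parts -/

section Primitives

/-- The primitive of `f` that vanishes at `-∞`. -/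
noncomputable def primitive (f : ℝ → ℝ) (x : ℝ) : ℝ := ∫ t in Iic x, f t

/-- The integral of `h` over `[t, ∞)`. -/
noncomputable def tailIntegral (h : ℝ → ℝ) (t : ℝ) : ℝ := ∫ x in Ici t, h x

/-- `f` vanishes on the left of `a` and is integrable on left half-lines. -/
def LeftSupported (a : ℝ) (f : ℝ → ℝ) : Prop :=
  (∀ x, IntegrableOn f (Iic x)) ∧ ∀ x, x < a → f x = 0

/-- `h` vanishes on the right of `R` and is integrable on right half-lines. -/
def RightSupported (R : ℝ) (h : ℝ → ℝ) : Prop :=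
  (∀ x, IntegrableOn h (Ici x)) ∧ ∀ x, R < x → h x = 0

/-- Fubini on the half-plane `t ≤ x`. This form of integration by parts has no boundary terms and
requires no differentiability. -/
theorem integral_primitive_mul_of_integrable {f h : ℝ → ℝ} (hf : Integrable f volume)
    (hh : Integrable h volume) :
    ∫ x, primitive f x * h x = ∫ t, f t * tailIntegral h t := by
  have hm : MeasurableSet {z : ℝ × ℝ | z.2 ≤ z.1} := measurableSet_le measurable_snd measurable_fst
  have hF : Integrable (fun z : ℝ × ℝ => {z : ℝ × ℝ | z.2 ≤ z.1}.indicator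
      (fun z => h z.1 * f z.2) z) (volume.prod volume) := (hh.mul_prod hf).indicator hm
  have h1 : ∀ x, primitive f x * h x =
      ∫ t, {z : ℝ × ℝ | z.2 ≤ z.1}.indicator (fun z => h z.1 * f z.2) (x, t) := by
    intro x
    rw [primitive, ← integral_indicator measurableSet_Iic, mul_comm, ← integral_const_mul]
    refine integral_congr_ae (Filter.Eventually.of_forall fun t => ?_)
    by_cases ht : t ≤ x <;> simp [indicator, ht]
  have h2 : ∀ t, f t * tailIntegral h t =
      ∫ x, {z : ℝ × ℝ | z.2 ≤ z.1}.indicator (fun z => h z.1 * f z.2) (x, t) := by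
    intro t
    rw [tailIntegral, ← integral_indicator measurableSet_Ici, ← integral_const_mul]
    refine integral_congr_ae (Filter.Eventually.of_forall fun x => ?_)
    by_cases ht : t ≤ x <;> simp [indicator, ht, mul_comm]
  simp only [h1, h2]
  exact integral_integral_swap hF

/-- Only the values of `f` and `h` on `[a, R]` matter: `primitive f` vanishes left of `a` and
`tailIntegral h` right of `R`. Cutting off both functions reduces to the integrable case; iterated
primitives need not be globally integrable. -/
theorem integral_primitive_mul {f h : ℝ → ℝ} {a R : ℝ} (hf : LeftSupported a f)
    (hh : RightSupported R h) :
    ∫ x, primitive f x * h x = ∫ t, f t * tailIntegral h t := by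
  have key := integral_primitive_mul_of_integrable
    ((integrable_indicator_iff measurableSet_Iic).2 (hf.1 R))
    ((integrable_indicator_iff measurableSet_Ici).2 (hh.1 a))
  have h1 : ∀ x, primitive ((Iic R).indicator f) x * (Ici a).indicator h x =
      primitive f x * h x := by
    intro x
    rcases lt_or_ge x a with hx | hx
    · have : primitive f x = 0 :=
        setIntegral_eq_zero_of_forall_eq_zero fun t ht => hf.2 t (lt_of_le_of_lt ht hx)
      rw [this, indicator_of_notMem (by simpa using hx)]
      simp
    rcases lt_or_ge R x with hR | hR
    · simp [indicator, hh.2 x hR]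
    · rw [indicator_of_mem (show x ∈ Ici a from hx)]
      congr 1
      refine setIntegral_congr_fun measurableSet_Iic fun t ht => ?_
      exact indicator_of_mem (show t ∈ Iic R from le_trans ht hR) _
  have h2 : ∀ t, (Iic R).indicator f t * tailIntegral ((Ici a).indicator h) t =
      f t * tailIntegral h t := by
    intro t
    rcases lt_or_ge R t with hR | hR
    · have : tailIntegral h t = 0 :=
        setIntegral_eq_zero_of_forall_eq_zero fun x hx => hh.2 x (lt_of_lt_of_le hR hx)
      rw [this, indicator_of_notMem (by simpa using hR)]
      simp
    rcases lt_or_ge t a with ht | ht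
    · simp [indicator, hf.2 t ht]
    · rw [indicator_of_mem (show t ∈ Iic R from hR)]
      congr 1
      refine setIntegral_congr_fun measurableSet_Ici fun x hx => ?_
      exact indicator_of_mem (show x ∈ Ici a from le_trans ht hx) _
  simpa only [h1, h2] using key

theorem LeftSupported.primitive_eq {f : ℝ → ℝ} {a : ℝ} (hf : LeftSupported a f) (x : ℝ) :
    primitive f x = ∫ t in a..x, f t := by
  rw [← intervalIntegral.integral_Iic_sub_Iic (hf.1 a) (hf.1 x), primitive]
  have : ∫ t in Iic a, f t = 0 := by
    rw [integral_Iic_eq_integral_Iio]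
    exact setIntegral_eq_zero_of_forall_eq_zero fun t ht => hf.2 t ht
  rw [this, sub_zero]

theorem LeftSupported.intervalIntegrable {f : ℝ → ℝ} {a : ℝ} (hf : LeftSupported a f) (x y : ℝ) :
    IntervalIntegrable f volume x y :=
  ((hf.1 (max x y)).mono_set (fun _ ht => ht.2)).intervalIntegrable

theorem LeftSupported.continuous_primitive {f : ℝ → ℝ} {a : ℝ} (hf : LeftSupported a f) :
    Continuous (primitive f) := by
  rw [funext hf.primitive_eq]
  exact intervalIntegral.continuous_primitive hf.intervalIntegrable a

theorem leftSupported_of_continuous {f : ℝ → ℝ} {a : ℝ} (hc : Continuous f)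
    (h : ∀ x, x < a → f x = 0) : LeftSupported a f := by
  refine ⟨fun x => ?_, h⟩
  have h1 : IntegrableOn f (Icc a x) := hc.integrableOn_Icc
  have h2 : IntegrableOn f (Iio a) :=
    integrableOn_zero.congr_fun (fun t ht => (h t ht).symm) measurableSet_Iio
  refine (h2.union h1).mono_set fun t ht => ?_
  rcases lt_or_ge t a with h3 | h3
  · exact Or.inl h3
  · exact Or.inr ⟨h3, ht⟩

theorem LeftSupported.primitive {f : ℝ → ℝ} {a : ℝ} (hf : LeftSupported a f) :
    LeftSupported a (primitive f) :=
  leftSupported_of_continuous hf.continuous_primitive fun _ hx =>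
    setIntegral_eq_zero_of_forall_eq_zero fun t ht => hf.2 t (lt_of_le_of_lt ht hx)

theorem LeftSupported.iterate_primitive {f : ℝ → ℝ} {a : ℝ} (hf : LeftSupported a f) (m : ℕ) :
    LeftSupported a (PrivateWavelet.primitive^[m] f) := by
  induction m with
  | zero => exact hf
  | succ m ih => rw [Function.iterate_succ_apply']; exact ih.primitive

theorem RightSupported.tailIntegral_eq {h : ℝ → ℝ} {R : ℝ} (hh : RightSupported R h) (t : ℝ) :
    tailIntegral h t = ∫ x in t..R, h x := by
  have h1 : ∀ y, IntegrableOn h (Ioi y) := fun y => (hh.1 y).mono_set Ioi_subset_Ici_self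
  rw [← intervalIntegral.integral_Ioi_sub_Ioi' (h1 t) (h1 R), PrivateWavelet.tailIntegral,
    integral_Ici_eq_integral_Ioi]
  have : ∫ x in Ioi R, h x = 0 :=
    setIntegral_eq_zero_of_forall_eq_zero fun t ht => hh.2 t ht
  rw [this, sub_zero]

theorem RightSupported.intervalIntegrable {h : ℝ → ℝ} {R : ℝ} (hh : RightSupported R h) (x y : ℝ) :
    IntervalIntegrable h volume x y :=
  ((hh.1 (min x y)).mono_set (fun _ ht => ht.1)).intervalIntegrable

theorem RightSupported.tailIntegral_eq_neg {h : ℝ → ℝ} {R : ℝ} (hh : RightSupported R h) :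
    tailIntegral h = fun t => -∫ x in R..t, h x := by
  funext t
  rw [hh.tailIntegral_eq, intervalIntegral.integral_symm]

theorem RightSupported.continuous_tailIntegral {h : ℝ → ℝ} {R : ℝ} (hh : RightSupported R h) :
    Continuous (tailIntegral h) := by
  rw [hh.tailIntegral_eq_neg]
  exact (intervalIntegral.continuous_primitive hh.intervalIntegrable R).neg

theorem RightSupported.hasDerivAt_tailIntegral {h : ℝ → ℝ} {R : ℝ} (hh : RightSupported R h)
    (hc : Continuous h) (x : ℝ) : HasDerivAt (tailIntegral h) (-h x) x := by
  rw [hh.tailIntegral_eq_neg]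
  exact (intervalIntegral.integral_hasDerivAt_right (hh.intervalIntegrable R x)
    (hc.stronglyMeasurableAtFilter _ _) hc.continuousAt).neg

theorem rightSupported_of_continuous {h : ℝ → ℝ} {R : ℝ} (hc : Continuous h)
    (h0 : ∀ x, R < x → h x = 0) : RightSupported R h := by
  refine ⟨fun x => ?_, h0⟩
  have h1 : IntegrableOn h (Icc x R) := hc.integrableOn_Icc
  have h2 : IntegrableOn h (Ioi R) :=
    integrableOn_zero.congr_fun (fun t ht => (h0 t ht).symm) measurableSet_Ioi
  refine (h2.union h1).mono_set fun t ht => ?_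
  rcases lt_or_ge R t with h3 | h3
  · exact Or.inl h3
  · exact Or.inr ⟨ht, h3⟩

theorem RightSupported.tailIntegral {h : ℝ → ℝ} {R : ℝ} (hh : RightSupported R h) :
    RightSupported R (tailIntegral h) :=
  rightSupported_of_continuous hh.continuous_tailIntegral fun _ hx =>
    setIntegral_eq_zero_of_forall_eq_zero fun t ht => hh.2 t (lt_of_lt_of_le hx ht)

theorem RightSupported.iterate_tailIntegral {h : ℝ → ℝ} {R : ℝ} (hh : RightSupported R h) (m : ℕ) :
    RightSupported R (PrivateWavelet.tailIntegral^[m] h) := by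
  induction m with
  | zero => exact hh
  | succ m ih => rw [Function.iterate_succ_apply']; exact ih.tailIntegral

theorem integral_iterate_primitive_mul {f h : ℝ → ℝ} {a R : ℝ} (hf : LeftSupported a f)
    (hh : RightSupported R h) (m : ℕ) :
    ∫ x, (primitive^[m] f) x * h x = ∫ x, f x * (tailIntegral^[m] h) x := by
  induction m generalizing h with
  | zero => rfl
  | succ m ih =>
    rw [Function.iterate_succ_apply', integral_primitive_mul (hf.iterate_primitive m) hh,
      ih hh.tailIntegral, Function.iterate_succ_apply]

theorem contDiff_tailIntegral {h : ℝ → ℝ} {R : ℝ} (hh : RightSupported R h)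
    (hc : ContDiff ℝ (⊤ : ℕ∞) h) : ContDiff ℝ (⊤ : ℕ∞) (tailIntegral h) := by
  rw [contDiff_infty_iff_deriv]
  have := hh.hasDerivAt_tailIntegral hc.continuous
  refine ⟨fun x => (this x).differentiableAt, ?_⟩
  rw [funext fun x => (this x).deriv]
  exact hc.neg

theorem contDiff_iterate_tailIntegral {h : ℝ → ℝ} {R : ℝ} (hh : RightSupported R h)
    (hc : ContDiff ℝ (⊤ : ℕ∞) h) (m : ℕ) :
    ContDiff ℝ (⊤ : ℕ∞) (tailIntegral^[m] h) := by
  induction m with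
  | zero => exact hc
  | succ m ih =>
    rw [Function.iterate_succ_apply']; exact contDiff_tailIntegral (hh.iterate_tailIntegral m) ih

theorem iteratedDeriv_iterate_tailIntegral {h : ℝ → ℝ} {R : ℝ} (hh : RightSupported R h)
    (hc : ContDiff ℝ (⊤ : ℕ∞) h) (m : ℕ) :
    iteratedDeriv m (tailIntegral^[m] h) = fun x => (-1) ^ m * h x := by
  induction m with
  | zero => simp
  | succ m ih =>
    have h1 : deriv (tailIntegral (tailIntegral^[m] h)) = fun x => -(tailIntegral^[m] h) x :=
      funext fun x => ((hh.iterate_tailIntegral m).hasDerivAt_tailIntegral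
        (contDiff_iterate_tailIntegral hh hc m).continuous x).deriv
    rw [Function.iterate_succ_apply', iteratedDeriv_succ', h1]
    funext x
    rw [iteratedDeriv_fun_neg, ih]
    ring

end Primitives

end PrivateWavelet

namespace PrivateWavelet

/-! ### Vanishing moments of the mother wavelet -/

section Moments

theorem iteratedDeriv_eq_zero_of_notMem_tsupport {h : ℝ → ℝ} {x : ℝ} (hx : x ∉ tsupport h) (m : ℕ) :
    iteratedDeriv m h x = 0 := by
  have h1 : h =ᶠ[nhds x] fun _ => (0 : ℝ) := notMem_tsupport_iff_eventuallyEq.1 hx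
  rw [h1.iteratedDeriv_eq]
  simp

/-- Test functions supported off `[-A, A]` have all derivatives supported there, so they are paired
with the zero part of `f`. -/
theorem IsWeakDeriv.ae_eq_zero {A : ℝ} {m : ℕ} {f g : ℝ → ℝ} (hg : IsWeakDeriv m f g)
    (hf : Function.support f ⊆ Icc (-A) A) : ∀ᵐ x, x ∈ (Icc (-A) A)ᶜ → g x = 0 := by
  refine isClosed_Icc.isOpen_compl.ae_eq_zero_of_integral_contDiff_smul_eq_zero
    (hg.2.1.locallyIntegrableOn _) fun h hh hs hU => ?_
  have h1 := hg.2.2 h hh hs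
  have h2 : ∀ x, f x * iteratedDeriv m h x = 0 := by
    intro x
    by_contra hne
    have h3 : x ∈ Icc (-A) A := hf (left_ne_zero_of_mul hne)
    exact right_ne_zero_of_mul hne
      (iteratedDeriv_eq_zero_of_notMem_tsupport (fun h4 => hU h4 h3) m)
  simp only [h2, integral_zero] at h1
  have h4 : ∫ x, g x * h x = 0 := by
    rcases mul_eq_zero.1 h1.symm with h5 | h5
    · exact absurd h5 (by simp)
    · exact h5
  simpa [mul_comm] using h4

/-- A compactly supported function with a weak derivative of order `m` is, up to a null set, the
`m`-fold primitive of a compactly supported integrable function. -/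
theorem IsWeakDeriv.exists_iterate_primitive {A : ℝ} {m : ℕ} {f g : ℝ → ℝ} (hg : IsWeakDeriv m f g)
    (hf : Function.support f ⊆ Icc (-A) A) (hA : 0 ≤ A) :
    ∃ g₀ : ℝ → ℝ, LeftSupported (-A) g₀ ∧ f =ᵐ[volume] primitive^[m] g₀ := by
  set g₀ := (Icc (-A) A).indicator g with hg₀
  have hgi : Integrable g₀ volume := by
    rw [hg₀, integrable_indicator_iff measurableSet_Icc]
    exact hg.2.1.integrableOn_isCompact isCompact_Icc
  have hgg : g =ᵐ[volume] g₀ := by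
    filter_upwards [hg.ae_eq_zero hf] with x hx
    by_cases h : x ∈ Icc (-A) A
    · rw [hg₀, indicator_of_mem h]
    · rw [hg₀, indicator_of_notMem h, hx h]
  have hl : LeftSupported (-A) g₀ :=
    ⟨fun x => hgi.integrableOn, fun x hx => indicator_of_notMem (fun h => by linarith [h.1]) _⟩
  refine ⟨g₀, hl, ?_⟩
  have hloc : LocallyIntegrable (primitive^[m] g₀) volume := by
    rw [locallyIntegrable_iff]
    intro K hK
    obtain ⟨R, hR⟩ := hK.bddAbove
    exact ((hl.iterate_primitive m).1 R).mono_set fun x hx => hR hx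
  refine ae_eq_of_integral_contDiff_smul_eq hg.1 hloc fun ζ hζ hs => ?_
  obtain ⟨R, hR⟩ := hs.isCompact.bddAbove
  have hr : RightSupported R ζ := rightSupported_of_continuous hζ.continuous fun x hx => by
    by_contra hne
    exact absurd (hR (subset_tsupport _ hne)) (not_le.2 hx)
  simp only [smul_eq_mul, mul_comm (ζ _)]
  rw [integral_iterate_primitive_mul hl hr]
  -- The iterated tail integral of the test function `ζ` recovers `ζ` up to sign after `m`
  -- derivatives, but need not vanish far to the left. The cutoff equals one on a neighbourhood of
  -- `[-A, A]`, so it changes neither the derivatives where `f` lives nor the pairing with `g₀`.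
  let χ : ContDiffBump (0 : ℝ) := ⟨A + 1, A + 2, by linarith, by linarith⟩
  have hH := contDiff_iterate_tailIntegral hr hζ m
  have h1 := hg.2.2 (fun x => χ x * (tailIntegral^[m] ζ) x) (χ.contDiff.mul hH)
    (χ.hasCompactSupport.mul_right)
  have h2 : ∀ x, f x * iteratedDeriv m (fun x => χ x * (tailIntegral^[m] ζ) x) x =
      (-1) ^ m * (f x * ζ x) := by
    intro x
    by_cases hx : f x = 0
    · simp [hx]
    have h3 : x ∈ Icc (-A) A := hf hx
    have h4 : (fun x => χ x * (tailIntegral^[m] ζ) x) =ᶠ[nhds x] tailIntegral^[m] ζ := by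
      have : Metric.ball (0 : ℝ) (A + 1) ∈ nhds x := Metric.isOpen_ball.mem_nhds (by
        rw [mem_ball_zero_iff, Real.norm_eq_abs]
        exact lt_of_le_of_lt (abs_le.2 h3) (by linarith))
      filter_upwards [this] with y hy
      rw [χ.one_of_mem_closedBall (Metric.ball_subset_closedBall hy), one_mul]
    rw [h4.iteratedDeriv_eq, iteratedDeriv_iterate_tailIntegral hr hζ]
    ring
  have h5 : ∫ x, g x * (χ x * (tailIntegral^[m] ζ) x) = ∫ x, g₀ x * (tailIntegral^[m] ζ) x := by
    refine integral_congr_ae ?_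
    filter_upwards [hgg] with x hx
    rw [hx]
    by_cases h : x ∈ Icc (-A) A
    · rw [χ.one_of_mem_closedBall, one_mul]
      rw [mem_closedBall_zero_iff, Real.norm_eq_abs]
      exact (abs_le.2 h).trans (by simp [χ])
    · simp [hg₀, indicator_of_notMem h]
  simp only [h2, integral_const_mul, h5] at h1
  exact mul_left_cancel₀ (pow_ne_zero _ (by norm_num)) h1

variable {A B : ℝ} {g h : ℝ → ℝ}

theorem BoundedSupported.rightSupported (hh : BoundedSupported A B h) : RightSupported A h :=
  ⟨fun _ => hh.integrable.integrableOn, fun _ hx => hh.eq_zero (lt_of_lt_of_le hx (le_abs_self _))⟩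

theorem BoundedSupported.integral_abs_le (hh : BoundedSupported A B h) (hA : 0 ≤ A) :
    ∫ x, |h x| ≤ 2 * A * B := by
  have h1 : ∫ x, |h x| = ∫ x in Icc (-A) A, |h x| := by
    rw [setIntegral_eq_integral_of_forall_compl_eq_zero]
    intro x hx
    by_contra hne
    exact hx (hh.support (by simpa using hne))
  rw [h1]
  calc ∫ x in Icc (-A) A, |h x| ≤ ∫ x in Icc (-A) A, B :=
        setIntegral_mono hh.integrable.abs.integrableOn (by simp) hh.bound
    _ = 2 * A * B := by
        rw [setIntegral_const, Real.volume_real_Icc_of_le (by linarith), smul_eq_mul]; ring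

/-- To the left of the support the tail integral is the full integral, so vanishing mean is exactly
what keeps the support compact. -/
theorem BoundedSupported.tailIntegral (hh : BoundedSupported A B h) (hA : 0 ≤ A)
    (h0 : ∫ x, h x = 0) : BoundedSupported A (2 * A * B) (tailIntegral h) := by
  refine ⟨hh.rightSupported.continuous_tailIntegral.measurable, fun t => ?_, fun t ht => ?_⟩
  · refine le_trans ?_ (hh.integral_abs_le hA)
    refine (abs_integral_le_integral_abs).trans ?_
    exact setIntegral_le_integral hh.integrable.abs (Filter.Eventually.of_forall fun _ => abs_nonneg _)
  · by_contra hne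
    rw [mem_Icc, not_and_or, not_le, not_le] at hne
    refine ht ?_
    rcases hne with h1 | h1
    · rw [← h0]
      refine setIntegral_eq_integral_of_forall_compl_eq_zero fun x hx => ?_
      have h2 : x < t := by simpa using hx
      exact hh.eq_zero (lt_abs.2 (Or.inr (by linarith)))
    · exact hh.rightSupported.tailIntegral.2 t h1

theorem tailIntegral_const_mul (c : ℝ) (h : ℝ → ℝ) :
    tailIntegral (fun x => c * h x) = fun t => c * tailIntegral h t :=
  funext fun _ => integral_const_mul _ _

theorem tailIntegral_dil (h : ℝ → ℝ) (j k : ℤ) :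
    tailIntegral (dil h j k) = fun t => ((2 : ℝ) ^ j)⁻¹ * dil (tailIntegral h) j k t := by
  funext t
  have h0 : (0 : ℝ) < 2 ^ j := by positivity
  have h1 : ∀ x, (Ici t).indicator (dil h j k) x = (2 : ℝ) ^ ((j : ℝ) / 2) *
      (Ici ((2 : ℝ) ^ j * t - k)).indicator h ((2 : ℝ) ^ j * x - k) := by
    intro x
    have h2 : x ∈ Ici t ↔ (2 : ℝ) ^ j * x - k ∈ Ici ((2 : ℝ) ^ j * t - k) := by
      rw [mem_Ici, mem_Ici, sub_le_sub_iff_right, mul_le_mul_iff_right₀ h0]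
    by_cases hx : x ∈ Ici t
    · rw [indicator_of_mem hx, indicator_of_mem (h2.1 hx), dil]
    · rw [indicator_of_notMem hx, indicator_of_notMem (fun h => hx (h2.2 h)), mul_zero]
  rw [tailIntegral, ← integral_indicator measurableSet_Ici]
  simp only [h1]
  rw [integral_const_mul, integral_comp_affine _ h0, integral_indicator measurableSet_Ici, dil,
    tailIntegral]
  ring

theorem iterate_tailIntegral_dil (h : ℝ → ℝ) (j k : ℤ) (m : ℕ) :
    tailIntegral^[m] (dil h j k) =
      fun t => (((2 : ℝ) ^ j)⁻¹) ^ m * dil (tailIntegral^[m] h) j k t := by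
  induction m with
  | zero => simp
  | succ m ih =>
    rw [Function.iterate_succ_apply', ih, tailIntegral_const_mul, tailIntegral_dil,
      Function.iterate_succ_apply']
    funext t
    ring

/-- Each integration moved from `f` to the wavelet gains a factor `2^{-j}`. This drives both the
vanishing of moments and the decay of coefficients. -/
theorem coeff_iterate_primitive {a : ℝ} {f : ℝ → ℝ} (hf : LeftSupported a f)
    (hh : BoundedSupported A B h) (m : ℕ) (j k : ℤ) :
    coeff h (primitive^[m] f) j k =
      (((2 : ℝ) ^ j)⁻¹) ^ m * coeff (tailIntegral^[m] h) f j k := by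
  rw [coeff, integral_iterate_primitive_mul hf (hh.dil j k).rightSupported, coeff,
    iterate_tailIntegral_dil, ← integral_const_mul]
  congr 1
  funext x
  ring

theorem eq_zero_of_forall_dyadic {f : ℝ → ℝ} (hf : Continuous f)
    (h : ∀ (i : ℕ) (k : ℤ), f (k / 2 ^ i) = 0) : f = 0 := by
  funext x
  have h1 : Filter.Tendsto (fun i : ℕ => (⌊x * 2 ^ i⌋ : ℝ) / 2 ^ i) Filter.atTop (nhds x) := by
    have h2 : Filter.Tendsto (fun i : ℕ => x - (1 / 2 : ℝ) ^ i) Filter.atTop (nhds (x - 0)) :=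
      tendsto_const_nhds.sub (tendsto_pow_atTop_nhds_zero_of_lt_one (by norm_num) (by norm_num))
    rw [sub_zero] at h2
    refine tendsto_of_tendsto_of_tendsto_of_le_of_le h2 tendsto_const_nhds (fun i => ?_) fun i => ?_
    · have h3 : (0 : ℝ) < 2 ^ i := by positivity
      simp only
      rw [le_div_iff₀ h3, sub_mul, ← mul_pow]
      norm_num
      linarith [(Int.lt_floor_add_one (x * 2 ^ i)).le]
    · have h3 : (0 : ℝ) < 2 ^ i := by positivity
      simp only
      rw [div_le_iff₀ h3]
      exact Int.floor_le _
  exact tendsto_nhds_unique ((hf.tendsto x).comp h1) (by simp [Function.comp_def, h])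

/-- Fix a dyadic point `x₀ = k / 2^i`. For `j ≥ i` the translate `k 2^{j-i}` centres the dilated `h`
at `x₀`, and as `j → ∞` the vanishing normalised coefficients converge to `f x₀ ∫ h`. If the mean is
nonzero, `f` vanishes at all dyadic points and hence everywhere. -/
theorem integral_eq_zero_or_eq_zero_of_coeff {f : ℝ → ℝ} (hf : Continuous f)
    (hh : BoundedSupported A B h) (h0 : ∀ (j : ℕ) (k : ℤ), coeff h f j k = 0) :
    ∫ x, h x = 0 ∨ f = 0 := by
  by_cases hi : ∫ x, h x = 0
  · exact Or.inl hi
  refine Or.inr (eq_zero_of_forall_dyadic hf fun i k => ?_)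
  set x₀ : ℝ := k / 2 ^ i with hx₀
  have h1 : ∀ j : ℕ, i ≤ j → ∫ y, f (x₀ + y / 2 ^ j) * h y = 0 := by
    intro j hij
    have h2 := h0 j (k * 2 ^ (j - i))
    have hp : (0 : ℝ) < 2 ^ j := by positivity
    have h3 : ∀ x, f x * dil h j (k * 2 ^ (j - i)) x = (2 : ℝ) ^ ((j : ℝ) / 2) *
        (fun y => f (x₀ + y / 2 ^ j) * h y) (2 ^ j * x - (k * 2 ^ (j - i) : ℤ)) := by
      intro x
      have h4 : x₀ + ((2 : ℝ) ^ j * x - (k * 2 ^ (j - i) : ℤ)) / 2 ^ j = x := by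
        obtain ⟨d, rfl⟩ := Nat.exists_eq_add_of_le hij
        rw [hx₀, Nat.add_sub_cancel_left]
        push_cast
        rw [pow_add]
        field_simp
        ring
      simp only [h4, dil, zpow_natCast, Int.cast_natCast]
      ring
    rw [coeff] at h2
    simp only [h3] at h2
    rw [integral_const_mul, integral_comp_affine (fun y => f (x₀ + y / 2 ^ j) * h y) hp] at h2
    rcases mul_eq_zero.1 h2 with h5 | h5
    · exact absurd h5 (by positivity)
    · exact (mul_eq_zero.1 h5).resolve_left (by positivity)
  obtain ⟨M, hM⟩ := (isCompact_Icc (a := x₀ - |A|) (b := x₀ + |A|)).exists_bound_of_continuousOn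
    hf.continuousOn
  have h2 : Filter.Tendsto (fun j : ℕ => ∫ y, f (x₀ + y / 2 ^ j) * h y) Filter.atTop
      (nhds (∫ y, f x₀ * h y)) := by
    refine tendsto_integral_of_dominated_convergence (fun y => M * |h y|)
      (fun j => ((hf.comp (by fun_prop)).measurable.mul hh.measurable).aestronglyMeasurable)
      (hh.integrable.abs.const_mul M)
      (fun j => Filter.Eventually.of_forall fun y => ?_)
      (Filter.Eventually.of_forall fun y => ?_)
    · rw [norm_mul, Real.norm_eq_abs (h y)]
      by_cases hy : h y = 0
      · simp [hy]
      refine mul_le_mul_of_nonneg_right (hM _ ?_) (abs_nonneg _)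
      have h3 := hh.abs_le_of_ne hy
      have h4 : |y / 2 ^ j| ≤ |A| := by
        rw [abs_div, abs_of_pos (by positivity : (0 : ℝ) < 2 ^ j)]
        refine (div_le_self (abs_nonneg _) (one_le_pow₀ (by norm_num))).trans
          (h3.trans (le_abs_self _))
      have h5 := abs_le.1 h4
      constructor <;> linarith
    · refine Filter.Tendsto.mul_const _ ((hf.tendsto x₀).comp ?_)
      have h6 : Filter.Tendsto (fun j : ℕ => x₀ + y * (1 / 2 : ℝ) ^ j) Filter.atTop
          (nhds (x₀ + y * 0)) :=
        tendsto_const_nhds.add ((tendsto_pow_atTop_nhds_zero_of_lt_one (by norm_num)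
          (by norm_num)).const_mul y)
      simpa [div_eq_mul_inv] using h6
  have h3 : ∫ y, f x₀ * h y = 0 :=
    tendsto_nhds_unique h2 (tendsto_const_nhds.congr' (by
      filter_upwards [Filter.eventually_ge_atTop i] with j hj
      rw [h1 j hj]))
  rw [integral_const_mul] at h3
  exact (mul_eq_zero.1 h3).resolve_right hi

variable {φ ψ : ℝ → ℝ}

theorem shiftSpan_mono (hm : GeneratesMRA φ) {i j : ℕ} (hij : i ≤ j) :
    shiftSpan φ i ≤ shiftSpan φ j := by
  induction j, hij using Nat.le_induction with
  | base => exact le_rfl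
  | succ j _ ih => exact ih.trans (by simpa using hm.nested j)

theorem integral_father_mul_mother (hφ : BoundedSupported A B φ) (hψ : BoundedSupported A B ψ)
    (hw : IsMotherWavelet φ ψ) (j l k : ℤ) : ∫ x, dil φ j l x * dil ψ j k x = 0 := by
  have h1 : ((hψ.dil 0 k).memLp 2).toLp _ ∈ (shiftSpan φ 0)ᗮ := by
    have := toLp_dil_mem_shiftSpan hψ 0 k
    rw [hw.span_eq] at this
    exact this.1
  have h2 := (Submodule.mem_orthogonal _ _).1 h1 _ (toLp_dil_mem_shiftSpan hφ 0 l)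
  rw [inner_toLp, integral_dil_mul_dil] at h2
  rw [integral_dil_mul_dil, h2]

theorem toLp_mother_mem_orthogonal (hφ : BoundedSupported A B φ) (hψ : BoundedSupported A B ψ)
    (hw : IsMotherWavelet φ ψ) (j k : ℤ) :
    ((hψ.dil j k).memLp 2).toLp _ ∈ (shiftSpan φ j)ᗮ :=
  mem_orthogonal_shiftSpan hφ j _ fun l => by
    rw [inner_toLp, integral_father_mul_mother hφ hψ hw]

theorem integral_father_mul_mother_of_le (hφ : BoundedSupported A B φ)
    (hψ : BoundedSupported A B ψ) (hm : GeneratesMRA φ) (hw : IsMotherWavelet φ ψ) {i j : ℕ}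
    (hij : i ≤ j) (l k : ℤ) : ∫ x, dil φ i l x * dil ψ j k x = 0 := by
  have h2 := (Submodule.mem_orthogonal _ _).1 (toLp_mother_mem_orthogonal hφ hψ hw j k) _
    (shiftSpan_mono hm hij (toLp_dil_mem_shiftSpan hφ i l))
  rwa [inner_toLp] at h2

/-- Induction on the number of primitives moved from `φ` onto `ψ`. The coefficients of `φ` against
all `ψ_{jk}` with `j ≥ 0` vanish, so those of the remaining primitive against the current tail
integral vanish too. The dyadic argument forces the latter to have mean zero, and one more tail
integral is compactly supported. -/
theorem exists_boundedSupported_iterate_tailIntegral_of_ae_eq (hφ : BoundedSupported A B φ) (hψ : BoundedSupported A B ψ) (hA : 0 ≤ A)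
    (hm : GeneratesMRA φ) (hw : IsMotherWavelet φ ψ) {g₀ : ℝ → ℝ} {a : ℝ}
    (hg : LeftSupported a g₀) {n : ℕ} (hφg : φ =ᵐ[volume] primitive^[n] g₀) :
    ∀ m ≤ n, ∃ B' : ℝ, BoundedSupported A B' (tailIntegral^[m] ψ) := by
  have hc : ∀ (j : ℕ) (k : ℤ), coeff ψ (primitive^[n] g₀) j k = 0 := by
    intro j k
    have h1 := integral_father_mul_mother_of_le hφ hψ hm hw (Nat.zero_le j) 0 k
    rw [coeff, ← h1]
    refine integral_congr_ae ?_
    filter_upwards [hφg] with x hx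
    rw [← hx, Nat.cast_zero, dil_zero_left, Int.cast_zero, sub_zero]
  intro m hmn
  induction m with
  | zero => exact ⟨B, hψ⟩
  | succ m ih =>
    obtain ⟨B', hB'⟩ := ih (by omega)
    obtain ⟨d, rfl⟩ := Nat.exists_eq_add_of_le hmn
    -- Only `m` primitives are moved. At least one remains, which supplies the continuity used by
    -- the dyadic argument.
    have e : m + 1 + d = m + (d + 1) := by omega
    have h1 : ∀ (j : ℕ) (k : ℤ),
        coeff (tailIntegral^[m] ψ) (primitive^[d + 1] g₀) j k = 0 := by
      intro j k
      have h2 := hc j k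
      rw [e, Function.iterate_add_apply, coeff_iterate_primitive (hg.iterate_primitive _) hψ] at h2
      exact (mul_eq_zero.1 h2).resolve_left (by positivity)
    have hcont : Continuous (primitive^[d + 1] g₀) := by
      rw [Function.iterate_succ_apply']
      exact (hg.iterate_primitive d).continuous_primitive
    rcases integral_eq_zero_or_eq_zero_of_coeff hcont hB' h1 with h2 | h2
    · rw [Function.iterate_succ_apply']
      exact ⟨_, hB'.tailIntegral hA h2⟩
    -- A vanishing primitive would give `φ = 0` almost everywhere, against its unit norm.
    · exfalso
      have h3 : ∀ i, primitive^[i] (0 : ℝ → ℝ) = 0 := by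
        intro i
        induction i with
        | zero => rfl
        | succ i ih =>
          rw [Function.iterate_succ_apply', ih]
          funext x
          simp [primitive]
      rw [e, Function.iterate_add_apply, h2, h3] at hφg
      have h4 := hm.orthonormal.2 0 0
      rw [integral_congr_ae (g := fun _ => (0 : ℝ))
        (by filter_upwards [hφg] with x hx; simp [hx])] at h4
      simp at h4

/-- The iterated tail integrals of the mother wavelet up to the order `N + 1` of regularity are
bounded and compactly supported. -/
theorem exists_boundedSupported_iterate_tailIntegral {N : ℕ} (hφ : BoundedSupported A B φ)
    (hψ : BoundedSupported A B ψ) (hA : 0 ≤ A) (hf : RegularFather N φ)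
    (hw : IsMotherWavelet φ ψ) :
    ∃ B' : ℝ, BoundedSupported A B' (tailIntegral^[N + 1] ψ) ∧ ∫ x, ψ x = 0 := by
  obtain ⟨g, hg, -⟩ := hf.weakDeriv
  obtain ⟨g₀, hl, he⟩ := hg.exists_iterate_primitive hφ.support hA
  have key := exists_boundedSupported_iterate_tailIntegral_of_ae_eq hφ hψ hA hf.mra hw hl he
  obtain ⟨B', hB'⟩ := key (N + 1) le_rfl
  refine ⟨B', hB', ?_⟩
  obtain ⟨B₁, hB₁⟩ := key 1 (by omega)
  by_contra hne
  have h1 : tailIntegral^[1] ψ (-A - 1) = ∫ x, ψ x := by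
    rw [Function.iterate_one]
    refine setIntegral_eq_integral_of_forall_compl_eq_zero fun x hx => ?_
    have h2 : x < -A - 1 := not_le.1 hx
    exact hψ.eq_zero (lt_abs.2 (Or.inr (by linarith)))
  have h3 : tailIntegral^[1] ψ (-A - 1) = 0 :=
    hB₁.eq_zero (lt_abs.2 (Or.inr (by linarith)))
  exact hne (h1.symm.trans h3)

end Moments

end PrivateWavelet

namespace PrivateWavelet

/-! ### Orthogonality of the wavelets and smooth bumps in the Besov class -/

section Bump

variable {A B : ℝ} {φ ψ : ℝ → ℝ}

theorem coeff_mother_mother_same (hw : IsMotherWavelet φ ψ) (j l k : ℤ) :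
    coeff ψ (dil ψ j l) j k = if l = k then 1 else 0 := by
  rw [coeff, hw.orthonormal.integral_dil]

/-- The two-scale identity applied to the wavelet itself: its part in `V_i` is zero and its mother
part at level `i` is the wavelet. The resulting finite father expansion at level `i + 1` yields
orthogonality to all finer mother levels. -/
theorem dil_mother_ae_eq (hφ : BoundedSupported A B φ) (hψ : BoundedSupported A B ψ)
    (hm : GeneratesMRA φ) (hw : IsMotherWavelet φ ψ) (i : ℕ) (l : ℤ) :
    ∃ s : Finset ℤ, dil ψ i l =ᵐ[volume]
      fun x => ∑ k ∈ s, coeff φ (dil ψ i l) (i + 1 : ℕ) k * dil φ (i + 1 : ℕ) k x := by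
  have hd := hψ.dil i l
  refine ⟨translates A (((2 : ℝ) ^ (i : ℤ))⁻¹ * (A + |(l : ℝ)|)) (i + 1), ?_⟩
  have h1 := levelPart_succ hφ hψ hm hw hd.measurable hd.integrable hd.support i
  filter_upwards [h1] with x hx
  have h2 : ∀ k, coeff φ (dil ψ i l) i k = 0 := by
    intro k
    rw [coeff, ← integral_father_mul_mother hφ hψ hw i k l]
    simp only [mul_comm]
  have h3 : l ∈ translates A (((2 : ℝ) ^ (i : ℤ))⁻¹ * (A + |(l : ℝ)|)) i := by
    by_contra hne
    have h4 := coeff_eq_zero hψ hd.support i hne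
    rw [coeff_mother_mother_same hw] at h4
    simp at h4
  unfold levelPart at hx
  rw [hx]
  simp only [h2, coeff_mother_mother_same hw, zero_mul, Finset.sum_const_zero, zero_add, ite_mul,
    one_mul, Finset.sum_ite_eq, if_pos h3]

theorem coeff_mother_mother_of_lt (hφ : BoundedSupported A B φ) (hψ : BoundedSupported A B ψ)
    (hm : GeneratesMRA φ) (hw : IsMotherWavelet φ ψ) {i j : ℕ} (hij : i < j) (l k : ℤ) :
    coeff ψ (dil ψ i l) j k = 0 := by
  obtain ⟨s, hs⟩ := dil_mother_ae_eq hφ hψ hm hw i l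
  rw [coeff, integral_congr_ae (g := fun x => ∑ k' ∈ s,
    coeff φ (dil ψ i l) (i + 1 : ℕ) k' * (dil φ (i + 1 : ℕ) k' x * dil ψ j k x))
    (by filter_upwards [hs] with x hx; rw [hx, Finset.sum_mul]; simp only [mul_assoc]),
    integral_finsetSum]
  · refine Finset.sum_eq_zero fun k' _ => ?_
    rw [integral_const_mul, integral_father_mul_mother_of_le hφ hψ hm hw hij, mul_zero]
  · exact fun k' _ => ((hψ.dil j k).integrable_mul (hφ.dil _ k').integrable).const_mul _

theorem coeff_mother_mother (hφ : BoundedSupported A B φ) (hψ : BoundedSupported A B ψ)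
    (hm : GeneratesMRA φ) (hw : IsMotherWavelet φ ψ) (i j : ℕ) (l k : ℤ) :
    coeff ψ (dil ψ i l) j k = if i = j ∧ l = k then 1 else 0 := by
  rcases lt_trichotomy i j with h | rfl | h
  · rw [coeff_mother_mother_of_lt hφ hψ hm hw h, if_neg (fun h' => h.ne h'.1)]
  · simp [coeff_mother_mother_same hw]
  · rw [if_neg (fun h' => h.ne' h'.1), ← coeff_mother_mother_of_lt hφ hψ hm hw h k l]
    unfold coeff
    simp only [mul_comm]

theorem coeff_father_mother (hφ : BoundedSupported A B φ) (hψ : BoundedSupported A B ψ)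
    (hm : GeneratesMRA φ) (hw : IsMotherWavelet φ ψ) (j : ℕ) (l k : ℤ) :
    coeff φ (dil ψ j l) 0 k = 0 := by
  have := integral_father_mul_mother_of_le hφ hψ hm hw (Nat.zero_le j) k l
  rw [coeff, ← this]
  simp only [mul_comm, Nat.cast_zero]

theorem iterate_primitive_iteratedDeriv {h : ℝ → ℝ} {a : ℝ} (hh : ContDiff ℝ (⊤ : ℕ∞) h)
    (h0 : ∀ x, x < a → h x = 0) (m : ℕ) :
    LeftSupported a (iteratedDeriv m h) ∧ primitive^[m] (iteratedDeriv m h) = h := by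
  have hz : ∀ m x, x < a → iteratedDeriv m h x = 0 := by
    intro m x hx
    have : h =ᶠ[nhds x] fun _ => (0 : ℝ) := by
      filter_upwards [isOpen_Iio.mem_nhds (show x ∈ Iio a from hx)] with y hy using h0 y hy
    rw [this.iteratedDeriv_eq]
    simp
  have hc : ∀ m : ℕ, Continuous (iteratedDeriv m h) := fun m =>
    hh.continuous_iteratedDeriv m (by exact_mod_cast le_top)
  have hl : ∀ m, LeftSupported a (iteratedDeriv m h) := fun m =>
    leftSupported_of_continuous (hc m) (hz m)
  refine ⟨hl m, ?_⟩
  induction m with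
  | zero => simp
  | succ m ih =>
    rw [Function.iterate_succ_apply]
    have h1 : primitive (iteratedDeriv (m + 1) h) = iteratedDeriv m h := by
      funext x
      have h2 : ∀ y, HasDerivAt (iteratedDeriv m h) (iteratedDeriv (m + 1) h y) y := by
        intro y
        rw [iteratedDeriv_succ]
        exact ((hh.differentiable_iteratedDeriv m
          (by exact_mod_cast WithTop.coe_lt_top m)) y).hasDerivAt
      rw [(hl (m + 1)).primitive_eq, intervalIntegral.integral_eq_sub_of_hasDerivAt
        (fun y _ => h2 y) ((hl (m + 1)).intervalIntegrable _ _)]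
      have h3 : iteratedDeriv m h a = 0 := by
        have h4 : IsClosed {x | iteratedDeriv m h x = 0} := isClosed_eq (hc m) continuous_const
        have h5 : Iic a ⊆ {x | iteratedDeriv m h x = 0} := by
          rw [← closure_Iio]
          exact h4.closure_subset_iff.2 fun x hx => hz m x hx
        exact h5 (mem_Iic.2 le_rfl)
      rw [h3, sub_zero]
    rw [h1, ih]

/-- The wavelet coefficients of a smooth function with compact support decay at the rate given by
the regularity of the wavelet basis. -/
theorem exists_abs_coeff_le {N : ℕ} (hφ : BoundedSupported A B φ) (hψ : BoundedSupported A B ψ)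
    (hA : 0 ≤ A) (hf : RegularFather N φ) (hw : IsMotherWavelet φ ψ) {h : ℝ → ℝ} {T : ℝ}
    (hh : ContDiff ℝ (⊤ : ℕ∞) h) (hT : Function.support h ⊆ Icc (-T) T) :
    ∃ C : ℝ, 0 ≤ C ∧ ∀ (j : ℕ) (k : ℤ),
      |coeff ψ h j k| ≤ C * (2 : ℝ) ^ (-((j : ℝ) * (N + 3 / 2))) := by
  obtain ⟨B', hB', -⟩ := exists_boundedSupported_iterate_tailIntegral hφ hψ hA hf hw
  have hz : ∀ x, x < -T → h x = 0 := fun x hx => by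
    by_contra hne
    linarith [(hT hne).1]
  obtain ⟨hl, he⟩ := iterate_primitive_iteratedDeriv hh hz (N + 1)
  have hcomp : HasCompactSupport h :=
    HasCompactSupport.of_support_subset_isCompact isCompact_Icc hT
  have hc : Continuous (iteratedDeriv (N + 1) h) :=
    hh.continuous_iteratedDeriv (N + 1) (by exact_mod_cast le_top)
  obtain ⟨G, hG⟩ : ∃ G : ℝ, ∀ x, |iteratedDeriv (N + 1) h x| ≤ G := by
    obtain ⟨G, hG⟩ := hcomp.isCompact.exists_bound_of_continuousOn hc.continuousOn
    refine ⟨max G 0, fun x => ?_⟩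
    by_cases hx : x ∈ tsupport h
    · exact (hG x hx).trans (le_max_left _ _)
    · rw [iteratedDeriv_eq_zero_of_notMem_tsupport hx]
      simp
  have hG0 : 0 ≤ G := (abs_nonneg _).trans (hG 0)
  set θ := tailIntegral^[N + 1] ψ with hθ
  refine ⟨G * ∫ x, |θ x|, by positivity, fun j k => ?_⟩
  have h1 : coeff ψ h j k = (((2 : ℝ) ^ (j : ℤ))⁻¹) ^ (N + 1) *
      coeff θ (iteratedDeriv (N + 1) h) j k := by
    conv_lhs => rw [← he]
    exact coeff_iterate_primitive hl hψ (N + 1) j k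
  have h2 : |coeff θ (iteratedDeriv (N + 1) h) j k| ≤
      G * ((2 : ℝ) ^ (-((j : ℝ) / 2)) * ∫ x, |θ x|) := by
    have h3 := integral_abs_dil θ j k
    push_cast at h3
    rw [coeff, ← h3, ← integral_const_mul]
    refine abs_integral_le_integral_abs.trans ?_
    refine integral_mono_of_nonneg (Filter.Eventually.of_forall fun _ => abs_nonneg _)
      ((hB'.dil j k).integrable.abs.const_mul G) (Filter.Eventually.of_forall fun x => ?_)
    simp only
    rw [abs_mul]
    exact mul_le_mul_of_nonneg_right (hG x) (abs_nonneg _)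
  rw [h1, abs_mul, abs_of_pos (by positivity)]
  refine (mul_le_mul_of_nonneg_left h2 (by positivity)).trans_eq ?_
  -- `N + 1` comes from the integrations and `1/2` from the `L¹` norm of the dilated tail integral.
  have h4 : (((2 : ℝ) ^ (j : ℤ))⁻¹) ^ (N + 1) * (2 : ℝ) ^ (-((j : ℝ) / 2)) =
      (2 : ℝ) ^ (-((j : ℝ) * (N + 3 / 2))) := by
    rw [two_zpow_eq_rpow, ← Real.rpow_neg two_pos.le, ← Real.rpow_natCast, ← Real.rpow_mul two_pos.le,
      ← Real.rpow_add two_pos]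
    congr 1
    push_cast
    ring
  rw [← h4]
  ring

theorem eLpNorm_count_le_of_support {c : ℤ → ℝ} {S : Finset ℤ} (hS : ∀ k, k ∉ S → c k = 0)
    {b p : ℝ} (hb : ∀ k, |c k| ≤ b) (hp : 0 < p) :
    eLpNorm c (ENNReal.ofReal p) Measure.count ≤ ENNReal.ofReal ((S.card : ℝ) ^ (1 / p) * b) := by
  have hb0 : 0 ≤ b := (abs_nonneg _).trans (hb 0)
  rw [eLpNorm_ofReal_eq hp, lintegral_count, tsum_eq_sum (s := S) fun k hk => by
    rw [hS k hk, enorm_zero, ENNReal.zero_rpow_of_pos hp]]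
  have h1 : ∑ k ∈ S, ‖c k‖ₑ ^ p ≤ S.card * ENNReal.ofReal b ^ p := by
    rw [← nsmul_eq_mul]
    refine Finset.sum_le_card_nsmul _ _ _ fun k _ => ?_
    refine ENNReal.rpow_le_rpow ?_ hp.le
    rw [Real.enorm_eq_ofReal_abs]
    exact ENNReal.ofReal_le_ofReal (hb k)
  refine (ENNReal.rpow_le_rpow h1 (by positivity)).trans_eq ?_
  rw [ENNReal.mul_rpow_of_nonneg _ _ (by positivity), ← ENNReal.rpow_mul,
    mul_one_div_cancel hp.ne', ENNReal.rpow_one, ENNReal.ofReal_mul (by positivity),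
    ← ENNReal.ofReal_rpow_of_nonneg (by positivity) (by positivity), ENNReal.ofReal_natCast]

theorem eLpNorm_geometric_lt_top {K ρ : ℝ} (hK : 0 ≤ K) (hρ : 0 < ρ) (hρ1 : ρ < 1) (q : ℝ≥0∞) :
    eLpNorm (fun j : ℕ => K * ρ ^ j) q Measure.count < ⊤ := by
  rcases eq_or_ne q 0 with rfl | hq0
  · simp
  rcases eq_or_ne q ⊤ with rfl | hqt
  · refine lt_of_le_of_lt (eLpNorm_exponent_top.trans_le (eLpNormEssSup_le_of_ae_bound (C := K)
      (Filter.Eventually.of_forall fun j => ?_))) ENNReal.ofReal_lt_top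
    rw [Real.norm_eq_abs, abs_of_nonneg (by positivity)]
    exact mul_le_of_le_one_right hK (pow_le_one₀ hρ.le hρ1.le)
  · have hq : 0 < q.toReal := ENNReal.toReal_pos hq0 hqt
    rw [eLpNorm_lt_top_iff_lintegral_rpow_enorm_lt_top hq0 hqt, lintegral_count]
    have h1 : ∀ j : ℕ, ‖K * ρ ^ j‖ₑ ^ q.toReal =
        ENNReal.ofReal (K ^ q.toReal * (ρ ^ q.toReal) ^ j) := by
      intro j
      rw [Real.enorm_eq_ofReal (by positivity), ENNReal.ofReal_rpow_of_nonneg (by positivity) hq.le,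
        Real.mul_rpow hK (by positivity), ← Real.rpow_natCast_mul hρ.le,
        ← Real.rpow_mul_natCast hρ.le, mul_comm (j : ℝ)]
    simp only [h1]
    refine Summable.tsum_ofReal_lt_top ?_
    exact (summable_geometric_of_lt_one (by positivity)
      (Real.rpow_lt_one hρ.le hρ1 hq)).mul_left _

/-- Smooth functions with compact support have a finite Besov norm. -/
theorem besovNorm_lt_top_of_contDiff {N : ℕ} {s p : ℝ} (hφ : BoundedSupported A B φ)
    (hψ : BoundedSupported A B ψ) (hA : 0 ≤ A) (hf : RegularFather N φ)
    (hw : IsMotherWavelet φ ψ) (hsN : s < N + 1) (hp : 1 ≤ p) (q : ℝ≥0∞) {h : ℝ → ℝ} {T : ℝ}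
    (hT : 0 ≤ T) (hh : ContDiff ℝ (⊤ : ℕ∞) h) (hhT : Function.support h ⊆ Icc (-T) T) :
    besovNorm φ ψ s p q h < ⊤ := by
  have hp0 : 0 < p := one_pos.trans_le hp
  refine ENNReal.add_lt_top.2 ⟨?_, ?_⟩
  · have h0 : ∀ k, k ∉ translates A T 0 → coeff φ h 0 k = 0 := fun k hk => by
      simpa using coeff_eq_zero hφ hhT 0 hk
    refine (eLpNorm_count_le_of_support (S := translates A T 0)
      (b := ∑ k ∈ translates A T 0, |coeff φ h 0 k|) h0 (fun k => ?_) hp0).trans_lt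
      ENNReal.ofReal_lt_top
    by_cases hk : k ∈ translates A T 0
    · exact Finset.single_le_sum (f := fun k => |coeff φ h 0 k|) (fun _ _ => abs_nonneg _) hk
    · rw [h0 k hk, abs_zero]
      exact Finset.sum_nonneg fun _ _ => abs_nonneg _
  · obtain ⟨C, hC, hc⟩ := exists_abs_coeff_le hφ hψ hA hf hw hh hhT
    set c := 2 * (T + A) + 1 with hc'
    have hc0 : 0 < c := by positivity
    -- The weight `2^{j(s+1/2-1/p)}`, the number of translates to the power `1/p` and the
    -- coefficient decay combine to `2^{-j(N+1-s)}`; this is where `s < N + 1` enters.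
    refine lt_of_le_of_lt (eLpNorm_mono_enorm fun j => ?_) (eLpNorm_geometric_lt_top
      (K := c ^ (1 / p) * C) (ρ := (2 : ℝ) ^ (-(N + 1 - s))) (by positivity) (by positivity)
      (Real.rpow_lt_one_of_one_lt_of_neg one_lt_two (by linarith)) q)
    rw [enorm_eq_self, Real.enorm_eq_ofReal (by positivity)]
    refine (mul_le_mul_right (eLpNorm_count_le_of_support (S := translates A T j)
      (fun k hk => coeff_eq_zero hψ hhT j hk) (hc j) hp0) _).trans ?_
    rw [← ENNReal.ofReal_mul (by positivity)]
    refine ENNReal.ofReal_le_ofReal ?_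
    have h1 : ((translates A T j).card : ℝ) ^ (1 / p) ≤ c ^ (1 / p) * (2 : ℝ) ^ ((j : ℝ) * (1 / p)) := by
      refine (Real.rpow_le_rpow (by positivity) (card_translates_le hA hT j)
        (by positivity)).trans_eq ?_
      rw [Real.mul_rpow hc0.le (by positivity), ← Real.rpow_natCast_mul two_pos.le]
    calc _ ≤ (2 : ℝ) ^ ((j : ℝ) * (s + 1 / 2 - 1 / p)) * (c ^ (1 / p) * (2 : ℝ) ^ ((j : ℝ) * (1 / p)) *
          (C * (2 : ℝ) ^ (-((j : ℝ) * (N + 3 / 2))))) := by gcongr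
      _ = c ^ (1 / p) * C * ((2 : ℝ) ^ ((j : ℝ) * (s + 1 / 2 - 1 / p)) *
          (2 : ℝ) ^ ((j : ℝ) * (1 / p)) * (2 : ℝ) ^ (-((j : ℝ) * (N + 3 / 2)))) := by ring
      _ = _ := by
        rw [← Real.rpow_add two_pos, ← Real.rpow_add two_pos, ← Real.rpow_mul_natCast two_pos.le]
        congr 2
        ring

/-- There is a probability density supported in `[-T, T]` with finite Besov norm that is bounded
and bounded away from zero on a neighbourhood of the origin. -/
theorem exists_bump_density {N : ℕ} {s p : ℝ} (hφ : BoundedSupported A B φ)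
    (hψ : BoundedSupported A B ψ) (hA : 0 ≤ A) (hf : RegularFather N φ)
    (hw : IsMotherWavelet φ ψ) (hsN : s < N + 1) (hp : 1 ≤ p) (q : ℝ≥0∞) {T : ℝ} (hT : 0 < T) :
    ∃ h : ℝ → ℝ, ∃ b : ℝ, 0 < b ∧ Measurable h ∧ (∀ x, 0 ≤ h x) ∧ Integrable h volume ∧
      ∫ x, h x = 1 ∧ Function.support h ⊆ Icc (-T) T ∧ besovNorm φ ψ s p q h < ⊤ ∧
      ∀ x, |x| ≤ T / 2 → b ≤ h x := by
  let f : ContDiffBump (0 : ℝ) := ⟨T / 2, T, by linarith, by linarith⟩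
  have hsupp : Function.support (f.normed volume) ⊆ Icc (-T) T := by
    rw [f.support_normed_eq, Real.ball_eq_Ioo]
    intro x hx
    simp only [f, zero_sub, zero_add] at hx
    exact Ioo_subset_Icc_self hx
  refine ⟨f.normed volume, 1 / ∫ x, f x, one_div_pos.2 f.integral_pos,
    f.continuous_normed.measurable, f.nonneg_normed, f.integrable_normed, f.integral_normed, hsupp,
    besovNorm_lt_top_of_contDiff hφ hψ hA hf hw hsN hp q hT.le f.contDiff_normed hsupp,
    fun x hx => ?_⟩
  rw [ContDiffBump.normed_def, f.one_of_mem_closedBall]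
  rwa [mem_closedBall_zero_iff]

end Bump

end PrivateWavelet

namespace PrivateWavelet

/-! ### Contraction of private channels -/

section Contraction

/-- The density `w` of `ν` satisfies `(w - 1)² ≤ d²`, and `∫ w dμ = 1`, so `∫ w² dμ ≤ 1 + d²`;
Cauchy–Schwarz finishes. The second hypothesis is additive so that `d > 1` needs no separate
treatment. -/
theorem sq_lintegral_le_of_close {Ω : Type*} [MeasurableSpace Ω] {μ ν : Measure Ω}
    [IsProbabilityMeasure μ] [IsProbabilityMeasure ν] {d : ℝ≥0}
    (h₁ : ν ≤ (1 + d : ℝ≥0∞) • μ) (h₂ : μ ≤ ν + (d : ℝ≥0∞) • μ) {g : Ω → ℝ≥0∞} (hg : Measurable g) :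
    (∫⁻ x, g x ∂ν) ^ 2 ≤ (1 + (d : ℝ≥0∞) ^ 2) * ∫⁻ x, g x ^ 2 ∂μ := by
  set w := ν.rnDeriv μ with hw
  have hwm : Measurable w := Measure.measurable_rnDeriv ν μ
  have hac : ν ≪ μ := fun s hs => by
    have := h₁ s
    rw [Measure.smul_apply, hs, smul_zero] at this
    exact le_antisymm this zero_le
  have hle : ∀ᵐ x ∂μ, w x ≤ 1 + d := rnDeriv_le_of_le_smul h₁
  have hge : ∀ᵐ x ∂μ, 1 ≤ w x + d := by
    refine ae_le_of_forall_setLIntegral_le_of_sigmaFinite measurable_const fun s hs _ => ?_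
    rw [lintegral_add_right _ measurable_const, Measure.setLIntegral_rnDeriv hac,
      setLIntegral_const, setLIntegral_const, one_mul]
    simpa using h₂ s
  have hw2 : ∫⁻ x, w x ^ 2 ∂μ ≤ 1 + (d : ℝ≥0∞) ^ 2 := by
    have hpt : ∀ᵐ x ∂μ, w x ^ 2 + 1 ≤ 2 * w x + (d : ℝ≥0∞) ^ 2 := by
      filter_upwards [hle, hge] with x hx1 hx2
      have hfin : w x ≠ ⊤ := ne_top_of_le_ne_top (by finiteness) hx1
      lift w x to ℝ≥0 using hfin with y
      norm_cast at hx1 hx2 ⊢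
      rw [← NNReal.coe_le_coe] at hx1 hx2 ⊢
      push_cast at hx1 hx2 ⊢
      nlinarith
    have h3 := lintegral_mono_ae hpt
    rw [lintegral_add_right _ measurable_const, lintegral_add_right _ measurable_const,
      lintegral_const_mul _ hwm, Measure.lintegral_rnDeriv hac, lintegral_const, lintegral_const,
      measure_univ, measure_univ, mul_one, mul_one, mul_one] at h3
    have h4 : (2 : ℝ≥0∞) + (d : ℝ≥0∞) ^ 2 = 1 + (d : ℝ≥0∞) ^ 2 + 1 := by ring
    rw [h4] at h3
    exact (ENNReal.add_le_add_iff_right ENNReal.one_ne_top).1 h3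
  have h5 : ∫⁻ x, g x ∂ν = ∫⁻ x, (g * w) x ∂μ := by
    conv_lhs => rw [← Measure.withDensity_rnDeriv_eq _ _ hac]
    rw [lintegral_withDensity_eq_lintegral_mul _ hwm hg, mul_comm]
  have h6 := ENNReal.lintegral_mul_le_Lp_mul_Lq μ Real.HolderConjugate.two_two hg.aemeasurable
    hwm.aemeasurable
  rw [h5]
  refine (pow_le_pow_left₀ zero_le h6 2).trans ?_
  rw [mul_pow, ← ENNReal.rpow_mul_natCast, ← ENNReal.rpow_mul_natCast]
  norm_num
  rw [mul_comm]
  gcongr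

/-- Mixtures of a private channel over two densities are close. -/
theorem abs_integral_mul_sub_le {α : ℝ} (hα : 0 ≤ α) {u : ℝ → ℝ} (hu : Measurable u)
    (hu0 : ∀ x, 0 ≤ u x) (hu1 : ∀ x, u x ≤ 1) (hp : ∀ x x', u x ≤ Real.exp α * u x')
    {f g : ℝ → ℝ} (hf : Integrable f volume) (hg : Integrable g volume) (hf0 : ∀ x, 0 ≤ f x)
    (hf1 : ∫ x, f x = 1) (hg1 : ∫ x, g x = 1) :
    |(∫ x, g x * u x) - ∫ x, f x * u x| ≤
      ((Real.exp α - 1) * ∫ x, |f x - g x|) * ∫ x, f x * u x := by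
  have hbdd : BddBelow (range u) := ⟨0, by rintro _ ⟨x, rfl⟩; exact hu0 x⟩
  -- Both densities have mass one, so `u` may be replaced by `u - c`. Privacy gives `0 ≤ u - c ≤
  -- (e^α - 1) c`, and `c` is at most the mixture under `f`.
  set c := ⨅ x, u x with hc
  have hc0 : 0 ≤ c := Real.iInf_nonneg hu0
  have hcu : ∀ x, c ≤ u x := fun x => ciInf_le hbdd x
  have huc : ∀ x, u x ≤ Real.exp α * c := by
    intro x
    rw [← div_le_iff₀' (Real.exp_pos α)]
    exact le_ciInf fun x' => (div_le_iff₀' (Real.exp_pos α)).2 (hp x x')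
  have hi : ∀ {f : ℝ → ℝ}, Integrable f volume → Integrable (fun x => f x * u x) volume := fun h =>
    h.mul_bdd (c := 1) hu.aestronglyMeasurable (Filter.Eventually.of_forall fun x => by
      rw [Real.norm_eq_abs, abs_of_nonneg (hu0 x)]; exact hu1 x)
  have hcf : c ≤ ∫ x, f x * u x := by
    calc c = ∫ x, f x * c := by rw [integral_mul_const, hf1, one_mul]
      _ ≤ _ := integral_mono (hf.mul_const c) (hi hf) fun x =>
        mul_le_mul_of_nonneg_left (hcu x) (hf0 x)
  have he : 0 ≤ Real.exp α - 1 := by linarith [Real.add_one_le_exp α]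
  have h1 : (∫ x, g x * u x) - ∫ x, f x * u x = ∫ x, (g x - f x) * (u x - c) := by
    have h2 : ∀ x, (g x - f x) * (u x - c) = (g x * u x - f x * u x) - (g x * c - f x * c) :=
      fun x => by ring
    simp only [h2]
    have h3 := (hi hg).sub (hi hf)
    have h4 := (hg.mul_const c).sub (hf.mul_const c)
    simp only [Pi.sub_def] at h3 h4
    rw [integral_sub h3 h4, integral_sub (hi hg) (hi hf), integral_sub (hg.mul_const c) (hf.mul_const c),
      integral_mul_const, integral_mul_const, hf1, hg1]
    ring
  rw [h1]
  calc |∫ x, (g x - f x) * (u x - c)| ≤ ∫ x, |(g x - f x) * (u x - c)| :=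
        abs_integral_le_integral_abs
    _ ≤ ∫ x, |f x - g x| * ((Real.exp α - 1) * c) := by
        refine integral_mono_of_nonneg (Filter.Eventually.of_forall fun _ => abs_nonneg _)
          ((hf.sub hg).abs.mul_const _) (Filter.Eventually.of_forall fun x => ?_)
        simp only
        rw [abs_mul, abs_sub_comm]
        refine mul_le_mul_of_nonneg_left ?_ (abs_nonneg _)
        rw [abs_of_nonneg (by linarith [hcu x])]
        linarith [huc x]
    _ = ((Real.exp α - 1) * ∫ x, |f x - g x|) * c := by rw [integral_mul_const]; ring
    _ ≤ _ := mul_le_mul_of_nonneg_left hcf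
        (mul_nonneg he (integral_nonneg fun _ => abs_nonneg _))

variable {Z : Type u} [MeasurableSpace Z]

/-- The conditional law of the next private view given the previous ones. -/
noncomputable def Mechanism.stepKernel (Q : Mechanism Z) (P : Measure ℝ) (n : ℕ) :
    Kernel (Fin n → Z) Z :=
  Q.channel n ∘ₖ (Kernel.const (Fin n → Z) P ×ₖ Kernel.id)

instance Mechanism.isMarkovKernel_channel (Q : Mechanism Z) (n : ℕ) :
    IsMarkovKernel (Q.channel n) := Q.markov n

instance Mechanism.isMarkovKernel_stepKernel (Q : Mechanism Z) (P : Measure ℝ)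
    [IsProbabilityMeasure P] (n : ℕ) : IsMarkovKernel (Q.stepKernel P n) := by
  unfold Mechanism.stepKernel; infer_instance

theorem Mechanism.stepKernel_apply (Q : Mechanism Z) (P : Measure ℝ) [IsProbabilityMeasure P]
    (n : ℕ) (z : Fin n → Z) {B : Set Z} (hB : MeasurableSet B) :
    Q.stepKernel P n z B = ∫⁻ x, Q.channel n (x, z) B ∂P := by
  have hm : Measurable fun b => Q.channel n b B := Kernel.measurable_coe _ hB
  rw [Mechanism.stepKernel, Kernel.comp_apply' _ _ _ hB, Kernel.prod_apply, Kernel.const_apply,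
    Kernel.id_apply, lintegral_prod _ hm.aemeasurable]
  refine lintegral_congr fun x => ?_
  exact lintegral_dirac' _ (hm.comp measurable_prodMk_left)

theorem measurable_snoc (n : ℕ) :
    Measurable fun y : (Fin n → Z) × Z => (Fin.snoc (α := fun _ => Z) y.1 y.2 : Fin (n + 1) → Z) := by
  refine measurable_pi_iff.2 fun i => ?_
  refine Fin.lastCases ?_ (fun i => ?_) i
  · simpa using measurable_snd
  · simp only [Fin.snoc_castSucc]
    exact (measurable_pi_apply i).comp measurable_fst

instance Mechanism.isProbabilityMeasure_viewLaw (Q : Mechanism Z) (P : Measure ℝ)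
    [IsProbabilityMeasure P] (n : ℕ) : IsProbabilityMeasure (Q.viewLaw P n) := by
  induction n with
  | zero => unfold Mechanism.viewLaw; infer_instance
  | succ n ih =>
    have h : IsMarkovKernel (Q.channel n ∘ₖ (Kernel.const (Fin n → Z) P ×ₖ Kernel.id)) :=
      Q.isMarkovKernel_stepKernel P n
    rw [Mechanism.viewLaw]
    exact Measure.isProbabilityMeasure_map (measurable_snoc n).aemeasurable

theorem Mechanism.lintegral_viewLaw_succ (Q : Mechanism Z) (P : Measure ℝ) [IsProbabilityMeasure P]
    (n : ℕ) {g : (Fin (n + 1) → Z) → ℝ≥0∞} (hg : Measurable g) :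
    ∫⁻ y, g y ∂(Q.viewLaw P (n + 1)) =
      ∫⁻ z, ∫⁻ y, g (Fin.snoc (α := fun _ => Z) z y) ∂(Q.stepKernel P n z) ∂(Q.viewLaw P n) := by
  have h : IsMarkovKernel (Q.channel n ∘ₖ (Kernel.const (Fin n → Z) P ×ₖ Kernel.id)) :=
    Q.isMarkovKernel_stepKernel P n
  rw [Mechanism.viewLaw, lintegral_map hg (measurable_snoc n)]
  exact Measure.lintegral_compProd (hg.comp (measurable_snoc n))

variable {f g : ℝ → ℝ} {α : ℝ}

theorem lintegral_densityLaw_eq_ofReal {u : ℝ → ℝ≥0∞} (hu : Measurable u) (hu1 : ∀ x, u x ≤ 1)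
    (hf : Measurable f) (hfi : Integrable f volume) (hf0 : ∀ x, 0 ≤ f x) :
    ∫⁻ x, u x ∂(densityLaw f) = ENNReal.ofReal (∫ x, f x * (u x).toReal) := by
  have hfin : ∀ x, u x ≠ ⊤ := fun x => ne_top_of_le_ne_top ENNReal.one_ne_top (hu1 x)
  rw [ofReal_integral_eq_lintegral_ofReal, densityLaw,
    lintegral_withDensity_eq_lintegral_mul _ hf.ennreal_ofReal hu]
  · refine lintegral_congr fun x => ?_
    rw [Pi.mul_apply, ENNReal.ofReal_mul (hf0 x), ENNReal.ofReal_toReal (hfin x)]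
  · exact hfi.mul_bdd (c := 1) hu.ennreal_toReal.aestronglyMeasurable
      (Filter.Eventually.of_forall fun x => by
        rw [Real.norm_eq_abs, abs_of_nonneg ENNReal.toReal_nonneg]
        exact ENNReal.toReal_le_of_le_ofReal one_pos.le (by simpa using hu1 x))
  · exact Filter.Eventually.of_forall fun x => mul_nonneg (hf0 x) ENNReal.toReal_nonneg

/-- For each event `B` the function `x ↦ Q(B | x, z)` has values within a factor `e^α` of one
another, so `abs_integral_mul_sub_le` applies. The bound is uniform in the past `z`, which is what
copes with interaction. -/
theorem Mechanism.stepKernel_close {Q : Mechanism Z} (hQ : Q.IsPrivate α) (hα : 0 ≤ α)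
    (hf : Measurable f) (hfi : Integrable f volume) (hf0 : ∀ x, 0 ≤ f x) (hf1 : ∫ x, f x = 1)
    (hg : Measurable g) (hgi : Integrable g volume) (hg0 : ∀ x, 0 ≤ g x) (hg1 : ∫ x, g x = 1)
    {d : ℝ≥0} (hd : (Real.exp α - 1) * ∫ x, |f x - g x| ≤ d) (n : ℕ) (z : Fin n → Z) :
    Q.stepKernel (densityLaw g) n z ≤ (1 + d : ℝ≥0∞) • Q.stepKernel (densityLaw f) n z ∧
    Q.stepKernel (densityLaw f) n z ≤
      Q.stepKernel (densityLaw g) n z + (d : ℝ≥0∞) • Q.stepKernel (densityLaw f) n z := by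
  have := isProbabilityMeasure_densityLaw hf0 hfi hf1
  have := isProbabilityMeasure_densityLaw hg0 hgi hg1
  have key : ∀ B : Set Z, MeasurableSet B → ∃ a b : ℝ, 0 ≤ a ∧ 0 ≤ b ∧
      Q.stepKernel (densityLaw f) n z B = ENNReal.ofReal a ∧
      Q.stepKernel (densityLaw g) n z B = ENNReal.ofReal b ∧ |b - a| ≤ d * a := by
    intro B hB
    have hu : Measurable fun x => Q.channel n (x, z) B :=
      (Kernel.measurable_coe _ hB).comp measurable_prodMk_right
    have hu1 : ∀ x, Q.channel n (x, z) B ≤ 1 := fun x => prob_le_one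
    have hfin : ∀ x, Q.channel n (x, z) B ≠ ⊤ := fun x => measure_ne_top _ _
    have h0 : 0 ≤ ∫ x, f x * (Q.channel n (x, z) B).toReal :=
      integral_nonneg fun x => mul_nonneg (hf0 x) ENNReal.toReal_nonneg
    refine ⟨_, ∫ x, g x * (Q.channel n (x, z) B).toReal, h0,
      integral_nonneg fun x => mul_nonneg (hg0 x) ENNReal.toReal_nonneg, ?_, ?_, ?_⟩
    · exact (Q.stepKernel_apply _ n z hB).trans (lintegral_densityLaw_eq_ofReal hu hu1 hf hfi hf0)
    · exact (Q.stepKernel_apply _ n z hB).trans (lintegral_densityLaw_eq_ofReal hu hu1 hg hgi hg0)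
    · refine (abs_integral_mul_sub_le hα hu.ennreal_toReal (fun x => ENNReal.toReal_nonneg)
        (fun x => ENNReal.toReal_le_of_le_ofReal one_pos.le (by simpa using hu1 x))
        (fun x x' => ?_) hfi hgi hf0 hf1 hg1).trans (mul_le_mul_of_nonneg_right hd h0)
      have h1 := hQ n z x x' B hB
      have h2 := ENNReal.toReal_mono (by finiteness [hfin x']) h1
      rwa [ENNReal.toReal_mul, ENNReal.toReal_ofReal (Real.exp_pos α).le] at h2
  constructor
  · refine Measure.le_iff.2 fun B hB => ?_
    obtain ⟨a, b, ha, hb, h1, h2, h3⟩ := key B hB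
    rw [Measure.smul_apply, h1, h2, smul_eq_mul, ← ENNReal.ofReal_one, ← ENNReal.ofReal_coe_nnreal,
      ← ENNReal.ofReal_add zero_le_one d.coe_nonneg, ← ENNReal.ofReal_mul (by positivity)]
    refine ENNReal.ofReal_le_ofReal ?_
    linarith [(abs_le.1 h3).2]
  · refine Measure.le_iff.2 fun B hB => ?_
    obtain ⟨a, b, ha, hb, h1, h2, h3⟩ := key B hB
    rw [Measure.add_apply, Measure.smul_apply, h1, h2, smul_eq_mul, ← ENNReal.ofReal_coe_nnreal,
      ← ENNReal.ofReal_mul d.coe_nonneg, ← ENNReal.ofReal_add hb (by positivity)]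
    refine ENNReal.ofReal_le_ofReal ?_
    linarith [(abs_le.1 h3).1]

/-- The laws of `n` private views under two densities are close in the `χ²` sense. -/
theorem Mechanism.sq_lintegral_viewLaw_le {Q : Mechanism Z} (hQ : Q.IsPrivate α) (hα : 0 ≤ α)
    (hf : Measurable f) (hfi : Integrable f volume) (hf0 : ∀ x, 0 ≤ f x) (hf1 : ∫ x, f x = 1)
    (hg : Measurable g) (hgi : Integrable g volume) (hg0 : ∀ x, 0 ≤ g x) (hg1 : ∫ x, g x = 1)
    {d : ℝ≥0} (hd : (Real.exp α - 1) * ∫ x, |f x - g x| ≤ d) (n : ℕ) {F : (Fin n → Z) → ℝ≥0∞}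
    (hF : Measurable F) :
    (∫⁻ z, F z ∂(Q.viewLaw (densityLaw g) n)) ^ 2 ≤
      (1 + (d : ℝ≥0∞) ^ 2) ^ n * ∫⁻ z, F z ^ 2 ∂(Q.viewLaw (densityLaw f) n) := by
  have := isProbabilityMeasure_densityLaw hf0 hfi hf1
  have := isProbabilityMeasure_densityLaw hg0 hgi hg1
  induction n with
  | zero =>
    rw [Mechanism.viewLaw, Mechanism.viewLaw, lintegral_dirac' _ hF,
      lintegral_dirac' _ (hF.pow_const 2), pow_zero, one_mul]
  | succ n ih =>
    have hFs := hF.comp (measurable_snoc (Z := Z) n)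
    have hm : Measurable fun z => ∫⁻ y, F (Fin.snoc (α := fun _ => Z) z y)
        ∂(Q.stepKernel (densityLaw g) n z) :=
      Measurable.lintegral_kernel_prod_right' hFs
    rw [Q.lintegral_viewLaw_succ _ n hF, Q.lintegral_viewLaw_succ _ n (hF.pow_const 2)]
    -- The induction hypothesis is applied to the inner integral as a function of the past views;
    -- its square is then bounded by the one-step estimate for each past separately.
    refine (ih hm).trans ?_
    rw [pow_succ _ n, mul_assoc]
    refine mul_le_mul_right ?_ _
    rw [← lintegral_const_mul' _ _ (by finiteness)]
    refine lintegral_mono fun z => ?_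
    obtain ⟨h1, h2⟩ := Mechanism.stepKernel_close hQ hα hf hfi hf0 hf1 hg hgi hg0 hg1 hd n z
    exact sq_lintegral_le_of_close h1 h2 (hFs.comp measurable_prodMk_left)

/-- Two measures that are close in the `χ²` sense cannot be separated by a test. -/
theorem le_lintegral_add_lintegral {Ω : Type*} [MeasurableSpace Ω] {μ ν : Measure Ω}
    [IsProbabilityMeasure μ] [IsProbabilityMeasure ν] {κ : ℝ} (hκ : 1 ≤ κ)
    (h : ∀ F : Ω → ℝ≥0∞, Measurable F →
      (∫⁻ x, F x ∂ν) ^ 2 ≤ ENNReal.ofReal κ * ∫⁻ x, F x ^ 2 ∂μ)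
    {F G : Ω → ℝ≥0∞} (hF : Measurable F) {Δ : ℝ} (hΔ : 0 < Δ)
    (hFG : ∀ x, ENNReal.ofReal Δ ≤ F x + G x) :
    ENNReal.ofReal (Δ / (4 * κ)) ≤ (∫⁻ x, F x ∂μ) + ∫⁻ x, G x ∂ν := by
  have hκ0 : 0 < κ := one_pos.trans_le hκ
  by_contra hlt
  rw [not_le] at hlt
  have hΔ0 : ENNReal.ofReal Δ ≠ 0 := by simpa using hΔ
  -- The truncated loss is used as a randomised test. Since `a² ≤ a`, a small loss under `μ` makes
  -- `∫ a dν` small by the `χ²` hypothesis, while the separation makes `1 - a` at most `G / Δ`.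
  -- Losses summing to less than `Δ / (4κ)` would give `∫ a dν < 1/2` and so `∫ G dν > Δ/2`, a
  -- contradiction.
  set a : Ω → ℝ≥0∞ := fun x => min (F x / ENNReal.ofReal Δ) 1 with ha
  have ham : Measurable a := (hF.div_const _).min measurable_const
  have h1 : ∫⁻ x, a x ^ 2 ∂μ ≤ (∫⁻ x, F x ∂μ) / ENNReal.ofReal Δ := by
    simp only [div_eq_mul_inv]
    rw [← lintegral_mul_const' _ _ (by simpa using hΔ)]
    refine lintegral_mono fun x => ?_
    calc a x ^ 2 ≤ a x * 1 := by rw [sq]; gcongr; exact min_le_right _ _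
      _ ≤ _ := by rw [mul_one, ← div_eq_mul_inv]; exact min_le_left _ _
  have h2 : 1 ≤ (∫⁻ x, a x ∂ν) + (∫⁻ x, G x ∂ν) / ENNReal.ofReal Δ := by
    simp only [div_eq_mul_inv]
    rw [← lintegral_mul_const' _ _ (by simpa using hΔ), ← lintegral_add_left ham]
    calc (1 : ℝ≥0∞) = ∫⁻ _, 1 ∂ν := by simp
      _ ≤ _ := lintegral_mono fun x => by
        rcases le_total 1 (F x / ENNReal.ofReal Δ) with h3 | h3
        · rw [ha]; simp only [min_eq_right h3]; exact le_self_add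
        · rw [ha]
          simp only [min_eq_left h3]
          rw [← div_eq_mul_inv, ← ENNReal.add_div, ENNReal.le_div_iff_mul_le (Or.inl hΔ0)
            (Or.inl ENNReal.ofReal_ne_top), one_mul]
          exact hFG x
  have hFt : ∫⁻ x, F x ∂μ ≠ ⊤ := ne_top_of_lt (le_self_add.trans_lt hlt)
  have hGt : ∫⁻ x, G x ∂ν ≠ ⊤ := ne_top_of_lt (le_add_self.trans_lt hlt)
  have hat : ∫⁻ x, a x ∂ν ≠ ⊤ := ne_top_of_le_ne_top ENNReal.one_ne_top
    ((lintegral_mono fun x => min_le_right _ _).trans (by simp))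
  have h3 := (h a ham).trans (mul_le_mul_right h1 _)
  obtain ⟨X, hX, hX0⟩ : ∃ X : ℝ, ∫⁻ x, F x ∂μ = ENNReal.ofReal X ∧ 0 ≤ X :=
    ⟨_, (ENNReal.ofReal_toReal hFt).symm, ENNReal.toReal_nonneg⟩
  obtain ⟨Y, hY, hY0⟩ : ∃ Y : ℝ, ∫⁻ x, G x ∂ν = ENNReal.ofReal Y ∧ 0 ≤ Y :=
    ⟨_, (ENNReal.ofReal_toReal hGt).symm, ENNReal.toReal_nonneg⟩
  obtain ⟨W, hW, hW0⟩ : ∃ W : ℝ, ∫⁻ x, a x ∂ν = ENNReal.ofReal W ∧ 0 ≤ W :=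
    ⟨_, (ENNReal.ofReal_toReal hat).symm, ENNReal.toReal_nonneg⟩
  rw [hX, hW, ← ENNReal.ofReal_pow hW0, ← ENNReal.ofReal_div_of_pos hΔ,
    ← ENNReal.ofReal_mul hκ0.le, ENNReal.ofReal_le_ofReal_iff (by positivity)] at h3
  rw [hY, hW, ← ENNReal.ofReal_div_of_pos hΔ, ← ENNReal.ofReal_add hW0 (by positivity),
    ← ENNReal.ofReal_one, ENNReal.ofReal_le_ofReal_iff (by positivity)] at h2
  rw [hX, hY, ← ENNReal.ofReal_add hX0 hY0, ENNReal.ofReal_lt_ofReal_iff (by positivity),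
    lt_div_iff₀ (by positivity)] at hlt
  have h4 : κ * X * 4 < Δ := by nlinarith
  have h5 : W ^ 2 < 1 / 4 := by
    refine h3.trans_lt ?_
    rw [← mul_div_assoc, div_lt_div_iff₀ hΔ (by norm_num)]
    linarith
  have h6 : W < 1 / 2 := by nlinarith
  have h7 : 1 / 2 < Y / Δ := by linarith
  rw [div_lt_div_iff₀ (by norm_num) hΔ] at h7
  nlinarith

end Contraction

end PrivateWavelet

namespace PrivateWavelet

/-! ### Perturbations by wavelets with disjoint supports -/

section Perturbation

variable {A B : ℝ} {φ ψ f g : ℝ → ℝ} {s p : ℝ} {q : ℝ≥0∞}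

theorem coeff_add {h : ℝ → ℝ} (hh : BoundedSupported A B h) (hf : Integrable f volume)
    (hg : Integrable g volume) (j k : ℤ) :
    coeff h (fun x => f x + g x) j k = coeff h f j k + coeff h g j k := by
  unfold coeff
  rw [← integral_add ((hh.dil j k).integrable_mul hf) ((hh.dil j k).integrable_mul hg)]
  simp only [add_mul]

theorem coeff_const_mul (h f : ℝ → ℝ) (c : ℝ) (j k : ℤ) :
    coeff h (fun x => c * f x) j k = c * coeff h f j k := by
  unfold coeff
  rw [← integral_const_mul]
  simp only [mul_assoc]

theorem besovNorm_add_le (hφ : BoundedSupported A B φ) (hψ : BoundedSupported A B ψ)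
    (hp : 1 ≤ p) (hq : 1 ≤ q) (hf : Integrable f volume) (hg : Integrable g volume) :
    besovNorm φ ψ s p q (fun x => f x + g x) ≤ besovNorm φ ψ s p q f + besovNorm φ ψ s p q g := by
  have hp1 : 1 ≤ ENNReal.ofReal p := by simpa using hp
  unfold besovNorm
  simp only [coeff_add hφ hf hg, coeff_add hψ hf hg]
  rw [add_add_add_comm]
  refine add_le_add (eLpNorm_add_le .of_discrete .of_discrete hp1) ?_
  refine le_trans (eLpNorm_mono_enorm fun j => ?_)
    (eLpNorm_add_le (ε := ℝ≥0∞) .of_discrete .of_discrete hq)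
  rw [enorm_eq_self, enorm_eq_self, Pi.add_apply, ← mul_add]
  exact mul_le_mul_right (eLpNorm_add_le .of_discrete .of_discrete hp1) _

theorem besovNorm_const_mul_le {c : ℝ} (hc : 0 ≤ c) :
    besovNorm φ ψ s p q (fun x => c * f x) ≤ ENNReal.ofReal c * besovNorm φ ψ s p q f := by
  have hin : ∀ a : ℤ → ℝ, eLpNorm (fun k => c * a k) (ENNReal.ofReal p) Measure.count ≤
      ENNReal.ofReal c * eLpNorm a (ENNReal.ofReal p) Measure.count := fun a => by
    refine eLpNorm_le_mul_eLpNorm_of_ae_le_mul (Filter.Eventually.of_forall fun k => ?_) _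
    rw [norm_mul, Real.norm_of_nonneg hc]
  unfold besovNorm
  simp only [coeff_const_mul]
  rw [mul_add]
  refine add_le_add (hin _) ?_
  refine eLpNorm_le_mul_eLpNorm_of_ae_le_mul' (c := c.toNNReal)
    (Filter.Eventually.of_forall fun j => ?_) q
  rw [enorm_eq_self, enorm_eq_self]
  refine (mul_le_mul_right (hin _) _).trans_eq ?_
  rw [mul_left_comm]
  rfl

/-- The perturbation with signs given by `v`, built from the wavelets at level `j` with
translates `0, D, 2D, …, (M - 1) D`. -/
noncomputable def perturbation (ψ : ℝ → ℝ) (γ : ℝ) (j : ℕ) (D : ℤ) {M : ℕ} (v : Fin M → Bool)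
    (x : ℝ) : ℝ :=
  ∑ m : Fin M, (if v m then γ else -γ) * dil ψ j (D * (m : ℕ)) x

/-- Reversing one of the signs. -/
def flipSign {M : ℕ} (m : Fin M) (v : Fin M → Bool) : Fin M → Bool := Function.update v m (!v m)

theorem flipSign_flipSign {M : ℕ} (m : Fin M) (v : Fin M → Bool) :
    flipSign m (flipSign m v) = v := by
  simp [flipSign]

variable {γ : ℝ} {j : ℕ} {D : ℤ} {M : ℕ}

/-- Spacing larger than the diameter `2A` of the support makes the wavelets in a perturbation
pairwise disjoint. -/
theorem eq_of_abs_sub_le (hD : 2 * A < D) {m m' : ℕ} {y : ℝ}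
    (h : |y - (D * (m : ℤ) : ℤ)| ≤ A) (h' : |y - (D * (m' : ℤ) : ℤ)| ≤ A) : m = m' := by
  have h1 : |((D * (m : ℤ) : ℤ) : ℝ) - (D * (m' : ℤ) : ℤ)| ≤ 2 * A := by
    rw [abs_le] at *
    constructor <;> linarith [h.1, h.2, h'.1, h'.2]
  have hA : 0 ≤ A := (abs_nonneg _).trans h
  have h2 : |(m : ℤ) - m'| < 1 := by
    have h3 : (D : ℝ) * |((m : ℤ) : ℝ) - (m' : ℤ)| ≤ 2 * A := by
      rw [← abs_of_pos (show (0 : ℝ) < D by linarith), ← abs_mul]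
      convert! h1 using 2
      push_cast
      ring
    by_contra hne
    rw [not_lt] at hne
    have h4 : (1 : ℝ) ≤ |((m : ℤ) : ℝ) - (m' : ℤ)| := by exact_mod_cast hne
    nlinarith
  have := Int.abs_lt_one_iff.1 h2
  omega

theorem perturbation_eq (hψ : BoundedSupported A B ψ) (hD : 2 * A < D) (v : Fin M → Bool)
    {m : Fin M} {x : ℝ} (hx : |(2 : ℝ) ^ (j : ℤ) * x - (D * ((m : ℕ) : ℤ) : ℤ)| ≤ A) :
    perturbation ψ γ j D v x = (if v m then γ else -γ) * dil ψ j (D * (m : ℕ)) x := by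
  unfold perturbation
  refine Finset.sum_eq_single m (fun m' _ hne => ?_) (by simp)
  have : dil ψ j (D * (m' : ℕ)) x = 0 := by
    by_contra h0
    exact hne (Fin.ext (eq_of_abs_sub_le hD (hψ.dil_support h0) hx))
  rw [this, mul_zero]

theorem exists_of_perturbation_ne_zero (hψ : BoundedSupported A B ψ) {v : Fin M → Bool} {x : ℝ}
    (hx : perturbation ψ γ j D v x ≠ 0) :
    ∃ m : Fin M, |(2 : ℝ) ^ (j : ℤ) * x - (D * ((m : ℕ) : ℤ) : ℤ)| ≤ A := by
  obtain ⟨m, -, hm⟩ := Finset.exists_ne_zero_of_sum_ne_zero hx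
  exact ⟨m, hψ.dil_support (right_ne_zero_of_mul hm)⟩

theorem abs_perturbation_le (hψ : BoundedSupported A B ψ) (hD : 2 * A < D) (hγ : 0 ≤ γ)
    (v : Fin M → Bool) (x : ℝ) :
    |perturbation ψ γ j D v x| ≤ γ * ((2 : ℝ) ^ ((j : ℝ) / 2) * B) := by
  have hB := hψ.nonneg
  by_cases h0 : perturbation ψ γ j D v x = 0
  · rw [h0, abs_zero]; positivity
  obtain ⟨m, hm⟩ := exists_of_perturbation_ne_zero hψ h0
  rw [perturbation_eq hψ hD v hm, abs_mul]
  have h1 : |if v m then γ else -γ| = γ := by split_ifs <;> simp [abs_of_nonneg hγ]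
  rw [h1]
  have := hψ.abs_dil_le j (D * (m : ℕ)) x
  rw [Int.cast_natCast] at this
  gcongr

theorem measurable_perturbation (hψ : BoundedSupported A B ψ) (v : Fin M → Bool) :
    Measurable (perturbation ψ γ j D v) :=
  Finset.measurable_sum _ fun _ _ => (hψ.measurable_dil _ _).const_mul _

theorem integrable_perturbation (hψ : BoundedSupported A B ψ) (v : Fin M → Bool) :
    Integrable (perturbation ψ γ j D v) volume :=
  integrable_finsetSum _ fun _ _ => (hψ.dil _ _).integrable.const_mul _

theorem integral_perturbation (hψ : BoundedSupported A B ψ) (h0 : ∫ x, ψ x = 0)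
    (v : Fin M → Bool) : ∫ x, perturbation ψ γ j D v x = 0 := by
  unfold perturbation
  rw [integral_finsetSum _ fun _ _ => (hψ.dil _ _).integrable.const_mul _]
  refine Finset.sum_eq_zero fun m _ => ?_
  rw [integral_const_mul]
  unfold dil
  rw [integral_const_mul, integral_comp_affine ψ (by positivity), h0, mul_zero, mul_zero, mul_zero]

theorem perturbation_sub_flipSign (v : Fin M → Bool) (m : Fin M) (x : ℝ) :
    perturbation ψ γ j D v x - perturbation ψ γ j D (flipSign m v) x =
      2 * (if v m then γ else -γ) * dil ψ j (D * (m : ℕ)) x := by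
  unfold perturbation
  rw [← Finset.sum_sub_distrib, Finset.sum_eq_single m]
  · cases h : v m <;> simp [flipSign, h] <;> ring
  · intro m' _ hne
    simp [flipSign, Function.update_of_ne hne]
  · simp

theorem integral_abs_perturbation_sub (hψ : BoundedSupported A B ψ) (hA : 0 ≤ A) (hγ : 0 ≤ γ)
    (v : Fin M → Bool) (m : Fin M) :
    ∫ x, |perturbation ψ γ j D v x - perturbation ψ γ j D (flipSign m v) x| ≤
      2 * γ * ((2 : ℝ) ^ (-((j : ℝ) / 2)) * (2 * A * B)) := by
  have h1 : |if v m then γ else -γ| = γ := by split_ifs <;> simp [abs_of_nonneg hγ]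
  simp only [perturbation_sub_flipSign, abs_mul, h1, abs_two]
  rw [integral_const_mul, integral_abs_dil, Int.cast_natCast]
  have := hψ.integral_abs_le hA
  gcongr

theorem coeff_sum {ι : Type*} (S : Finset ι) (h : ℝ → ℝ) (c : ι → ℝ) (F : ι → ℝ → ℝ)
    (hF : ∀ i ∈ S, Integrable (F i) volume) (hh : BoundedSupported A B h) (i k : ℤ) :
    coeff h (fun x => ∑ m ∈ S, c m * F m x) i k = ∑ m ∈ S, c m * coeff h (F m) i k := by
  unfold coeff
  simp only [Finset.sum_mul, mul_assoc]
  rw [integral_finsetSum _ fun m hm => ((hh.dil i k).integrable_mul (hF m hm)).const_mul _]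
  simp only [integral_const_mul]

theorem coeff_perturbation (hφ : BoundedSupported A B φ) (hψ : BoundedSupported A B ψ)
    (hm : GeneratesMRA φ) (hw : IsMotherWavelet φ ψ) (v : Fin M → Bool) (i : ℕ) (k : ℤ) :
    coeff ψ (perturbation ψ γ j D v) i k =
      ∑ m : Fin M, (if v m then γ else -γ) * if j = i ∧ D * (m : ℕ) = k then 1 else 0 := by
  unfold perturbation
  rw [coeff_sum _ _ _ _ (fun m _ => (hψ.dil _ _).integrable) hψ]
  simp only [coeff_mother_mother hφ hψ hm hw]

/-- By orthogonality only level `j` is present, with at most `M` coefficients of modulus `γ`, so the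
outer `ℓ^q` norm reduces to one term whatever `q` is. -/
theorem besovNorm_perturbation_le (hφ : BoundedSupported A B φ) (hψ : BoundedSupported A B ψ)
    (hm : GeneratesMRA φ) (hw : IsMotherWavelet φ ψ) (hp : 1 ≤ p) (hD : D ≠ 0)
    (hγ : 0 ≤ γ) (v : Fin M → Bool) :
    besovNorm φ ψ s p q (perturbation ψ γ j D v) ≤
      ENNReal.ofReal ((2 : ℝ) ^ ((j : ℝ) * (s + 1 / 2 - 1 / p)) * ((M : ℝ) ^ (1 / p) * γ)) := by
  have hp0 : 0 < p := one_pos.trans_le hp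
  have h0 : ∀ k, coeff φ (perturbation ψ γ j D v) 0 k = 0 := by
    intro k
    unfold perturbation
    rw [coeff_sum _ _ _ _ (fun m _ => (hψ.dil _ _).integrable) hφ]
    simp [coeff_father_mother hφ hψ hm hw]
  have h1 : ∀ (i : ℕ), i ≠ j → ∀ k : ℤ, coeff ψ (perturbation ψ γ j D v) i k = 0 := by
    intro i hi k
    rw [coeff_perturbation hφ hψ hm hw]
    simp [Ne.symm hi]
  set c := ENNReal.ofReal ((2 : ℝ) ^ ((j : ℝ) * (s + 1 / 2 - 1 / p)) * ((M : ℝ) ^ (1 / p) * γ))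
    with hc
  unfold besovNorm
  simp only [h0]
  rw [eLpNorm_zero', zero_add]
  refine (eLpNorm_mono_enorm (g := ({j} : Set ℕ).indicator fun _ => c) fun i => ?_).trans ?_
  · rw [enorm_eq_self, enorm_eq_self]
    by_cases hi : i = j
    · subst hi
      rw [indicator_of_mem (mem_singleton i), hc, ENNReal.ofReal_mul (by positivity)]
      refine mul_le_mul_right ?_ _
      refine (eLpNorm_count_le_of_support (b := γ)
        (S := Finset.univ.image fun m : Fin M => D * ((m : ℕ) : ℤ)) (fun k hk => ?_)
        (fun k => ?_) hp0).trans (ENNReal.ofReal_le_ofReal ?_)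
      · rw [coeff_perturbation hφ hψ hm hw]
        refine Finset.sum_eq_zero fun m _ => ?_
        refine mul_eq_zero_of_right _ (if_neg ?_)
        rintro ⟨-, h2⟩
        exact hk (Finset.mem_image.2 ⟨m, Finset.mem_univ _, h2⟩)
      · rw [coeff_perturbation hφ hψ hm hw]
        by_cases hk : ∃ m : Fin M, D * ((m : ℕ) : ℤ) = k
        · obtain ⟨m, hmk⟩ := hk
          rw [Finset.sum_eq_single m]
          · split_ifs <;> simp [abs_of_nonneg hγ, hγ]
          · intro m' _ hne
            refine mul_eq_zero_of_right _ (if_neg ?_)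
            rintro ⟨-, h2⟩
            rw [← hmk] at h2
            have h3 := mul_left_cancel₀ hD h2
            exact hne (Fin.ext (by exact_mod_cast h3))
          · simp
        · rw [Finset.sum_eq_zero, abs_zero]
          · exact hγ
          · intro m _
            refine mul_eq_zero_of_right _ (if_neg ?_)
            exact fun h2 => hk ⟨m, h2.2⟩
      · gcongr
        exact_mod_cast Finset.card_image_le.trans (by simp)
    · rw [indicator_of_notMem (by simpa using hi)]
      simp only [h1 i hi]
      rw [eLpNorm_zero', mul_zero]
  · refine (eLpNorm_indicator_const_le _ q).trans_eq ?_
    rw [Measure.count_singleton, ENNReal.one_rpow, mul_one, enorm_eq_self]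

end Perturbation

end PrivateWavelet

namespace PrivateWavelet

/-! ### The lower bound -/

section LowerBound

variable {A B : ℝ} {φ ψ f : ℝ → ℝ} {s p r : ℝ} {q : ℝ≥0∞} {γ : ℝ} {j : ℕ} {D : ℤ} {M : ℕ}

/-- Averaging over all sign vectors and pairing each of them with its neighbours. -/
theorem card_mul_le_of_pairs {R : (Fin M → Bool) → ℝ≥0∞} {a : Fin M → (Fin M → Bool) → ℝ≥0∞}
    {c S : ℝ≥0∞} (hR : ∀ v, ∑ m, a m v ≤ R v) (ha : ∀ m v, c ≤ a m v + a m (flipSign m v))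
    (hS : ∀ v, R v ≤ S) : M * c ≤ 2 * S := by
  have h1 : ∀ m, ∑ v, a m (flipSign m v) = ∑ v, a m v := fun m =>
    Equiv.sum_comp (Function.Involutive.toPerm (flipSign m) (flipSign_flipSign m)) (a m)
  have h2 : ∑ m : Fin M, ∑ _v : Fin M → Bool, c ≤ 2 * ∑ _v : Fin M → Bool, S := by
    calc ∑ m : Fin M, ∑ _v : Fin M → Bool, c ≤ ∑ m, ∑ v, (a m v + a m (flipSign m v)) :=
          Finset.sum_le_sum fun m _ => Finset.sum_le_sum fun v _ => ha m v
      _ = 2 * ∑ v, ∑ m, a m v := by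
          simp only [Finset.sum_add_distrib, h1]
          rw [Finset.sum_comm, two_mul]
      _ ≤ _ := by
          gcongr with v
          exact (hR v).trans (hS v)
  simp only [Finset.sum_const, Finset.card_univ, nsmul_eq_mul, Fintype.card_fin] at h2
  rw [mul_left_comm, mul_left_comm 2] at h2
  refine (ENNReal.mul_le_mul_iff_right ?_ ?_).1 h2
  · exact_mod_cast Fintype.card_ne_zero
  · exact ENNReal.natCast_ne_top _

/-- The support of the wavelet with translate `D m` at level `j`. -/
def cell (A : ℝ) (j : ℕ) (D : ℤ) (m : ℕ) : Set ℝ :=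
  {x | |(2 : ℝ) ^ (j : ℤ) * x - (D * (m : ℤ) : ℤ)| ≤ A}

theorem measurableSet_cell (A : ℝ) (j : ℕ) (D : ℤ) (m : ℕ) : MeasurableSet (cell A j D m) :=
  measurableSet_le (by fun_prop) measurable_const

/-- The contribution of one cell to the loss. -/
noncomputable def cellLoss (A : ℝ) (ψ : ℝ → ℝ) (γ r : ℝ) (j : ℕ) (D : ℤ) (f e : ℝ → ℝ) (m : ℕ)
    (ε : Bool) : ℝ≥0∞ :=
  ∫⁻ x in cell A j D m, ‖e x - (f x + (if ε then γ else -γ) * dil ψ j (D * (m : ℤ)) x)‖ₑ ^ r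

/-- The cells are disjoint, and on a cell the perturbation depends on its own sign only. The loss
thus decouples into one problem per sign. -/
theorem sum_cellLoss_le (hψ : BoundedSupported A B ψ) (hD : 2 * A < D) (f e : ℝ → ℝ)
    (v : Fin M → Bool) :
    ∑ m : Fin M, cellLoss A ψ γ r j D f e m (v m) ≤
      lossPow r e (fun x => f x + perturbation ψ γ j D v x) := by
  have h1 : ∀ m : Fin M, cellLoss A ψ γ r j D f e m (v m) =
      ∫⁻ x in cell A j D m, ‖e x - (f x + perturbation ψ γ j D v x)‖ₑ ^ r := by
    intro m
    refine setLIntegral_congr_fun (measurableSet_cell A j D m) fun x hx => ?_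
    rw [perturbation_eq hψ hD v hx]
  simp only [h1]
  rw [← tsum_fintype (L := SummationFilter.unconditional _), ← lintegral_iUnion (fun m : Fin M => measurableSet_cell A j D m)]
  · exact setLIntegral_le_lintegral _ _
  · intro m m' hne
    refine disjoint_left.2 fun x hx hx' => hne (Fin.ext (eq_of_abs_sub_le hD hx hx'))

/-- The two candidates differ on the cell by `2γ` times one wavelet, so by the triangle inequality
no estimate can be close to both. -/
theorem le_cellLoss_add (hψ : BoundedSupported A B ψ) (hr : 1 ≤ r) (hγ : 0 ≤ γ) (f e : ℝ → ℝ)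
    (he : Measurable e) (hf : Measurable f) (m : ℕ) (ε : Bool) :
    ENNReal.ofReal ((2 * γ) ^ r * (2 : ℝ) ^ ((j : ℝ) * (r / 2 - 1))) * (∫⁻ x, ‖ψ x‖ₑ ^ r) ≤
      ENNReal.ofReal (2 ^ (r - 1)) *
        (cellLoss A ψ γ r j D f e m ε + cellLoss A ψ γ r j D f e m (!ε)) := by
  have hr0 : 0 < r := one_pos.trans_le hr
  have hd := hψ.measurable_dil j (D * (m : ℤ))
  have h1 : ∫⁻ x in cell A j D m, ‖2 * γ * dil ψ j (D * (m : ℤ)) x‖ₑ ^ r =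
      ENNReal.ofReal ((2 * γ) ^ r * (2 : ℝ) ^ ((j : ℝ) * (r / 2 - 1))) * ∫⁻ x, ‖ψ x‖ₑ ^ r := by
    rw [setLIntegral_eq_of_support_subset]
    · have h2 : ∀ x, ‖2 * γ * dil ψ j (D * (m : ℤ)) x‖ₑ ^ r =
          ENNReal.ofReal ((2 * γ) ^ r) * ‖dil ψ j (D * (m : ℤ)) x‖ₑ ^ r := by
        intro x
        rw [enorm_mul, ENNReal.mul_rpow_of_nonneg _ _ hr0.le, Real.enorm_of_nonneg (by positivity),
          ENNReal.ofReal_rpow_of_nonneg (by positivity) hr0.le]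
      simp only [h2]
      rw [lintegral_const_mul' _ _ ENNReal.ofReal_ne_top, lintegral_dil_rpow _ _ _ hr0.le,
        ENNReal.ofReal_mul (by positivity), Int.cast_natCast, mul_assoc]
    · intro x hx
      refine hψ.dil_support (j := j) (k := D * (m : ℤ)) fun h0 => hx ?_
      simp [h0, hr0]
  have hmeas : Measurable fun x =>
      ‖e x - (f x + (if ε then γ else -γ) * dil ψ j (D * (m : ℤ)) x)‖ₑ ^ r :=
    ((he.sub (hf.add (hd.const_mul _))).enorm).pow_const r
  rw [← h1, cellLoss, cellLoss, ← lintegral_add_left hmeas,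
    ← lintegral_const_mul' _ _ ENNReal.ofReal_ne_top]
  refine lintegral_mono fun x => ?_
  have h3 : ‖2 * γ * dil ψ j (D * (m : ℤ)) x‖ₑ ≤
      ‖e x - (f x + (if ε then γ else -γ) * dil ψ j (D * (m : ℤ)) x)‖ₑ +
        ‖e x - (f x + (if !ε then γ else -γ) * dil ψ j (D * (m : ℤ)) x)‖ₑ := by
    have h4 : ‖2 * γ * dil ψ j (D * (m : ℤ)) x‖ₑ =
        ‖(e x - (f x + (if ε then γ else -γ) * dil ψ j (D * (m : ℤ)) x)) -
          (e x - (f x + (if !ε then γ else -γ) * dil ψ j (D * (m : ℤ)) x))‖ₑ := by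
      cases ε
      · congr 1
        simp only [Bool.false_eq_true, if_false, Bool.not_false, if_true]
        ring
      · rw [← enorm_neg]
        congr 1
        simp only [Bool.false_eq_true, if_false, Bool.not_true, if_true]
        ring
    rw [h4]
    exact enorm_sub_le
  refine (ENNReal.rpow_le_rpow h3 hr0.le).trans ?_
  refine (ENNReal.rpow_add_le_mul_rpow_add_rpow _ _ hr).trans_eq ?_
  congr 1
  rw [← ENNReal.ofReal_rpow_of_pos two_pos, ENNReal.ofReal_ofNat]

theorem measurable_cellLoss {Ω : Type*} [MeasurableSpace Ω] (hψ : BoundedSupported A B ψ)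
    {e : Ω → ℝ → ℝ} (he : Measurable (Function.uncurry e)) (hf : Measurable f) (m : ℕ) (ε : Bool) :
    Measurable fun z => cellLoss A ψ γ r j D f (e z) m ε := by
  have hd := hψ.measurable_dil j (D * (m : ℤ))
  have h : Measurable (Function.uncurry fun (z : Ω) (x : ℝ) =>
      ‖e z x - (f x + (if ε then γ else -γ) * dil ψ j (D * (m : ℤ)) x)‖ₑ ^ r) :=
    ((he.sub ((hf.comp measurable_snd).add ((hd.comp measurable_snd).const_mul _))).enorm).pow_const r
  exact h.lintegral_prod_right'

/-- A lower bound for the private minimax risk over a class that contains all perturbations of a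
density. -/
theorem le_privateMinimaxRisk (hψ : BoundedSupported A B ψ) (hA : 0 ≤ A) (hD : 2 * A < D)
    (hr : 1 ≤ r) (hγ : 0 < γ) {F : Set (ℝ → ℝ)} (hf : Measurable f)
    (hF : ∀ v : Fin M → Bool, (fun x => f x + perturbation ψ γ j D v x) ∈ F)
    (hF' : ∀ g ∈ F, Measurable g ∧ (∀ x, 0 ≤ g x) ∧ Integrable g volume ∧ ∫ x, g x = 1)
    {Ψ : ℝ} (hΨ : 0 < Ψ) (hΨψ : ENNReal.ofReal Ψ ≤ ∫⁻ x, ‖ψ x‖ₑ ^ r) {n : ℕ} {α d κ : ℝ}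
    (hα : 0 ≤ α) (hd : (Real.exp α - 1) * (2 * γ * ((2 : ℝ) ^ (-((j : ℝ) / 2)) * (2 * A * B))) ≤ d)
    (hκ : (1 + d ^ 2) ^ n ≤ κ) :
    ENNReal.ofReal (M * ((2 * γ) ^ r * (2 : ℝ) ^ ((j : ℝ) * (r / 2 - 1)) * Ψ / 2 ^ (r - 1) /
      (4 * κ)) / 2) ≤ privateMinimaxRisk.{u} r F n α := by
  have hB := hψ.nonneg
  have he0 : 0 ≤ Real.exp α - 1 := by linarith [Real.add_one_le_exp α]
  have hd0 : 0 ≤ d := le_trans (by positivity) hd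
  have hκ1 : 1 ≤ κ := le_trans (one_le_pow₀ (by nlinarith)) hκ
  have hκ0 : 0 < κ := one_pos.trans_le hκ1
  set Δ := (2 * γ) ^ r * (2 : ℝ) ^ ((j : ℝ) * (r / 2 - 1)) * Ψ / 2 ^ (r - 1) with hΔ
  have hΔ0 : 0 < Δ := by positivity
  unfold privateMinimaxRisk
  refine le_iInf fun Z => le_iInf fun hZ => le_iInf fun Q => le_iInf fun hQ => le_iInf fun e =>
    le_iInf fun he => ?_
  set S := ⨆ g ∈ F, ∫⁻ z, lossPow r (e z) g ∂(Q.viewLaw (densityLaw g) n) with hS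
  set fv : (Fin M → Bool) → ℝ → ℝ := fun v x => f x + perturbation ψ γ j D v x with hfv
  have hpr : ∀ v, IsProbabilityMeasure (densityLaw (fv v)) := fun v =>
    isProbabilityMeasure_densityLaw (hF' _ (hF v)).2.1 (hF' _ (hF v)).2.2.1 (hF' _ (hF v)).2.2.2
  have hcell : ∀ (m : Fin M) (ε : Bool),
      Measurable fun z => cellLoss A ψ γ r j D f (e z) m ε := fun m ε =>
    measurable_cellLoss hψ he hf m ε
  -- Assouad's scheme: the cost of sign `m` is its cell loss averaged under the view law of `v`.
  -- Reversing that sign changes both the target and the law, and the law only slightly.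
  have key := card_mul_le_of_pairs (M := M)
    (R := fun v => ∫⁻ z, lossPow r (e z) (fv v) ∂(Q.viewLaw (densityLaw (fv v)) n))
    (a := fun m v => ∫⁻ z, cellLoss A ψ γ r j D f (e z) m (v m)
      ∂(Q.viewLaw (densityLaw (fv v)) n))
    (c := ENNReal.ofReal (Δ / (4 * κ))) (S := S)
    (fun v => ?_) (fun m v => ?_) fun v => ?_
  · rw [ENNReal.ofReal_div_of_pos two_pos, ENNReal.ofReal_mul (by positivity),
      ENNReal.ofReal_natCast, ENNReal.ofReal_ofNat]
    exact ENNReal.div_le_of_le_mul (by rwa [mul_comm S])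
  · rw [← lintegral_finsetSum _ fun m _ => hcell m (v m)]
    exact lintegral_mono fun z => sum_cellLoss_le hψ hD f (e z) v
  · have hflip : flipSign m v m = !v m := by simp [flipSign]
    simp only [hflip]
    refine le_lintegral_add_lintegral hκ1 (fun G hG => ?_) (hcell m (v m)) hΔ0 fun z => ?_
    · obtain ⟨h1, h2, h3, h4⟩ := hF' _ (hF v)
      obtain ⟨h1', h2', h3', h4'⟩ := hF' _ (hF (flipSign m v))
      have hdist : (Real.exp α - 1) * ∫ x, |fv v x - fv (flipSign m v) x| ≤ d.toNNReal := by
        rw [Real.coe_toNNReal d hd0]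
        refine le_trans ?_ hd
        have h5 := integral_abs_perturbation_sub (γ := γ) (j := j) (D := D) hψ hA hγ.le v m
        simp only [hfv, add_sub_add_left_eq_sub]
        gcongr
      refine (Mechanism.sq_lintegral_viewLaw_le hQ hα h1 h3 h2 h4 h1' h3' h2' h4' hdist n hG).trans ?_
      refine mul_le_mul_left ?_ _
      calc (1 + (d.toNNReal : ℝ≥0∞) ^ 2) ^ n = ENNReal.ofReal ((1 + d ^ 2) ^ n) := by
            rw [ENNReal.ofReal_pow (by positivity), ENNReal.ofReal_add one_pos.le (by positivity),
              ENNReal.ofReal_pow hd0, ENNReal.ofReal_one]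
            rfl
        _ ≤ _ := ENNReal.ofReal_le_ofReal hκ
    · have hez : Measurable (e z) := he.comp measurable_prodMk_left
      have h6 := le_cellLoss_add (A := A) (j := j) (D := D) hψ hr hγ.le f (e z) hez hf m (v m)
      rw [hΔ, ENNReal.ofReal_div_of_pos (by positivity), ENNReal.ofReal_mul (by positivity)]
      refine ENNReal.div_le_of_le_mul ?_
      rw [mul_comm _ (ENNReal.ofReal (2 ^ (r - 1)))]
      exact (mul_le_mul_right hΨψ _).trans h6
  · exact le_iSup₂_of_le (fv v) (hF v) le_rfl

/-- The Besov slack `L - L₁` absorbs the perturbation, the lower bound `β` on the cells keeps the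
sum nonnegative, and `∫ ψ = 0` preserves the mass. -/
theorem add_perturbation_mem_densityClass {L L₁ T T' β : ℝ} (hφ : BoundedSupported A B φ)
    (hψ : BoundedSupported A B ψ) (hm : GeneratesMRA φ) (hw : IsMotherWavelet φ ψ)
    (h0 : ∫ x, ψ x = 0) (hp : 1 ≤ p) (hq : 1 ≤ q) (hA : 0 ≤ A) (hD : 2 * A < D) (hγ : 0 ≤ γ)
    (hL₁ : 0 ≤ L₁) (hf : f ∈ densityClass φ ψ s p q L₁ T) (hT : T' ≤ T)
    (hβ : ∀ x, |x| ≤ T' → β ≤ f x)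
    (hJ : (2 : ℝ) ^ ((j : ℝ) * (s + 1 / 2 - 1 / p)) * ((M : ℝ) ^ (1 / p) * γ) ≤ L - L₁)
    (hsup : γ * ((2 : ℝ) ^ ((j : ℝ) / 2) * B) ≤ β)
    (hcell : ∀ m : ℕ, m < M → ∀ x ∈ cell A j D m, |x| ≤ T') (v : Fin M → Bool) :
    (fun x => f x + perturbation ψ γ j D v x) ∈ densityClass φ ψ s p q L T := by
  obtain ⟨hfm, hf0, hfi, hf1, hfT, hfJ⟩ := hf
  have hin : ∀ x, perturbation ψ γ j D v x ≠ 0 → |x| ≤ T' := fun x hx => by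
    obtain ⟨m, hm⟩ := exists_of_perturbation_ne_zero hψ hx
    exact hcell m m.2 x hm
  have hD0 : D ≠ 0 := by
    rintro rfl
    push_cast at hD
    linarith
  refine ⟨hfm.add (measurable_perturbation hψ v), fun x => ?_,
    hfi.add (integrable_perturbation hψ v), ?_, fun x hx => ?_, ?_⟩
  · by_cases hx : perturbation ψ γ j D v x = 0
    · simp only [hx, add_zero, hf0 x]
    · have h1 := hβ x (hin x hx)
      have h2 := (abs_le.1 (abs_perturbation_le (j := j) hψ hD hγ v x)).1
      linarith
  · rw [integral_add hfi (integrable_perturbation hψ v), integral_perturbation hψ h0, hf1, add_zero]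
  · by_cases h1 : f x = 0
    · have h2 : perturbation ψ γ j D v x ≠ 0 := fun h2 => hx (by simp [h1, h2])
      exact abs_le.1 ((hin x h2).trans hT)
    · exact hfT h1
  · refine (besovNorm_add_le hφ hψ hp hq hfi (integrable_perturbation hψ v)).trans ?_
    refine (add_le_add hfJ (besovNorm_perturbation_le hφ hψ hm hw hp hD0 hγ v)).trans ?_
    rw [← ENNReal.ofReal_add hL₁ (by positivity)]
    exact ENNReal.ofReal_le_ofReal (by linarith)

/-- If the Besov ball of a smaller radius contains a density, then there is a density in the
interior of the ball that is bounded away from zero near the origin. -/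
theorem exists_interior_density {N : ℕ} {L L₀ T : ℝ} (hφ : BoundedSupported A B φ)
    (hψ : BoundedSupported A B ψ) (hA : 0 ≤ A) (hf : RegularFather N φ)
    (hw : IsMotherWavelet φ ψ) (hsN : s < N + 1) (hp : 1 ≤ p) (hq : 1 ≤ q) (hT : 0 < T)
    (hL : 0 < L) (hL₀ : L₀ < L) (hne : (densityClass φ ψ s p q L₀ T).Nonempty) :
    ∃ f : ℝ → ℝ, ∃ L₁ β : ℝ, 0 ≤ L₁ ∧ L₁ < L ∧ 0 < β ∧ f ∈ densityClass φ ψ s p q L₁ T ∧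
      ∀ x, |x| ≤ T / 2 → β ≤ f x := by
  obtain ⟨f₀, hfm, hf0, hfi, hf1, hfT, hfJ⟩ := hne
  obtain ⟨h, b, hb, hhm, hh0, hhi, hh1, hhT, hhJ, hhb⟩ :=
    exists_bump_density hφ hψ hA hf hw hsN hp q hT
  set H := (besovNorm φ ψ s p q h).toReal with hH
  have hH0 : 0 ≤ H := ENNReal.toReal_nonneg
  set L' := max L₀ 0 with hL'
  have hL'0 : 0 ≤ L' := le_max_right _ _
  have hL'L : L' < L := max_lt hL₀ hL
  -- A small admixture of the bump uses at most half of the gap between the radii, however large its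
  -- Besov norm `H` is.
  set ε := min 1 ((L - L') / (2 * (H + 1))) with hε
  have hε0 : 0 < ε := lt_min one_pos (div_pos (by linarith) (by positivity))
  have hε1 : ε ≤ 1 := min_le_left _ _
  have hεH : ε * H ≤ (L - L') / 2 := by
    have h1 : ε ≤ (L - L') / (2 * (H + 1)) := min_le_right _ _
    rw [le_div_iff₀ (by positivity)] at h1
    nlinarith
  refine ⟨fun x => (1 - ε) * f₀ x + ε * h x, L' + ε * H, ε * b, by positivity, by linarith,
    by positivity, ⟨(hfm.const_mul _).add (hhm.const_mul _), fun x => ?_,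
      (hfi.const_mul _).add (hhi.const_mul _), ?_, fun x hx => ?_, ?_⟩, fun x hx => ?_⟩
  · have := hf0 x
    have := hh0 x
    have : 0 ≤ 1 - ε := by linarith
    positivity
  · rw [integral_add (hfi.const_mul _) (hhi.const_mul _), integral_const_mul, integral_const_mul,
      hf1, hh1]
    ring
  · by_cases h1 : f₀ x = 0
    · exact hhT fun h2 => hx (by simp [h1, h2])
    · exact hfT h1
  · refine (besovNorm_add_le hφ hψ hp hq (hfi.const_mul _) (hhi.const_mul _)).trans ?_
    rw [ENNReal.ofReal_add hL'0 (by positivity)]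
    refine add_le_add ?_ ?_
    · refine (besovNorm_const_mul_le (by linarith)).trans ?_
      calc ENNReal.ofReal (1 - ε) * besovNorm φ ψ s p q f₀ ≤ 1 * ENNReal.ofReal L₀ := by
            gcongr
            exact ENNReal.ofReal_le_one.2 (by linarith)
        _ ≤ _ := by rw [one_mul]; exact ENNReal.ofReal_le_ofReal (le_max_left _ _)
    · refine (besovNorm_const_mul_le hε0.le).trans_eq ?_
      rw [ENNReal.ofReal_mul hε0.le, hH, ENNReal.ofReal_toReal hhJ.ne]
  · have h1 := hhb x hx
    have h2 : 0 ≤ (1 - ε) * f₀ x := mul_nonneg (by linarith) (hf0 x)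
    nlinarith

end LowerBound

end PrivateWavelet

namespace PrivateWavelet

/-! ### Calibration of the perturbations and the minimax rate -/

section MinimaxRate

variable {A B : ℝ} {φ ψ : ℝ → ℝ} {s p r : ℝ} {q : ℝ≥0∞}

theorem OrthonormalShifts.lintegral_rpow_ne_zero (hψ : BoundedSupported A B ψ)
    (ho : OrthonormalShifts ψ) (hr : 0 < r) : ∫⁻ x, ‖ψ x‖ₑ ^ r ≠ 0 := by
  intro h
  rw [lintegral_eq_zero_iff (hψ.measurable.enorm.pow_const r)] at h
  have h1 := ho.2 0 0
  rw [integral_congr_ae (g := fun _ => (0 : ℝ))] at h1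
  · simp at h1
  · filter_upwards [h] with x hx
    have h2 : ψ x = 0 := by simpa [hr] using hx
    simp [h2]

/-- At level `j₁` the `2^{j₁}` spaced cells would spread over a length of about `D`; the fixed extra
level `j₀` shrinks this into `[-T, T]`. -/
theorem abs_le_of_mem_cell {T : ℝ} {D : ℤ} {j₀ j₁ m : ℕ} (hD : 0 ≤ D) (hA : 0 ≤ A)
    (hj₀ : (D : ℝ) + A ≤ 2 ^ j₀ * T) (hm : m < 2 ^ j₁) {x : ℝ} (hx : x ∈ cell A (j₁ + j₀) D m) :
    |x| ≤ T := by
  have h1 : |(2 : ℝ) ^ (j₁ + j₀) * x - D * m| ≤ A := by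
    have h2 : |(2 : ℝ) ^ ((j₁ + j₀ : ℕ) : ℤ) * x - (D * (m : ℤ) : ℤ)| ≤ A := hx
    rw [zpow_natCast] at h2
    push_cast at h2
    exact h2
  have hD' : (0 : ℝ) ≤ D := by exact_mod_cast hD
  have hm' : (m : ℝ) ≤ 2 ^ j₁ := by exact_mod_cast hm.le
  have h3 : |(2 : ℝ) ^ (j₁ + j₀) * x| ≤ D * 2 ^ j₁ + A := by
    calc |(2 : ℝ) ^ (j₁ + j₀) * x| = |(2 ^ (j₁ + j₀) * x - D * m) + D * m| := by ring_nf
      _ ≤ |(2 : ℝ) ^ (j₁ + j₀) * x - D * m| + |(D : ℝ) * m| := abs_add_le _ _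
      _ ≤ A + D * 2 ^ j₁ := by
        rw [abs_of_nonneg (a := (D : ℝ) * m) (by positivity)]
        gcongr
      _ = _ := add_comm _ _
  have h4 : (1 : ℝ) ≤ 2 ^ j₁ := one_le_pow₀ one_le_two
  rw [abs_mul, abs_of_pos (by positivity), pow_add] at h3
  have h5 : (0 : ℝ) < 2 ^ j₁ * 2 ^ j₀ := by positivity
  refine le_of_mul_le_mul_left (h3.trans ?_) h5
  calc (D : ℝ) * 2 ^ j₁ + A ≤ 2 ^ j₁ * (D + A) := by nlinarith
    _ ≤ 2 ^ j₁ * (2 ^ j₀ * T) := by gcongr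
    _ = _ := by ring

set_option maxHeartbeats 1000000 in
/-- The lower bound `c 2^{-j₁ r s}` for the private minimax risk, in terms of the largest
resolution level `j₁` that the privacy constraint leaves undetected. -/
theorem exists_le_privateMinimaxRisk {N : ℕ} {L L₀ T : ℝ} (hφ : BoundedSupported A B φ)
    (hψ : BoundedSupported A B ψ) (hA : 0 ≤ A) (hf : RegularFather N φ)
    (hw : IsMotherWavelet φ ψ) (hs : 0 < s) (hsN : s < N + 1) (hp : 1 ≤ p) (hr : 1 ≤ r)
    (hq : 1 ≤ q) (hT : 0 < T) (hL : 0 < L) (hL₀ : L₀ < L)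
    (hne : (densityClass φ ψ s p q L₀ T).Nonempty) (αbar : ℝ) (C₁ : ℝ) :
    ∃ c : ℝ, 0 < c ∧ ∀ (n : ℕ) (α : ℝ) (j₁ : ℕ), 0 < α → α ≤ αbar →
      n * α ^ 2 ≤ C₁ * (2 : ℝ) ^ ((j₁ : ℝ) * (2 * s + 2)) →
      ENNReal.ofReal (c * (2 : ℝ) ^ (-((j₁ : ℝ) * (r * s)))) ≤
        privateMinimaxRisk.{u} r (densityClass φ ψ s p q L T) n α := by
  have hB := hψ.nonneg
  have hr0 : 0 < r := one_pos.trans_le hr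
  obtain ⟨f, L₁, β, hL₁0, hL₁L, hβ0, hfD, hfβ⟩ :=
    exists_interior_density hφ hψ hA hf hw hsN hp hq hT hL hL₀ hne
  obtain ⟨-, -, h0⟩ := exists_boundedSupported_iterate_tailIntegral hφ hψ hA hf hw
  set D : ℤ := 2 * ⌈A⌉ + 1 with hD
  have hD2 : 2 * A < D := by
    rw [hD]; push_cast; linarith [Int.le_ceil A]
  have hD0 : 0 ≤ D := by
    have : (0 : ℝ) ≤ D := by linarith
    exact_mod_cast this
  obtain ⟨j₀, hj₀⟩ : ∃ j₀ : ℕ, (D : ℝ) + A ≤ 2 ^ j₀ * (T / 2) := by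
    obtain ⟨j₀, h⟩ := pow_unbounded_of_one_lt (((D : ℝ) + A) / (T / 2)) one_lt_two
    exact ⟨j₀, ((div_lt_iff₀ (by positivity)).1 h).le⟩
  obtain ⟨Ψ, hΨ0, hΨ⟩ : ∃ Ψ : ℝ, 0 < Ψ ∧ ENNReal.ofReal Ψ ≤ ∫⁻ x, ‖ψ x‖ₑ ^ r := by
    obtain ⟨y, hy0, hy⟩ := ENNReal.lt_iff_exists_nnreal_btwn.1
      (pos_iff_ne_zero.2 (hw.orthonormal.lintegral_rpow_ne_zero hψ hr0))
    refine ⟨y, ?_, ?_⟩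
    · exact_mod_cast hy0
    · rw [ENNReal.ofReal_coe_nnreal]; exact hy.le
  set a₁ := (2 : ℝ) ^ ((j₀ : ℝ) * (s + 1 / 2 - 1 / p)) with ha₁
  set a₂ := (2 : ℝ) ^ ((j₀ : ℝ) / 2) with ha₂
  have ha₁0 : 0 < a₁ := by positivity
  have ha₂0 : 0 < a₂ := by positivity
  -- The first entry is dictated by the Besov radius, the second by positivity; `B + 1` avoids a
  -- division by zero.
  set η := min ((L - L₁) / a₁) (β / (a₂ * (B + 1))) with hη
  have hη0 : 0 < η := lt_min (div_pos (by linarith) ha₁0) (by positivity)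
  have hη1 : η * a₁ ≤ L - L₁ := (le_div_iff₀ ha₁0).1 (min_le_left _ _)
  have hη2 : η * (a₂ * (B + 1)) ≤ β := (le_div_iff₀ (by positivity)).1 (min_le_right _ _)
  set E := 4 * η * A * B * Real.exp αbar with hE
  have hE0 : 0 ≤ E := by positivity
  set κ := Real.exp (C₁ * E ^ 2) with hκ
  have hκ0 : 0 < κ := Real.exp_pos _
  refine ⟨(2 * η) ^ r * (2 : ℝ) ^ ((j₀ : ℝ) * (r / 2 - 1)) * Ψ / 2 ^ (r - 1) / (4 * κ) / 2,
    by positivity, fun n α j₁ hα hαb hn => ?_⟩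
  -- With `2^{j₁}` wavelets this amplitude keeps the Besov norm of the perturbation constant in
  -- `j₁`, for every `p` and `q`, while its sup norm is of order `2^{-j₁ s}`.
  set γ := η * (2 : ℝ) ^ (-((j₁ : ℝ) * (s + 1 / 2))) with hγ
  have hγ0 : 0 < γ := by positivity
  have hF : ∀ v : Fin (2 ^ j₁) → Bool, (fun x => f x + perturbation ψ γ (j₁ + j₀) D v x) ∈
      densityClass φ ψ s p q L T := by
    refine fun v => add_perturbation_mem_densityClass hφ hψ hf.mra hw h0 hp hq hA hD2 hγ0.le hL₁0
      hfD (by linarith) hfβ ?_ ?_ (fun m hm x hx => abs_le_of_mem_cell hD0 hA hj₀ hm hx) v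
    · refine le_trans (le_of_eq ?_) hη1
      have h1 : (2 : ℝ) ^ (((j₁ + j₀ : ℕ) : ℝ) * (s + 1 / 2 - 1 / p)) *
          (2 : ℝ) ^ ((j₁ : ℝ) * (1 / p)) * (2 : ℝ) ^ (-((j₁ : ℝ) * (s + 1 / 2))) = a₁ := by
        rw [← Real.rpow_add two_pos, ← Real.rpow_add two_pos, ha₁]
        congr 1
        push_cast
        ring
      rw [← h1, hγ]
      push_cast
      rw [← Real.rpow_natCast_mul two_pos.le]
      ring
    · have h1 : (2 : ℝ) ^ (-((j₁ : ℝ) * (s + 1 / 2))) * (2 : ℝ) ^ (((j₁ + j₀ : ℕ) : ℝ) / 2) =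
          a₂ * (2 : ℝ) ^ (-((j₁ : ℝ) * s)) := by
        rw [← Real.rpow_add two_pos, ha₂, ← Real.rpow_add two_pos]
        congr 1
        push_cast
        ring
      have h2 : (2 : ℝ) ^ (-((j₁ : ℝ) * s)) ≤ 1 :=
        Real.rpow_le_one_of_one_le_of_nonpos one_le_two (by
          have : 0 ≤ (j₁ : ℝ) * s := by positivity
          linarith)
      calc γ * ((2 : ℝ) ^ (((j₁ + j₀ : ℕ) : ℝ) / 2) * B) =
            η * ((2 : ℝ) ^ (-((j₁ : ℝ) * (s + 1 / 2))) * (2 : ℝ) ^ (((j₁ + j₀ : ℕ) : ℝ) / 2)) * B := by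
            rw [hγ]; ring
        _ = η * a₂ * B * (2 : ℝ) ^ (-((j₁ : ℝ) * s)) := by rw [h1]; ring
        _ ≤ η * a₂ * B * 1 := by gcongr
        _ ≤ β := by nlinarith [mul_pos hη0 ha₂0]
  -- The `L¹` distance of neighbours is of order `γ 2^{-j₁/2}`. The bound on `α` enters through `e^α
  -- - 1 ≤ α e^{αbar}`, absorbed in `E`.
  set d := α * (2 : ℝ) ^ (-((j₁ : ℝ) * (s + 1))) * E with hd
  have hd0 : 0 ≤ d := by positivity
  have hdle : (Real.exp α - 1) *
      (2 * γ * ((2 : ℝ) ^ (-(((j₁ + j₀ : ℕ) : ℝ) / 2)) * (2 * A * B))) ≤ d := by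
    have h1 : Real.exp α - 1 ≤ α * Real.exp αbar := by
      have h2 : Real.exp α ≤ Real.exp αbar := Real.exp_le_exp.2 hαb
      have h3 := Real.add_one_le_exp (-α)
      have h4 : Real.exp α * Real.exp (-α) = 1 := by rw [← Real.exp_add]; simp
      nlinarith [Real.exp_pos α]
    have h2 : (2 : ℝ) ^ (-((j₁ : ℝ) * (s + 1 / 2))) * (2 : ℝ) ^ (-(((j₁ + j₀ : ℕ) : ℝ) / 2)) ≤
        (2 : ℝ) ^ (-((j₁ : ℝ) * (s + 1))) := by
      rw [← Real.rpow_add two_pos]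
      refine Real.rpow_le_rpow_of_exponent_le one_le_two ?_
      push_cast
      have : (0 : ℝ) ≤ j₀ := by positivity
      nlinarith
    calc (Real.exp α - 1) * (2 * γ * ((2 : ℝ) ^ (-(((j₁ + j₀ : ℕ) : ℝ) / 2)) * (2 * A * B)))
        ≤ (α * Real.exp αbar) *
          (2 * γ * ((2 : ℝ) ^ (-(((j₁ + j₀ : ℕ) : ℝ) / 2)) * (2 * A * B))) := by gcongr
      _ = α * Real.exp αbar * (4 * η * A * B) * ((2 : ℝ) ^ (-((j₁ : ℝ) * (s + 1 / 2))) *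
          (2 : ℝ) ^ (-(((j₁ + j₀ : ℕ) : ℝ) / 2))) := by rw [hγ]; ring
      _ ≤ α * Real.exp αbar * (4 * η * A * B) * (2 : ℝ) ^ (-((j₁ : ℝ) * (s + 1))) := by gcongr
      _ = d := by rw [hd, hE]; ring
  have hκle : (1 + d ^ 2) ^ n ≤ κ := by
    have h1 : (1 + d ^ 2) ^ n ≤ Real.exp (n * d ^ 2) := by
      rw [Real.exp_nat_mul]
      exact pow_le_pow_left₀ (by positivity) (by linarith [Real.add_one_le_exp (d ^ 2)]) n
    refine h1.trans (Real.exp_le_exp.2 ?_)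
    have h2 : ((2 : ℝ) ^ (-((j₁ : ℝ) * (s + 1)))) ^ 2 * (2 : ℝ) ^ ((j₁ : ℝ) * (2 * s + 2)) = 1 := by
      rw [← Real.rpow_mul_natCast two_pos.le, ← Real.rpow_add two_pos]
      convert! Real.rpow_zero (2 : ℝ) using 2
      push_cast
      ring
    calc (n : ℝ) * d ^ 2 = n * α ^ 2 * ((2 : ℝ) ^ (-((j₁ : ℝ) * (s + 1)))) ^ 2 * E ^ 2 := by
          rw [hd]; ring
      _ ≤ C₁ * (2 : ℝ) ^ ((j₁ : ℝ) * (2 * s + 2)) *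
          ((2 : ℝ) ^ (-((j₁ : ℝ) * (s + 1)))) ^ 2 * E ^ 2 := by gcongr
      _ = C₁ * (((2 : ℝ) ^ (-((j₁ : ℝ) * (s + 1)))) ^ 2 *
          (2 : ℝ) ^ ((j₁ : ℝ) * (2 * s + 2))) * E ^ 2 := by ring
      _ = C₁ * E ^ 2 := by rw [h2, mul_one]
  refine le_trans (ENNReal.ofReal_le_ofReal (le_of_eq ?_))
    (le_privateMinimaxRisk hψ hA hD2 hr hγ0 hfD.1 hF
      (fun g hg => ⟨hg.1, hg.2.1, hg.2.2.1, hg.2.2.2.1⟩) hΨ0 hΨ hα.le hdle hκle)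
  -- Balance: number of cells times the separation per cell, `2^{j₁} · γ^r · 2^{j₁(r/2-1)}`, is of
  -- order `2^{-j₁ r s}`.
  have h1 : (2 : ℝ) ^ (j₁ : ℝ) * (2 : ℝ) ^ (-((j₁ : ℝ) * (s + 1 / 2)) * r) *
      (2 : ℝ) ^ (((j₁ + j₀ : ℕ) : ℝ) * (r / 2 - 1)) =
      (2 : ℝ) ^ ((j₀ : ℝ) * (r / 2 - 1)) * (2 : ℝ) ^ (-((j₁ : ℝ) * (r * s))) := by
    rw [← Real.rpow_add two_pos, ← Real.rpow_add two_pos, ← Real.rpow_add two_pos]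
    congr 1
    push_cast
    ring
  have h2 : (2 * γ) ^ r = (2 * η) ^ r * (2 : ℝ) ^ (-((j₁ : ℝ) * (s + 1 / 2)) * r) := by
    rw [hγ, ← mul_assoc, Real.mul_rpow (by positivity) (by positivity), ← Real.rpow_mul two_pos.le]
  rw [h2]
  push_cast at h1 ⊢
  rw [← Real.rpow_natCast 2 j₁]
  calc _ = (2 * η) ^ r * Ψ / 2 ^ (r - 1) / (4 * κ) / 2 *
        ((2 : ℝ) ^ ((j₀ : ℝ) * (r / 2 - 1)) * (2 : ℝ) ^ (-((j₁ : ℝ) * (r * s)))) := by ring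
    _ = _ := by rw [← h1]; ring

/-! ### Resolution levels -/

variable {t α : ℝ} {n : ℕ}

theorem resolution_pos (t : ℝ) (hn : 1 ≤ n) (hα : 0 < α) : 0 < resolution t n α := by
  have : (0 : ℝ) < n := by exact_mod_cast hn
  exact lt_min (by positivity) (by positivity)

theorem resolution_rpow_le_rate (ht : 0 < t) (r : ℝ) (hn : 1 ≤ n) (hα : 0 < α) :
    resolution t n α ^ (-(r * t)) ≤ rate r t n α := by
  have hn0 : (0 : ℝ) < n := by exact_mod_cast hn
  unfold resolution rate
  rcases min_choice (((n : ℝ) * α ^ 2) ^ (1 / (2 * t + 2))) ((n : ℝ) ^ (1 / (2 * t + 1))) with h | h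
  · rw [h, ← Real.rpow_mul (by positivity)]
    refine le_trans (le_of_eq ?_) (le_max_left _ _)
    congr 1
    field_simp
  · rw [h, ← Real.rpow_mul (by positivity)]
    refine le_trans (le_of_eq ?_) (le_max_right _ _)
    congr 1
    field_simp

theorem rpow_resolution_le (ht : 0 < t) (hn : 1 ≤ n) (hα : 0 < α) :
    resolution t n α ^ (2 * t + 1) ≤ n ∧ resolution t n α ^ (2 * t + 2) ≤ n * α ^ 2 := by
  have hn0 : (0 : ℝ) < n := by exact_mod_cast hn
  have hR := (resolution_pos t hn hα).le
  constructor
  · refine (Real.rpow_le_rpow hR (min_le_right _ _) (by positivity)).trans_eq ?_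
    rw [← Real.rpow_mul hn0.le, one_div_mul_cancel (by positivity), Real.rpow_one]
  · refine (Real.rpow_le_rpow hR (min_le_left _ _) (by positivity)).trans_eq ?_
    rw [← Real.rpow_mul (by positivity), one_div_mul_cancel (by positivity), Real.rpow_one]

/-- If the nonprivate term is the minimum, then `nα² ≤ αbar² n`, and `n` is at most its power with
exponent `(2t+2)/(2t+1) ≥ 1`. Hence for bounded `α` the private lower bound suffices in both
regimes. -/
theorem mul_sq_le_rpow_resolution (ht : 0 < t) (hn : 1 ≤ n) (hα : 0 < α) {αbar : ℝ}
    (hαb : α ≤ αbar) :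
    n * α ^ 2 ≤ max 1 (αbar ^ 2) * resolution t n α ^ (2 * t + 2) := by
  have hn1 : (1 : ℝ) ≤ n := by exact_mod_cast hn
  have hn0 : (0 : ℝ) < n := by exact_mod_cast hn
  unfold resolution
  rcases min_choice (((n : ℝ) * α ^ 2) ^ (1 / (2 * t + 2))) ((n : ℝ) ^ (1 / (2 * t + 1))) with h | h
  · rw [h, ← Real.rpow_mul (by positivity), one_div_mul_cancel (by positivity), Real.rpow_one]
    exact le_mul_of_one_le_left (by positivity) (le_max_left _ _)
  · rw [h, mul_comm]
    have h1 : (n : ℝ) ≤ ((n : ℝ) ^ (1 / (2 * t + 1))) ^ (2 * t + 2) := by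
      rw [← Real.rpow_mul hn0.le]
      refine (Real.rpow_one (n : ℝ)).symm.trans_le (Real.rpow_le_rpow_of_exponent_le hn1 ?_)
      rw [one_div_mul_eq_div, le_div_iff₀ (by positivity)]
      linarith
    have h2 : α ^ 2 ≤ max 1 (αbar ^ 2) := (pow_le_pow_left₀ hα.le hαb 2).trans (le_max_right _ _)
    gcongr

theorem WaveletPair.exists_boundedSupported {N : ℕ} (hw : WaveletPair N A φ ψ) :
    ∃ B : ℝ, 0 < B ∧ BoundedSupported A B φ ∧ BoundedSupported A B ψ := by
  obtain ⟨Φ, ⟨B₁, hB₁⟩, -, hΦ, -, -⟩ := hw.father.decay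
  obtain ⟨B₂, hB₂⟩ := hw.bounded_mother
  refine ⟨max 1 (max B₁ B₂), lt_max_of_lt_left one_pos,
    ⟨hw.measurable_father, fun x => ?_, hw.support_father⟩,
    ⟨hw.measurable_mother, fun x => ?_, hw.support_mother⟩⟩
  · exact ((hΦ x).trans (hB₁ _ (abs_nonneg x))).trans ((le_max_left _ _).trans (le_max_right _ _))
  · exact (hB₂ x).trans ((le_max_right _ _).trans (le_max_right _ _))

end MinimaxRate

end PrivateWavelet

/-! ### Comparison of the upper and lower bounds -/

theorem corollary4p2
    (N : ℕ) (A : ℝ) (φ ψ : ℝ → ℝ) (hw : PrivateWavelet.WaveletPair N A φ ψ)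
    (s p r : ℝ) (q : ℝ≥0∞) (hs : 0 < s) (hsN : s < N + 1) (hp : 1 ≤ p) (hr : 1 ≤ r) (hq : 1 ≤ q)
    (hs' : 0 < PrivateWavelet.effSmoothness s p r)
    (L T : ℝ) (hL : 0 < L) (hT : 0 < T)
    (c₁ c₂ : ℝ) (hc₁ : 0 < c₁) (hc₂ : 0 < c₂) :
    (∃ C : ℝ, 0 < C ∧ ∀ (n : ℕ) (α : ℝ) (j₁ : ℕ), 1 ≤ n → 0 < α →
      c₁ * PrivateWavelet.resolution (PrivateWavelet.effSmoothness s p r) n α ≤ (2 : ℝ) ^ j₁ →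
      (2 : ℝ) ^ j₁ ≤ c₂ * PrivateWavelet.resolution (PrivateWavelet.effSmoothness s p r) n α →
      (⨆ f ∈ PrivateWavelet.densityClass φ ψ s p q L T,
          PrivateWavelet.linearRisk φ ψ A T r j₁ n α f) ≤
        ENNReal.ofReal
          (C * PrivateWavelet.rate r (PrivateWavelet.effSmoothness s p r) n α)) ∧
    (r ≤ p →
      (∃ L₀ : ℝ, L₀ < L ∧ (PrivateWavelet.densityClass φ ψ s p q L₀ T).Nonempty) →
      ∀ αbar : ℝ, 0 < αbar → ∃ C : ℝ, 0 < C ∧ ∀ (n : ℕ) (α : ℝ) (j₁ : ℕ),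
        1 ≤ n → 0 < α → α ≤ αbar →
        c₁ * PrivateWavelet.resolution (PrivateWavelet.effSmoothness s p r) n α ≤ (2 : ℝ) ^ j₁ →
        (2 : ℝ) ^ j₁ ≤ c₂ * PrivateWavelet.resolution (PrivateWavelet.effSmoothness s p r) n α →
        PrivateWavelet.LocallyPrivate α (PrivateWavelet.laplaceChannel φ ψ A T j₁ α) ∧
        (⨆ f ∈ PrivateWavelet.densityClass φ ψ s p q L T,
            PrivateWavelet.linearRisk φ ψ A T r j₁ n α f) ≤
          ENNReal.ofReal C *
            PrivateWavelet.privateMinimaxRisk.{u} r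
              (PrivateWavelet.densityClass φ ψ s p q L T) n α) := by
  open PrivateWavelet in
  obtain ⟨B, hB, hφ, hψ⟩ := hw.exists_boundedSupported
  have hm := hw.father.mra
  have hA : 0 ≤ A := (hm.orthonormal.pos_of_supported hφ.support).le
  set t := effSmoothness s p r with ht
  have hr0 : 0 < r := one_pos.trans_le hr
  set K := max (c₂ ^ (2 * t + 1)) (c₂ ^ (2 * t + 2)) with hK
  have hK0 : 0 < K := lt_max_of_lt_left (by positivity)
  obtain ⟨C, hC, hup⟩ := exists_linearRisk_le (q := q) hφ hψ hA hB hT hm hw.mother hL.le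
    (one_pos.trans_le hq).ne' hp hr hs' hK0.le
  -- The bound is kept in terms of `j₁`: the first claim converts it into the rate, while the second
  -- compares it with the lower bound at the same `j₁`.
  have hbound : ∀ (n : ℕ) (α : ℝ) (j₁ : ℕ), 1 ≤ n → 0 < α →
      (2 : ℝ) ^ j₁ ≤ c₂ * resolution t n α →
      (⨆ f ∈ densityClass φ ψ s p q L T, linearRisk φ ψ A T r j₁ n α f) ≤
        ENNReal.ofReal (C * (2 : ℝ) ^ (-((j₁ : ℝ) * (r * t)))) := by
    intro n α j₁ hn hα hle
    have hR := resolution_pos t hn hα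
    obtain ⟨h1, h2⟩ := rpow_resolution_le hs' hn hα
    have hpow : ∀ e : ℝ, 0 ≤ e →
        (2 : ℝ) ^ ((j₁ : ℝ) * e) ≤ c₂ ^ e * resolution t n α ^ e := fun e he => by
      rw [← Real.mul_rpow hc₂.le hR.le, Real.rpow_natCast_mul two_pos.le]
      exact Real.rpow_le_rpow (by positivity) hle he
    refine iSup₂_le fun f hf => hup n α j₁ hn hα ?_ ?_ f hf
    · refine (hpow _ (by positivity)).trans ?_
      exact mul_le_mul (le_max_left _ _) h1 (by positivity) hK0.le
    · refine (hpow _ (by positivity)).trans ?_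
      exact mul_le_mul (le_max_right _ _) h2 (by positivity) hK0.le
  refine ⟨⟨C * c₁ ^ (-(r * t)), by positivity, fun n α j₁ hn hα h1 h2 => ?_⟩, ?_⟩
  · refine (hbound n α j₁ hn hα h2).trans (ENNReal.ofReal_le_ofReal ?_)
    have hR := resolution_pos t hn hα
    rw [mul_assoc]
    refine mul_le_mul_of_nonneg_left ?_ hC.le
    calc (2 : ℝ) ^ (-((j₁ : ℝ) * (r * t))) = ((2 : ℝ) ^ j₁) ^ (-(r * t)) := by
          rw [← Real.rpow_natCast_mul two_pos.le]
          congr 1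
          ring
      _ ≤ (c₁ * resolution t n α) ^ (-(r * t)) :=
          Real.rpow_le_rpow_of_nonpos (by positivity) h1 (neg_nonpos.2 (by positivity))
      _ = c₁ ^ (-(r * t)) * resolution t n α ^ (-(r * t)) := Real.mul_rpow hc₁.le hR.le
      _ ≤ _ := by
          gcongr
          exact resolution_rpow_le_rate hs' r hn hα
  · rintro hrp ⟨L₀, hL₀, hne⟩ αbar -
    have hts : t = s := by
      have h1 : 1 / p ≤ 1 / r := one_div_le_one_div_of_le hr0 hrp
      rw [ht, effSmoothness, max_eq_right (by linarith), sub_zero]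
    -- The lower inequality in `(*)` is solved for the resolution and inserted into the bound for
    -- `nα²`.
    set C₁ := max 1 (αbar ^ 2) * c₁ ^ (-(2 * t + 2)) with hC₁
    obtain ⟨c, hc, hlow⟩ := exists_le_privateMinimaxRisk.{u} hφ hψ hA hw.father hw.mother hs hsN hp
      hr hq hT hL hL₀ hne αbar C₁
    refine ⟨C / c, by positivity, fun n α j₁ hn hα hαb h1 h2 => ⟨?_, ?_⟩⟩
    · exact locallyPrivate_laplaceChannel hφ hψ hA hm.orthonormal hw.mother.orthonormal hα T j₁
    · refine (hbound n α j₁ hn hα h2).trans ?_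
      have hR := resolution_pos t hn hα
      have h3 : n * α ^ 2 ≤ C₁ * (2 : ℝ) ^ ((j₁ : ℝ) * (2 * s + 2)) := by
        refine (mul_sq_le_rpow_resolution hs' hn hα hαb).trans ?_
        rw [hC₁, mul_assoc, ← hts]
        refine mul_le_mul_of_nonneg_left ?_ (by positivity)
        rw [Real.rpow_neg hc₁.le, ← div_eq_inv_mul, le_div_iff₀ (by positivity), mul_comm,
          ← Real.mul_rpow hc₁.le hR.le, Real.rpow_natCast_mul two_pos.le]
        exact Real.rpow_le_rpow (by positivity) h1 (by positivity)
      have h4 := hlow n α j₁ hα hαb h3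
      calc ENNReal.ofReal (C * (2 : ℝ) ^ (-((j₁ : ℝ) * (r * t)))) =
            ENNReal.ofReal (C / c) * ENNReal.ofReal (c * (2 : ℝ) ^ (-((j₁ : ℝ) * (r * s)))) := by
            rw [← ENNReal.ofReal_mul (by positivity), hts]
            congr 1
            field_simp
        _ ≤ _ := by gcongr
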